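/- **Setting.** Let $d\ge 0$ and $n\ge d+2$ be integers, write $\mathbb R^n=\mathbb R^d\times\mathbb R^{n-d}\ni X=(x,t)$, identify $\mathbb R^d$ with $\{t=0\}$, and put $\delta(X)=|t|$. $\mathcal H^d$ is the Hausdorff measure normalised to agree with Lebesgue measure on $d$-planes. A matrix $T$ is elliptic with constant $\lambda$ if $\lambda^{-1}|\xi|^2\le\langle T\xi,\xi\rangle\le\lambda|\xi|^2$ for all $\xi$. *Higher co-dimensional $C^{0,1}$ condition.* A matrix field $A$ satisfies it in $B_R(X_0)$ with constants $\lambda,C_0>0$ if, on $B_R(X_0)\setminus\mathbb R^d$, $A$ is locally Lipschitz and symmetric, $\delta^{n-d-1}A$ is elliptic with constant $\lambda$, and $|\nabla A|\le C_0\,\delta^{-(n-d)}$; and if $\mathcal A=\delta^{n-d-1}A$ extends to a Lipschitz field on $B_R(X_0)$ for which there are a Lipschitz field $J$ of symmetric $d\times d$ matrices, elliptic with constant $\lambda$, and a Lipschitz scalar $h$ with $\lambda^{-1}\le h\le\lambda$, such that in $B_R(X_0)$ $$|\nabla\mathcal A|+|\nabla J|+|\nabla h|\le C_0,\qquad \left|\mathcal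 A-\begin{pmatrix}J&0\\0&h\,I_{n-d}\end{pmatrix}\right|\le C_0\,\delta .$$ *The map $\rho$.* Fix a smooth, nonnegative, radial $\eta$ on $\mathbb R^d$ supported in the unit ball with $\int\eta=1$, and a smooth $\theta$ on $\mathbb R^n$ with $\chi_{B_{1/2}}\le\theta\le\chi_{B_1}$. Let $\beta>1$, $a_0>0$, $c_\beta=\int_{\mathbb R^d}(1+|y|^2)^{-(d+\beta)/2}dy$. Suppose that the set $\Gamma$ is, near the origin, the graph of a $C^{1,1}$ function $\psi$. With $r=|t|$, $\psi_r=\eta_r*\psi$ (where $\eta_r(x)=r^{-d}\eta(x/r)$ and $\psi_0=\psi$) and $\Phi_r(x)=(x,\psi_r(x))$, define $$\rho(x,t)=\Phi_r(x)+h(x,r)R_{x,r}(0,t),\quad h=(c_\beta\lambda(x,r))^{1/\beta},\quad \lambda(x,r)=a_0^{-1}r^{-d}\int_\Gamma\theta\Big(\frac{\Phi_r(x)-Y}{r}\Big)d\mathcal H^d(Y),$$ where $R_{x,r}$ is the linear map sending the standard basis to $v^1,\dots,v^d,w^{d+1},\dots,w^n$, with $(v^i)$ and $(w^j)$ obtained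 by Gram–Schmidt from $\hat v^i=\partial_{x_i}\Phi_r(x)$ and from $\hat w^j=(-\nabla\psi_r^j(x),e^j)$. When $\Gamma=\mathbb R^d$, $\rho(x,t)=(x,\kappa t)$ with $\kappa=\big(c_\beta a_0^{-1}\int_{\mathbb R^d}\theta(y,0)\,dy\big)^{1/\beta}$. *The conjugated matrix.* With $D_\beta(X)=\big(\int_\Gamma|X-Y|^{-d-\beta}d\mathcal H^d(Y)\big)^{-1/\beta}$ and $\mathrm{Jac}=(\partial_i\rho_j)_{ij}$, put $A_{\rho,\beta}=|t|^{-n+d+1}\mathcal A_{\rho,\beta}$, where $$\mathcal A_{\rho,\beta}(x,t)=\Big(\frac{|t|}{D_\beta(\rho(x,t))}\Big)^{n-d-1}|\det\mathrm{Jac}|\,(\mathrm{Jac}^{-1})^T\mathrm{Jac}^{-1}.$$ **Theorem B.4.** Let $n,d,\eta,\theta$ be as above and $K\ge1$. There are constants $\bar r=\bar r(C_2)>0$, $\lambda=\lambda(\beta,C_A)>0$, $C_0=C_0(\beta,C_2,C_A)>0$, $\lambda'=\lambda'(\beta)>0$ and $\bar r'=\bar r'(\beta,C_2,C_A)>0$,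 depending besides the displayed quantities only on $n,d,\eta,\theta,K$, such that the following holds. Let $\beta>1$ and $a_0>0$ be such that $K^{-1}\le\kappa\le K$, and let $\phi\in C^1(\mathbb R^d;\mathbb R^{n-d})$ be such that $\nabla\phi$ is Lipschitz with constant $C_2$ and the graph $\Gamma$ of $\phi$ is $d$-Ahlfors regular with constant $C_A$, i.e. $C_A^{-1}r^d\le\mathcal H^d(\Gamma\cap B_r(X))\le C_Ar^d$ for all $X\in\Gamma$, $r>0$. Let $X_0\in\Gamma$. There are rigid motions of $\mathbb R^n$ that take $X_0$ to $0$ and the tangent plane of $\Gamma$ at $X_0$ to $\mathbb R^d$. For each of them and each $0<r_0\le\bar r$, the image of $\Gamma$ (again written $\Gamma$) coincides in $B_{4r_0}(0)$ with the graph of a function $\psi\in C^{1,1}(B_{4r_0}\cap\mathbb R^d;\mathbb R^{n-d})$ with $\psi(0)=0$, $\nabla\psi(0)=0$, $|\nabla\psi|\le1$ and $\nabla\psi$ Lipschitz with constant $2C_2$, and for the map $\rho$ built from $\psi$ and $\Gamma$: 1. $\rho$ is bi-Lipschitz on $B_{r_0}(0)$ with constant $2K$: $(2K)^{-1}|X-Y|\le|\rho(X)-\rho(Y)|\le2K|X-Y|$.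 In particular the constant is $2$ if $a_0$ is normalised so that $\kappa=1$ (one may then take $K=1$). 2. $A_{\rho,\beta}$ satisfies the higher co-dimensional $C^{0,1}$ condition in $B_{r_0}(0)$ with constants $\lambda(\beta,C_A)$ and $C_0(\beta,C_2,C_A)$; if moreover $r_0\le\bar r'(\beta,C_2,C_A)$, it does so with constants $\lambda'(\beta)$ and $C_0(\beta,C_2,C_A)$. -/

import Mathlib

open Set MeasureTheory Metric
open scoped NNReal ContDiff

noncomputable section

namespace HigherCodim

/-- Euclidean space `ℝ^k`. -/
abbrev Eu (k : ℕ) := EuclideanSpace ℝ (Fin k)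

/-- The ambient space `ℝ^n = ℝ^d × ℝ^m`, `n = d + m`, with the Euclidean norm and inner product.
Its points are written `(x, t)`, and `ℝ^d` is identified with `{t = 0}`. -/
abbrev Amb (d m : ℕ) := WithLp 2 (Eu d × Eu m)

variable {d m : ℕ}

/-- The point `(x, t)`. -/
def pt (x : Eu d) (t : Eu m) : Amb d m := WithLp.toLp 2 (x, t)

/-- The graph of `φ : ℝ^d → ℝ^m`. -/
def graphSet (φ : Eu d → Eu m) : Set (Amb d m) := range fun x => pt x (φ x)

/-- `S` is `d`-Ahlfors regular with constant `C`. Here `μHE[d]` is the `d`-dimensional Hausdorff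
measure, normalised to agree with Lebesgue measure on `ℝ^d`. -/
def AhlforsRegular (S : Set (Amb d m)) (C : ℝ) : Prop :=
  ∀ X ∈ S, ∀ r : ℝ, 0 < r →
    ENNReal.ofReal (C⁻¹ * r ^ d) ≤ μHE[d] (S ∩ ball X r) ∧
      μHE[d] (S ∩ ball X r) ≤ ENNReal.ofReal (C * r ^ d)

/-! ### The higher co-dimension `C^{0,1}` condition -/

/-- Uniform ellipticity with constant `lam` of one matrix (viewed as a linear map). -/
def Elliptic {E : Type*} [NormedAddCommGroup E] [InnerProductSpace ℝ E]
    (lam : ℝ) (T : E →L[ℝ] E) : Prop :=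
  ∀ ξ : E, lam⁻¹ * ‖ξ‖ ^ 2 ≤ inner ℝ (T ξ) ξ ∧ inner ℝ (T ξ) ξ ≤ lam * ‖ξ‖ ^ 2

/-- The block matrix with diagonal blocks `J` (of size `d`) and `h I_m`. -/
def blockOp (J : Eu d →L[ℝ] Eu d) (h : ℝ) : Amb d m →L[ℝ] Amb d m :=
  ((WithLp.prodContinuousLinearEquiv 2 ℝ (Eu d) (Eu m)).symm : (Eu d × Eu m) →L[ℝ] Amb d m) ∘L
    (J.prodMap (h • ContinuousLinearMap.id ℝ (Eu m))) ∘L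
    ((WithLp.prodContinuousLinearEquiv 2 ℝ (Eu d) (Eu m)) : Amb d m →L[ℝ] (Eu d × Eu m))

/-- The ball `B_R(X₀)` with `ℝ^d = {t = 0}` removed. -/
def offPlane (X₀ : Amb d m) (R : ℝ) : Set (Amb d m) := {X | X ∈ ball X₀ R ∧ X.snd ≠ 0}

/-- The matrix field `A` satisfies the higher co-dimensional `C^{0,1}` condition in `B_R(X₀)` with
constants `lam` and `C₀`. The distance of `X = (x, t)` to `ℝ^d` is `‖t‖ = ‖X.snd‖`, matrices are
viewed as linear maps with the operator norm, and `cA` is the Lipschitz field on the ball that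
equals `‖t‖ ^ (n - d - 1) A` off `ℝ^d`. At a point where a (locally) Lipschitz map is not
differentiable `fderiv` is `0`, so that a bound on it says what an almost everywhere bound says. -/
structure HigherCodimC01 (A : Amb d m → (Amb d m →L[ℝ] Amb d m)) (X₀ : Amb d m)
    (R lam C₀ : ℝ) : Prop where
  locLip : LocallyLipschitzOn (offPlane X₀ R) A
  symm : ∀ X ∈ offPlane X₀ R, IsSelfAdjoint (A X)
  elliptic : ∀ X ∈ offPlane X₀ R, Elliptic lam (‖X.snd‖ ^ (m - 1) • A X)
  grad : ∀ X ∈ offPlane X₀ R, ‖fderiv ℝ A X‖ ≤ C₀ * (‖X.snd‖ ^ m)⁻¹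
  block : ∃ (cA : Amb d m → (Amb d m →L[ℝ] Amb d m)) (J : Amb d m → (Eu d →L[ℝ] Eu d))
      (h : Amb d m → ℝ),
    (∀ X ∈ offPlane X₀ R, cA X = ‖X.snd‖ ^ (m - 1) • A X) ∧
    (∃ L : ℝ≥0, LipschitzOnWith L cA (ball X₀ R) ∧ LipschitzOnWith L J (ball X₀ R) ∧
      LipschitzOnWith L h (ball X₀ R)) ∧
    ∀ X ∈ ball X₀ R,
      IsSelfAdjoint (J X) ∧ Elliptic lam (J X) ∧ lam⁻¹ ≤ h X ∧ h X ≤ lam ∧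
      ‖fderiv ℝ cA X‖ + ‖fderiv ℝ J X‖ + ‖fderiv ℝ h X‖ ≤ C₀ ∧
      ‖cA X - blockOp (J X) (h X)‖ ≤ C₀ * ‖X.snd‖

/-! ### The change of variables -/

/-- The mollifier: smooth, nonnegative, radial, supported in the unit ball, of integral one. -/
structure IsMollifier (η : Eu d → ℝ) : Prop where
  smooth : ContDiff ℝ ∞ η
  nonneg : ∀ x, 0 ≤ η x
  radial : ∀ x y, ‖x‖ = ‖y‖ → η x = η y
  supp : ∀ x, 1 ≤ ‖x‖ → η x = 0
  integral_eq_one : ∫ x, η x = 1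

/-- The cut-off: smooth, with `χ_{B_{1/2}} ≤ θ ≤ χ_{B_1}`. -/
structure IsCutoff (θ : Amb d m → ℝ) : Prop where
  smooth : ContDiff ℝ ∞ θ
  lower : ∀ X, (ball (0 : Amb d m) (1 / 2)).indicator 1 X ≤ θ X
  upper : ∀ X, θ X ≤ (ball (0 : Amb d m) 1).indicator 1 X

/-- `φ_s = η_s * φ`, with the change of variables `y = s z` in the convolution integral. At `s = 0`
this is `φ` itself. -/
def phiS (η : Eu d → ℝ) (φ : Eu d → Eu m) (s : ℝ) (x : Eu d) : Eu m :=
  ∫ z, η z • φ (x - s • z)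

/-- `Φ_s(x) = (x, φ_s(x))`. -/
def PhiS (η : Eu d → ℝ) (φ : Eu d → Eu m) (s : ℝ) (x : Eu d) : Amb d m := pt x (phiS η φ s x)

/-- `v̂^i(x, r) = ∂_{x_i} Φ_r(x)`. -/
def vHat (η : Eu d → ℝ) (φ : Eu d → Eu m) (x : Eu d) (r : ℝ) (i : Fin d) : Amb d m :=
  fderiv ℝ (PhiS η φ r) x (EuclideanSpace.single i 1)

/-- `ŵ^j(x, r) = (-∇ φ_r^j(x), e^j)`. -/
def wHat (η : Eu d → ℝ) (φ : Eu d → Eu m) (x : Eu d) (r : ℝ) (j : Fin m) : Amb d m :=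
  pt (-gradient (fun y => phiS η φ r y j) x) (EuclideanSpace.single j 1)

/-- `R_{x,r}`: the linear map sending the standard basis to `v^1, …, v^d, w^{d+1}, …, w^n`, the
orthonormal families obtained from `v̂^i` and from `ŵ^j` by the Gram-Schmidt procedure. -/
def rot (η : Eu d → ℝ) (φ : Eu d → Eu m) (x : Eu d) (r : ℝ) (Y : Amb d m) : Amb d m :=
  ∑ i, Y.fst i • InnerProductSpace.gramSchmidtNormed ℝ (vHat η φ x r) i +
    ∑ j, Y.snd j • InnerProductSpace.gramSchmidtNormed ℝ (wHat η φ x r) j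

/-- `λ(x, r) = a₀⁻¹ r^{-d} ∫_Γ θ((Φ_r(x) - Y) / r) dH^d(Y)`, with `Γ = S`. -/
def density (η : Eu d → ℝ) (θ : Amb d m → ℝ) (a₀ : ℝ) (S : Set (Amb d m)) (φ : Eu d → Eu m)
    (x : Eu d) (r : ℝ) : ℝ :=
  a₀⁻¹ * (r ^ d)⁻¹ * ∫ Y in S, θ (r⁻¹ • (PhiS η φ r x - Y)) ∂μHE[d]

/-- `c_β = ∫_{ℝ^d} (1 + |y|²)^{-(d+β)/2} dy`. -/
def cBeta (d : ℕ) (β : ℝ) : ℝ := ∫ y : Eu d, (1 + ‖y‖ ^ 2) ^ (-(d + β) / 2)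

/-- `h(x, r) = (c_β λ(x, r))^{1/β}`. -/
def hFun (η : Eu d → ℝ) (θ : Amb d m → ℝ) (a₀ β : ℝ) (S : Set (Amb d m)) (φ : Eu d → Eu m)
    (x : Eu d) (r : ℝ) : ℝ :=
  (cBeta d β * density η θ a₀ S φ x r) ^ (1 / β)

/-- `ρ(x, t) = Φ_r(x) + h(x, r) R_{x,r}(0, t)`, `r = |t|`. Here `φ` is a function whose graph is
`S` near the points under consideration. -/
def rho (η : Eu d → ℝ) (θ : Amb d m → ℝ) (a₀ β : ℝ) (S : Set (Amb d m)) (φ : Eu d → Eu m)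
    (X : Amb d m) : Amb d m :=
  PhiS η φ ‖X.snd‖ X.fst +
    hFun η θ a₀ β S φ X.fst ‖X.snd‖ • rot η φ X.fst ‖X.snd‖ (pt 0 X.snd)

/-- The value of `h` when `Γ` is the plane `ℝ^d`; then `ρ(x, t) = (x, κ t)` with this `κ`. -/
def flatStretch (θ : Amb d m → ℝ) (a₀ β : ℝ) : ℝ :=
  (cBeta d β * (a₀⁻¹ * ∫ y : Eu d, θ (pt y 0))) ^ (1 / β)

/-! ### The conjugated matrix -/

/-- The regularized distance `D_β(X) = (∫_Γ |X - Y|^{-d-β} dH^d(Y))^{-1/β}`, with `Γ = S`. -/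
def regDist (β : ℝ) (S : Set (Amb d m)) (X : Amb d m) : ℝ :=
  (∫ Y in S, (‖X - Y‖ ^ ((d : ℝ) + β))⁻¹ ∂μHE[d]) ^ (-1 / β)

/-- The Jacobian matrix `Jac = ∇ρ`, `Jac_{ij} = ∂_i ρ_j`, which acts on row vectors from the right:
it is the transpose of the matrix of the differential. -/
def jac (ρ : Amb d m → Amb d m) (X : Amb d m) : Amb d m →L[ℝ] Amb d m :=
  ContinuousLinearMap.adjoint (fderiv ℝ ρ X)

/-- `𝒜_{ρ,β} = (|t| / D_β(ρ))^{n-d-1} |det Jac| (Jac⁻¹)ᵀ Jac⁻¹`. -/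
def calA (β : ℝ) (S : Set (Amb d m)) (ρ : Amb d m → Amb d m) (X : Amb d m) :
    Amb d m →L[ℝ] Amb d m :=
  ((‖X.snd‖ / regDist β S (ρ X)) ^ (m - 1) * |(jac ρ X).det|) •
    (ContinuousLinearMap.adjoint (jac ρ X).inverse ∘L (jac ρ X).inverse)

/-- The conjugated matrix `A_{ρ,β} = |t|^{-n+d+1} 𝒜_{ρ,β}`. -/
def conjMatrix (β : ℝ) (S : Set (Amb d m)) (ρ : Amb d m → Amb d m) (X : Amb d m) :
    Amb d m →L[ℝ] Amb d m :=
  (‖X.snd‖ ^ (m - 1))⁻¹ • calA β S ρ X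

/-! ### Localization -/

/-- The rigid motion `U` sends the point `X₀ = (x₀, φ(x₀))` of the graph of `φ` to the origin and
the tangent plane of the graph at `X₀` to `ℝ^d`. -/
def AdaptedMotion (φ : Eu d → Eu m) (x₀ : Eu d) (U : Amb d m ≃ᵃⁱ[ℝ] Amb d m) : Prop :=
  U (pt x₀ (φ x₀)) = 0 ∧ ∀ v : Eu d, (U.linearIsometryEquiv (pt v (fderiv ℝ φ x₀ v))).snd = 0

/-- In the ball `B_R(0)` the set `S` is the graph of the `C^{1,1}` function `ψ`, which vanishes
to first order at the origin. -/
structure LocalGraph (S : Set (Amb d m)) (ψ : Eu d → Eu m) (L : ℝ≥0) (R : ℝ) : Prop where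
  contDiffOn : ContDiffOn ℝ 1 ψ (ball 0 R)
  zero : ψ 0 = 0
  fderiv_zero : fderiv ℝ ψ 0 = 0
  fderiv_le_one : ∀ x ∈ ball (0 : Eu d) R, ‖fderiv ℝ ψ x‖ ≤ 1
  lipschitz : LipschitzOnWith L (fderiv ℝ ψ) (ball 0 R)
  graph : ∀ X ∈ ball (0 : Amb d m) R, X ∈ S ↔ X.snd = ψ X.fst

end HigherCodim

end

open HigherCodim

/-! Localization. A rigid motion and a cut-off turn Γ near X₀ into the graph of a function ψ on all
of ℝ^d with |∇ψ| ≤ ε and ∇ψ L-Lipschitz. Here ε depends only on d, n, η, θ, K, while L depends also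
on C₂ (`exists_flat_graph`, `exists_localModel`). The price is that Γ and the graph may differ
outside a ball B_R with R = R(C₂). On B_{r₀} the map ρ does not see the difference and equals
`modelRho`.

Bi-Lipschitz bound. ρ differs from (x, t) ↦ (x, κt) by a map of Lipschitz constant O(ε)
(`lipOn_modelRho_sub`). The stretching h R is O(ε)-close to κ times the inclusion of ℝ^m, and its
variation, which is O(L), is multiplied by |t| ≤ r₀ with L r₀ ≤ ε.

The Jacobian is Lipschitz. The density λ(x, r) and the mollified gradient of ψ have the form ∫ k(z,
(ψ_r(x) - ψ(x + rz))/r) w(x + rz) dz, with k smooth and supported in |z| ≤ 1 and w only Lipschitz.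
Such integrals are Lipschitz up to r = 0. In the variable y = x + rz the weight no longer depends on
(x, r), so all derivatives fall on the kernel, and r times the gradient is an integral of the same
kind, again Lipschitz (`exists_conicReg_kerInt`). Since ρ contains these functions multiplied by t,
only r∇ of them enters its differential. The discontinuous direction t/|t| also occurs there, but
always next to a Lipschitz factor that vanishes on {t = 0}, and such products are Lipschitz
(`LipOn.mul_dirT`).

The regularized distance. Rescaling gives |t|^β ∫ |ρ - Y|^{-d-β} = ∫ N^{-(d+β)/2} w dz, with N ≥ c(1
+ |z|²). Because R(0, t) is normal to the mollified graph, the cross term of N contains t/|t| only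
next to a quantity of size O(r). The Lipschitz constant of N grows like (1 + |z|)³, so the integrand
loses one power of |z|, and β > 1 is what keeps the integral finite (`lipOn_potential`). Replacing
the graph by Γ adds |t|^β times the difference of two far potentials, which are bounded and
Lipschitz.

Block form. On {t = 0} the radial symmetry of η makes the first-order terms cancel. The Jacobian
then sends ℝ^d to the tangent space and is a similarity of ℝ^m onto the normal space, so (Jac⁻¹)ᵀ
Jac⁻¹ acts on ℝ^m as a scalar (`modelA_of_snd_eq_zero`). The Lipschitz bound gives the O(δ) error.

Ellipticity. The potential is bounded below by the part of Γ near the point, independently of C_A,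
and above by a constant of β plus (r₀/R) times a constant of (β, C_A). Hence λ(β, C_A) in general,
and λ'(β) once r₀ is small (`exists_condition`). -/

set_option linter.unusedSectionVars false

namespace HigherCodim

/-! ### Calculus of Lipschitz maps with explicit constants -/

section LipOn

variable {E F V W Z : Type*} [NormedAddCommGroup E] [NormedAddCommGroup F]
  [NormedAddCommGroup V] [NormedSpace ℝ V] [NormedAddCommGroup W] [NormedSpace ℝ W]
  [NormedAddCommGroup Z] [NormedSpace ℝ Z]

/-- `f` is Lipschitz on `s` with the real constant `C`. -/
def LipOn (C : ℝ) (f : E → F) (s : Set E) : Prop :=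
  ∀ x ∈ s, ∀ y ∈ s, ‖f x - f y‖ ≤ C * ‖x - y‖

namespace LipOn

lemma mono {C C' : ℝ} {f : E → F} {s t : Set E} (h : LipOn C f s) (hC : C ≤ C') (ht : t ⊆ s) :
    LipOn C' f t := fun x hx y hy =>
  (h x (ht hx) y (ht hy)).trans (mul_le_mul_of_nonneg_right hC (norm_nonneg _))

lemma congr {C : ℝ} {f g : E → F} {s : Set E} (h : LipOn C f s) (hfg : ∀ x ∈ s, g x = f x) :
    LipOn C g s := fun x hx y hy => by
  rw [hfg x hx, hfg y hy]; exact h x hx y hy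

lemma const (c : F) (s : Set E) : LipOn 0 (fun _ : E => c) s := fun x _ y _ => by simp

lemma lipschitzOnWith {C : ℝ} {f : E → F} {s : Set E} (h : LipOn C f s) :
    LipschitzOnWith C.toNNReal f s := by
  refine LipschitzOnWith.of_dist_le_mul fun x hx y hy => ?_
  rw [dist_eq_norm, dist_eq_norm]
  exact (h x hx y hy).trans (mul_le_mul_of_nonneg_right (Real.le_coe_toNNReal C) (norm_nonneg _))

lemma continuousOn {C : ℝ} {f : E → F} {s : Set E} (h : LipOn C f s) : ContinuousOn f s :=
  h.lipschitzOnWith.continuousOn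

lemma add {C C' : ℝ} {f g : E → F} {s : Set E} (hf : LipOn C f s) (hg : LipOn C' g s) :
    LipOn (C + C') (fun x => f x + g x) s := fun x hx y hy => by
  have := norm_add_le (f x - f y) (g x - g y)
  have h1 := hf x hx y hy
  have h2 := hg x hx y hy
  rw [show f x + g x - (f y + g y) = f x - f y + (g x - g y) by abel]
  linarith

lemma comp {C C' : ℝ} {f : F → V} {g : E → F} {s : Set E} {t : Set F} (hf : LipOn C f t)
    (hg : LipOn C' g s) (hst : MapsTo g s t) (hC : 0 ≤ C) :
    LipOn (C * C') (fun x => f (g x)) s := fun x hx y hy => by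
  have h1 := hf _ (hst hx) _ (hst hy)
  have h2 := mul_le_mul_of_nonneg_left (hg x hx y hy) hC
  linarith

lemma prodMk {C C' : ℝ} {f : E → V} {g : E → W} {s : Set E} (hf : LipOn C f s)
    (hg : LipOn C' g s) : LipOn (max C C') (fun x => (f x, g x)) s := fun x hx y hy => by
  rw [Prod.mk_sub_mk, Prod.norm_mk]
  refine max_le ((hf x hx y hy).trans ?_) ((hg x hx y hy).trans ?_)
  · exact mul_le_mul_of_nonneg_right (le_max_left _ _) (norm_nonneg _)
  · exact mul_le_mul_of_nonneg_right (le_max_right _ _) (norm_nonneg _)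

lemma bilin {C C' M M' : ℝ} {f : E → V} {g : E → W} {s : Set E} (b : V →L[ℝ] W →L[ℝ] Z)
    (hf : LipOn C f s) (hg : LipOn C' g s) (hM : ∀ x ∈ s, ‖f x‖ ≤ M) (hM' : ∀ x ∈ s, ‖g x‖ ≤ M') :
    LipOn (‖b‖ * (C * M' + M * C')) (fun x => b (f x) (g x)) s := fun x hx y hy => by
  have e : b (f x) (g x) - b (f y) (g y) = b (f x - f y) (g x) + b (f y) (g x - g y) := by
    simp
  rw [e]
  have h1 := b.le_opNorm₂ (f x - f y) (g x)
  have h2 := b.le_opNorm₂ (f y) (g x - g y)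
  have hM0 : 0 ≤ M := (norm_nonneg _).trans (hM x hx)
  have hC0 : 0 ≤ C * ‖x - y‖ := (norm_nonneg _).trans (hf x hx y hy)
  have h3 : ‖b‖ * ‖f x - f y‖ * ‖g x‖ ≤ ‖b‖ * (C * ‖x - y‖) * M' := by
    gcongr
    · exact hf x hx y hy
    · exact hM' x hx
  have h4 : ‖b‖ * ‖f y‖ * ‖g x - g y‖ ≤ ‖b‖ * M * (C' * ‖x - y‖) := by
    gcongr
    · exact hM y hy
    · exact hg x hx y hy
  have := norm_add_le (b (f x - f y) (g x)) (b (f y) (g x - g y))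
  nlinarith

lemma smul {C C' M M' : ℝ} {f : E → ℝ} {g : E → W} {s : Set E}
    (hf : LipOn C f s) (hg : LipOn C' g s) (hM : ∀ x ∈ s, ‖f x‖ ≤ M) (hM' : ∀ x ∈ s, ‖g x‖ ≤ M') :
    LipOn (C * M' + M * C') (fun x => f x • g x) s := fun x hx y hy => by
  have e : f x • g x - f y • g y = (f x - f y) • g x + f y • (g x - g y) := by
    simp [sub_smul, smul_sub]
  rw [e]
  refine (norm_add_le _ _).trans ?_
  rw [norm_smul, norm_smul]
  have hM0 : 0 ≤ M := (norm_nonneg _).trans (hM x hx)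
  have hC0 : 0 ≤ C * ‖x - y‖ := (norm_nonneg _).trans (hf x hx y hy)
  have h3 := mul_le_mul (hf x hx y hy) (hM' x hx) (norm_nonneg _) hC0
  have h4 := mul_le_mul (hM y hy) (hg x hx y hy) (norm_nonneg _) hM0
  nlinarith

lemma mul {C C' M M' : ℝ} {f : E → ℝ} {g : E → ℝ} {s : Set E}
    (hf : LipOn C f s) (hg : LipOn C' g s) (hM : ∀ x ∈ s, ‖f x‖ ≤ M) (hM' : ∀ x ∈ s, ‖g x‖ ≤ M') :
    LipOn (C * M' + M * C') (fun x => f x * g x) s :=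
  hf.smul hg hM hM'

lemma clmComp {C C' M M' : ℝ} {f : E → W →L[ℝ] Z} {g : E → V →L[ℝ] W} {s : Set E}
    (hf : LipOn C f s) (hg : LipOn C' g s) (hM : ∀ x ∈ s, ‖f x‖ ≤ M) (hM' : ∀ x ∈ s, ‖g x‖ ≤ M') :
    LipOn (C * M' + M * C') (fun x => f x ∘L g x) s := fun x hx y hy => by
  have e : f x ∘L g x - f y ∘L g y = (f x - f y) ∘L g x + f y ∘L (g x - g y) := by
    ext v; simp
  rw [e]
  refine (norm_add_le _ _).trans ?_
  have h1 := (f x - f y).opNorm_comp_le (g x)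
  have h2 := (f y).opNorm_comp_le (g x - g y)
  have hM0 : 0 ≤ M := (norm_nonneg _).trans (hM x hx)
  have hC0 : 0 ≤ C * ‖x - y‖ := (norm_nonneg _).trans (hf x hx y hy)
  have h3 := mul_le_mul (hf x hx y hy) (hM' x hx) (norm_nonneg _) hC0
  have h4 := mul_le_mul (hM y hy) (hg x hx y hy) (norm_nonneg _) hM0
  nlinarith

/-- A Lipschitz map has a derivative bounded by the Lipschitz constant. -/
lemma norm_fderiv_le {C : ℝ} (hC : 0 ≤ C) {f : V → W} {s : Set V} {x : V} (h : LipOn C f s)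
    (hs : s ∈ nhds x) : ‖fderiv ℝ f x‖ ≤ C := by
  have := norm_fderiv_le_of_lipschitzOn ℝ hs h.lipschitzOnWith
  rwa [Real.coe_toNNReal C hC] at this

/-- A locally Lipschitz map is Lipschitz on a compact set, convex or not. The constant depends on
`f` and `K` alone, which is how bounds uniform over all admissible ψ arise: data varying in a fixed
compact set are fed into a fixed smooth map. -/
lemma of_contDiffOn {f : V → W} {O K : Set V} (hO : IsOpen O) (hf : ContDiffOn ℝ 1 f O)
    (hK : IsCompact K) (hKO : K ⊆ O) :
    ∃ C, 0 ≤ C ∧ LipOn C f K ∧ ∀ x ∈ K, ‖f x‖ ≤ C := by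
  have hl : LocallyLipschitzOn K f := by
    intro x hx
    obtain ⟨C, t, ht, hC⟩ :=
      (hf.contDiffAt (hO.mem_nhds (hKO hx))).exists_lipschitzOnWith
    exact ⟨C, t, nhdsWithin_le_nhds ht, hC⟩
  obtain ⟨C, hC⟩ := hl.exists_lipschitzOnWith_of_compact hK
  obtain ⟨M, hM⟩ := hK.exists_bound_of_continuousOn (hf.continuousOn.mono hKO)
  refine ⟨max C M, le_max_of_le_left C.2, fun x hx y hy => ?_, fun x hx =>
    (hM x hx).trans (le_max_right _ _)⟩
  have := hC.dist_le_mul x hx y hy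
  rw [dist_eq_norm, dist_eq_norm] at this
  exact this.trans (mul_le_mul_of_nonneg_right (le_max_left _ _) (norm_nonneg _))

lemma of_contDiff [FiniteDimensional ℝ V] {f : V → W} (hf : ContDiff ℝ 1 f) (R : ℝ) :
    ∃ C, 0 ≤ C ∧ LipOn C f (closedBall 0 R) ∧ ∀ x ∈ closedBall (0 : V) R, ‖f x‖ ≤ C :=
  have := FiniteDimensional.proper ℝ V
  of_contDiffOn isOpen_univ hf.contDiffOn (isCompact_closedBall _ _) (subset_univ _)

/-- Integrals of Lipschitz maps are Lipschitz. -/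
lemma integral {α : Type*} [MeasurableSpace α] {μ : Measure α} {f : E → α → W} {c : α → ℝ}
    {s : Set E} (hf : ∀ x ∈ s, Integrable (f x) μ) (hc : Integrable c μ)
    (h : ∀ a, LipOn (c a) (fun x => f x a) s) : LipOn (∫ a, c a ∂μ) (fun x => ∫ a, f x a ∂μ) s := by
  intro x hx y hy
  rw [← integral_sub (hf x hx) (hf y hy), ← integral_mul_const]
  exact norm_integral_le_of_norm_le (hc.mul_const _) (Filter.Eventually.of_forall fun a =>
    h a x hx y hy)

lemma of_hasFDerivAt {C : ℝ} {f : V → W} {f' : V → V →L[ℝ] W} {s : Set V} (hs : Convex ℝ s)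
    (hf : ∀ x ∈ s, HasFDerivAt f (f' x) x) (hC : ∀ x ∈ s, ‖f' x‖ ≤ C) : LipOn C f s :=
  fun x hx y hy => by
    simpa [norm_sub_rev] using
      hs.norm_image_sub_le_of_norm_hasFDerivWithin_le (fun z hz => (hf z hz).hasFDerivWithinAt) hC
        hy hx

end LipOn

lemma integral_lipschitz_bound {α : Type*} [MeasurableSpace α] {μ : Measure α} {f : α → W}
    {c : α → ℝ} (hc : Integrable c μ) (h : ∀ a, ‖f a‖ ≤ c a) : ‖∫ a, f a ∂μ‖ ≤ ∫ a, c a ∂μ :=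
  norm_integral_le_of_norm_le hc (Filter.Eventually.of_forall h)

end LipOn

/-! ### Coordinates on ℝ^d × ℝ^m and the direction t/|t| -/

section Ambient

variable {d m : ℕ} {W Z : Type*} [NormedAddCommGroup W] [NormedSpace ℝ W]
  [NormedAddCommGroup Z] [NormedSpace ℝ Z]

instance : ContinuousSMul ℝ (Amb d m) := IsBoundedSMul.continuousSMul

/-- The map `(x, t) ↦ pt x t` as a continuous linear map. -/
noncomputable def ptL (d m : ℕ) : (Eu d × Eu m) →L[ℝ] Amb d m :=
  ((WithLp.prodContinuousLinearEquiv 2 ℝ (Eu d) (Eu m)).symm : (Eu d × Eu m) →L[ℝ] Amb d m)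

/-- The inclusion `t ↦ (0, t)`. -/
noncomputable def inrL (d m : ℕ) : Eu m →L[ℝ] Amb d m :=
  ptL d m ∘L ContinuousLinearMap.inr ℝ (Eu d) (Eu m)

/-- The inclusion `x ↦ (x, 0)`. -/
noncomputable def inlL (d m : ℕ) : Eu d →L[ℝ] Amb d m :=
  ptL d m ∘L ContinuousLinearMap.inl ℝ (Eu d) (Eu m)

/-- The projection `(x, t) ↦ x`. -/
noncomputable def fstA (d m : ℕ) : Amb d m →L[ℝ] Eu d := WithLp.fstL 2 ℝ (Eu d) (Eu m)

/-- The projection `(x, t) ↦ t`. -/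
noncomputable def sndA (d m : ℕ) : Amb d m →L[ℝ] Eu m := WithLp.sndL 2 ℝ (Eu d) (Eu m)

@[simp] lemma ptL_apply (p : Eu d × Eu m) : ptL d m p = pt p.1 p.2 := rfl
@[simp] lemma inrL_apply (t : Eu m) : inrL d m t = pt 0 t := rfl
@[simp] lemma inlL_apply (x : Eu d) : inlL d m x = pt x 0 := rfl
@[simp] lemma fstA_apply (X : Amb d m) : fstA d m X = X.fst := rfl
@[simp] lemma sndA_apply (X : Amb d m) : sndA d m X = X.snd := rfl
@[simp] lemma pt_fst (x : Eu d) (t : Eu m) : (pt x t).fst = x := rfl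
@[simp] lemma pt_snd (x : Eu d) (t : Eu m) : (pt x t).snd = t := rfl
@[simp] lemma pt_eta (X : Amb d m) : pt X.fst X.snd = X := rfl

lemma pt_add (x x' : Eu d) (t t' : Eu m) : pt x t + pt x' t' = pt (x + x') (t + t') := rfl
lemma pt_sub (x x' : Eu d) (t t' : Eu m) : pt x t - pt x' t' = pt (x - x') (t - t') := rfl
lemma smul_pt (c : ℝ) (x : Eu d) (t : Eu m) : c • pt x t = pt (c • x) (c • t) := rfl

lemma norm_sq_amb (X : Amb d m) : ‖X‖ ^ 2 = ‖X.fst‖ ^ 2 + ‖X.snd‖ ^ 2 :=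
  WithLp.prod_norm_sq_eq_of_L2 X

lemma inner_amb (X Y : Amb d m) :
    inner ℝ X Y = inner ℝ X.fst Y.fst + inner ℝ X.snd Y.snd := rfl

lemma norm_fst_le (X : Amb d m) : ‖X.fst‖ ≤ ‖X‖ := by
  have := norm_sq_amb X
  exact abs_le_of_sq_le_sq' (by nlinarith [sq_nonneg ‖X.snd‖]) (norm_nonneg X) |>.2

lemma norm_snd_le (X : Amb d m) : ‖X.snd‖ ≤ ‖X‖ := by
  have := norm_sq_amb X
  exact abs_le_of_sq_le_sq' (by nlinarith [sq_nonneg ‖X.fst‖]) (norm_nonneg X) |>.2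

lemma norm_le_add (X : Amb d m) : ‖X‖ ≤ ‖X.fst‖ + ‖X.snd‖ := by
  have := norm_sq_amb X
  nlinarith [norm_nonneg X, norm_nonneg X.fst, norm_nonneg X.snd]

@[simp] lemma norm_pt_zero_left (t : Eu m) : ‖(pt 0 t : Amb d m)‖ = ‖t‖ :=
  WithLp.norm_toLp_snd 2 (Eu d) (Eu m) t

@[simp] lemma norm_pt_zero_right (x : Eu d) : ‖(pt x 0 : Amb d m)‖ = ‖x‖ :=
  WithLp.norm_toLp_fst 2 (Eu d) (Eu m) x

lemma norm_inrL_le : ‖inrL d m‖ ≤ 1 :=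
  ContinuousLinearMap.opNorm_le_bound _ zero_le_one fun t => by simp

lemma norm_sndA_le : ‖sndA d m‖ ≤ 1 :=
  ContinuousLinearMap.opNorm_le_bound _ zero_le_one fun t => by simpa using norm_snd_le t

/-- Cylindrical coordinates `(x, |t|)` of the point `(x, t)`. -/
noncomputable def cyl (X : Amb d m) : Eu d × ℝ := (X.fst, ‖X.snd‖)

/-- The direction `t / |t|` of the point `(x, t)`, zero if `t = 0`. -/
noncomputable def dirT (X : Amb d m) : Eu m := ‖X.snd‖⁻¹ • X.snd

/-- The set `{|t| < R}`. -/
def tube (d m : ℕ) (R : ℝ) : Set (Amb d m) := {X | ‖X.snd‖ < R}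

/-- The set of `(x, r)` with `0 ≤ r < R`. -/
def slab (d : ℕ) (R : ℝ) : Set (Eu d × ℝ) := {p | 0 ≤ p.2 ∧ p.2 < R}

lemma slab_mem_nhds {R : ℝ} {p : Eu d × ℝ} (h0 : 0 < p.2) (h : p.2 < R) : slab d R ∈ nhds p := by
  have : slab d R = Prod.snd ⁻¹' (Ico 0 R) := rfl
  rw [this]
  exact continuous_snd.continuousAt (Ico_mem_nhds h0 h)

lemma cyl_mem_slab {R : ℝ} {X : Amb d m} (h : X ∈ tube d m R) : cyl X ∈ slab d R :=
  ⟨norm_nonneg _, h⟩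

lemma lipOn_cyl (s : Set (Amb d m)) : LipOn 1 cyl s := fun X _ Y _ => by
  rw [one_mul, cyl, cyl, Prod.mk_sub_mk, Prod.norm_mk]
  exact max_le (norm_fst_le (X - Y)) ((abs_norm_sub_norm_le _ _).trans (norm_snd_le (X - Y)))

lemma norm_dirT_le (X : Amb d m) : ‖dirT X‖ ≤ 1 := by
  rw [dirT, norm_smul, norm_inv, norm_norm]
  exact inv_mul_le_one

lemma norm_dirT {X : Amb d m} (h : X.snd ≠ 0) : ‖dirT X‖ = 1 := by
  rw [dirT, norm_smul, norm_inv, norm_norm, inv_mul_cancel₀ (norm_ne_zero_iff.mpr h)]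

lemma smul_dirT (X : Amb d m) : ‖X.snd‖ • dirT X = X.snd := by
  by_cases h : X.snd = 0
  · simp [h]
  · rw [dirT, smul_smul, mul_inv_cancel₀ (norm_ne_zero_iff.mpr h), one_smul]

/-- The direction is discontinuous at t = 0, but multiplication by |t| repairs this. All Lipschitz
bounds for expressions containing t/|t| rest on this inequality. -/
lemma norm_snd_mul_dirT_sub (X Y : Amb d m) : ‖Y.snd‖ * ‖dirT X - dirT Y‖ ≤ 2 * ‖X - Y‖ := by
  have e : ‖Y.snd‖ • (dirT X - dirT Y) = (X.snd - Y.snd) + (‖Y.snd‖ - ‖X.snd‖) • dirT X := by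
    rw [smul_sub, smul_dirT, sub_smul, smul_dirT]; abel
  have h1 : ‖Y.snd‖ * ‖dirT X - dirT Y‖ = ‖‖Y.snd‖ • (dirT X - dirT Y)‖ := by
    rw [norm_smul, norm_norm]
  rw [h1, e]
  refine (norm_add_le _ _).trans ?_
  rw [norm_smul]
  have h2 : ‖X.snd - Y.snd‖ ≤ ‖X - Y‖ := norm_snd_le (X - Y)
  have h3 : ‖‖Y.snd‖ - ‖X.snd‖‖ ≤ ‖X.snd - Y.snd‖ := by
    rw [norm_sub_rev]; exact abs_norm_sub_norm_le _ _
  have h4 := mul_le_mul h3 (norm_dirT_le X) (norm_nonneg _) (norm_nonneg _)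
  linarith

end Ambient

end HigherCodim

namespace HigherCodim

open Filter Topology
open scoped ENNReal

/-! ### Area formula for graphs, by differentiation of measures -/

section Area

variable {d m : ℕ}

/-- A comparison of distances gives a comparison of the Hausdorff measures of images. -/
lemma hausdorff_image_le {α X Y : Type*} [EMetricSpace X] [MeasurableSpace X] [BorelSpace X]
    [EMetricSpace Y] [MeasurableSpace Y] [BorelSpace Y] (k : ℕ) {s : Set α} {f : α → X} {g : α → Y}
    (c : ℝ≥0) (h : ∀ y ∈ s, ∀ y' ∈ s, edist (f y) (f y') ≤ c * edist (g y) (g y')) :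
    μHE[k] (f '' s) ≤ (c : ℝ≥0∞) ^ k * μHE[k] (g '' s) := by
  rcases s.eq_empty_or_nonempty with rfl | ⟨a, ha⟩
  · simp
  have : Nonempty α := ⟨a⟩
  let i := Function.invFunOn g s
  have hi : ∀ y ∈ s, i (g y) ∈ s ∧ g (i (g y)) = g y := fun y hy =>
    ⟨Function.invFunOn_mem ⟨y, hy, rfl⟩, Function.invFunOn_eq ⟨y, hy, rfl⟩⟩
  -- The hypothesis forces `f` to agree at points where `g` agrees, so `f` factors through `g` by a
  -- `c`-Lipschitz map on `g '' s`.
  have hfi : ∀ y ∈ s, f (i (g y)) = f y := fun y hy => by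
    have := h _ (hi y hy).1 y hy
    rw [(hi y hy).2, edist_self, mul_zero] at this
    exact edist_le_zero.mp this
  have e : f '' s = (f ∘ i) '' (g '' s) := by
    rw [image_image]
    exact image_congr fun y hy => (hfi y hy).symm
  have hl : LipschitzOnWith c (f ∘ i) (g '' s) := by
    rintro _ ⟨y, hy, rfl⟩ _ ⟨y', hy', rfl⟩
    simp only [Function.comp_apply, hfi y hy, hfi y' hy']
    exact h y hy y' hy'
  rw [e, Measure.euclideanHausdorffMeasure_def, Measure.smul_apply,
    Measure.euclideanHausdorffMeasure_def, Measure.smul_apply, mul_smul_comm]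
  gcongr
  simpa using hl.hausdorffMeasure_image_le (d := k) (Nat.cast_nonneg k)

lemma hausdorff_image_le_of_norm {α E F : Type*} [NormedAddCommGroup E] [MeasurableSpace E]
    [BorelSpace E] [NormedAddCommGroup F] [MeasurableSpace F] [BorelSpace F] (k : ℕ) {s : Set α}
    {f : α → E} {g : α → F} {c : ℝ} (hc : 0 ≤ c)
    (h : ∀ y ∈ s, ∀ y' ∈ s, ‖f y - f y'‖ ≤ c * ‖g y - g y'‖) :
    μHE[k] (f '' s) ≤ ENNReal.ofReal c ^ k * μHE[k] (g '' s) := by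
  refine hausdorff_image_le k c.toNNReal fun y hy y' hy' => ?_
  rw [edist_dist, edist_dist, dist_eq_norm, dist_eq_norm]
  change _ ≤ ENNReal.ofReal c * _
  rw [← ENNReal.ofReal_mul hc]
  exact ENNReal.ofReal_le_ofReal (h y hy y' hy')

/-- The linear parametrization `v ↦ (v, B v)` of the graph of `B`. -/
noncomputable def liftL (B : Eu d →L[ℝ] Eu m) : Eu d →L[ℝ] Amb d m :=
  ptL d m ∘L (ContinuousLinearMap.id ℝ (Eu d)).prod B

@[simp] lemma liftL_apply (B : Eu d →L[ℝ] Eu m) (v : Eu d) : liftL B v = pt v (B v) := rfl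

lemma norm_le_norm_pt (v : Eu d) (t : Eu m) : ‖v‖ ≤ ‖pt v t‖ := norm_fst_le (pt v t)

lemma norm_pt_le (v : Eu d) (t : Eu m) : ‖pt v t‖ ≤ ‖v‖ + ‖t‖ := norm_le_add (pt v t)

/-- The ratio between the measure of the image under `v ↦ (v, B v)` and Lebesgue measure. -/
noncomputable def areaRatio (B : Eu d →L[ℝ] Eu m) : ℝ≥0∞ :=
  μHE[d] (liftL B '' closedBall 0 1) / volume (closedBall (0 : Eu d) 1)

/-- The area factor of the linear map `v ↦ (v, B v)`. -/
noncomputable def areaFactor (B : Eu d →L[ℝ] Eu m) : ℝ := (areaRatio B).toReal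

lemma volume_closedBall_pos : 0 < volume (closedBall (0 : Eu d) 1) :=
  measure_closedBall_pos _ _ one_pos

lemma volume_closedBall_ne_top : volume (closedBall (0 : Eu d) 1) ≠ ⊤ :=
  measure_closedBall_lt_top.ne

/-- The factor √det(I + BᵀB) is never computed. Distances on two linear graphs compare with ratio 1
+ ‖B' - B‖, because |v| ≤ |(v, Bv)|, and the measures compare accordingly. -/
lemma areaRatio_le_mul (B B' : Eu d →L[ℝ] Eu m) :
    areaRatio B' ≤ ENNReal.ofReal (1 + ‖B' - B‖) ^ d * areaRatio B := by
  rw [areaRatio, areaRatio, ← mul_div_assoc]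
  refine ENNReal.div_le_div_right (hausdorff_image_le_of_norm d (by positivity) ?_) _
  intro y _ y' _
  rw [← map_sub, ← map_sub]
  have e : liftL B' (y - y') = liftL B (y - y') + pt 0 ((B' - B) (y - y')) := by
    simp [pt_add]
  rw [e]
  refine (norm_add_le _ _).trans ?_
  rw [norm_pt_zero_left]
  have h1 := (B' - B).le_opNorm (y - y')
  have h2 : ‖y - y'‖ ≤ ‖liftL B (y - y')‖ := norm_le_norm_pt _ _
  have h3 := mul_le_mul_of_nonneg_left h2 (norm_nonneg (B' - B))
  linarith

lemma areaRatio_zero : areaRatio (0 : Eu d →L[ℝ] Eu m) = 1 := by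
  have hi : Isometry (liftL (0 : Eu d →L[ℝ] Eu m)) := by
    refine AddMonoidHomClass.isometry_of_norm _ fun v => ?_
    simp
  rw [areaRatio, hi.euclideanHausdorffMeasure_image,
    EuclideanSpace.euclideanHausdorffMeasure_eq_volume]
  exact ENNReal.div_self volume_closedBall_pos.ne' volume_closedBall_ne_top

lemma areaRatio_ne_top (B : Eu d →L[ℝ] Eu m) : areaRatio B ≠ ⊤ := by
  have := areaRatio_le_mul 0 B
  rw [areaRatio_zero, mul_one] at this
  exact ne_top_of_le_ne_top (by simp) this

lemma areaFactor_nonneg (B : Eu d →L[ℝ] Eu m) : 0 ≤ areaFactor B := ENNReal.toReal_nonneg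

lemma areaFactor_zero : areaFactor (0 : Eu d →L[ℝ] Eu m) = 1 := by
  rw [areaFactor, areaRatio_zero, ENNReal.toReal_one]

lemma areaFactor_le_mul (B B' : Eu d →L[ℝ] Eu m) :
    areaFactor B' ≤ (1 + ‖B' - B‖) ^ d * areaFactor B := by
  have h := ENNReal.toReal_mono (ENNReal.mul_ne_top (by simp) (areaRatio_ne_top B))
    (areaRatio_le_mul B B')
  rwa [ENNReal.toReal_mul, ENNReal.toReal_pow, ENNReal.toReal_ofReal (by positivity)] at h

lemma areaFactor_lipschitz (d m : ℕ) : ∃ C, 0 ≤ C ∧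
    LipOn C (areaFactor : (Eu d →L[ℝ] Eu m) → ℝ) (closedBall 0 1) := by
  obtain ⟨C, hC, hl, -⟩ := LipOn.of_contDiff (f := fun s : ℝ => (1 + s) ^ d) (by fun_prop) 2
  have key : ∀ B ∈ closedBall (0 : Eu d →L[ℝ] Eu m) 1, ∀ B' ∈ closedBall (0 : Eu d →L[ℝ] Eu m) 1,
      areaFactor B' - areaFactor B ≤ 2 ^ d * C * ‖B - B'‖ := by
    intro B hB B' hB'
    rw [mem_closedBall_zero_iff] at hB hB'
    have h1 := areaFactor_le_mul B B'
    -- Comparison with B = 0, whose factor is 1, turns the multiplicative estimate into an additive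
    -- one.
    have h2 : areaFactor B ≤ 2 ^ d := by
      have h3 := areaFactor_le_mul 0 B
      rw [areaFactor_zero, mul_one, sub_zero] at h3
      exact h3.trans (pow_le_pow_left₀ (by positivity) (by linarith) _)
    have h4 : ‖B' - B‖ ≤ 2 := (norm_sub_le _ _).trans (by linarith)
    have h5 := hl ‖B' - B‖ (by rw [mem_closedBall_zero_iff, norm_norm]; exact h4) 0 (by simp)
    simp only [add_zero, one_pow, sub_zero, norm_norm] at h5
    have h6 := (le_abs_self _).trans h5
    rw [norm_sub_rev B]
    have h7 : ((1 + ‖B' - B‖) ^ d - 1) * areaFactor B ≤ C * ‖B' - B‖ * 2 ^ d :=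
      mul_le_mul h6 h2 (areaFactor_nonneg B) (by positivity)
    linarith
  refine ⟨2 ^ d * C, by positivity, fun B hB B' hB' => ?_⟩
  rw [Real.norm_eq_abs, abs_le]
  constructor
  · have := key B hB B' hB'
    linarith
  · have := key B' hB' B hB
    rwa [norm_sub_rev B'] at this

lemma liftL_image_closedBall (B : Eu d →L[ℝ] Eu m) (x : Eu d) {r : ℝ} (hr : 0 < r) :
    μHE[d] (liftL B '' closedBall x r) / volume (closedBall x r) = areaRatio B := by
  have e : closedBall x r = (fun y => x + r • y) '' closedBall (0 : Eu d) 1 := by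
    have := (affinity_unitClosedBall (E := Eu d) hr.le x).symm
    rw [this, ← Set.image_smul, ← Set.image_vadd, image_image]
    rfl
  have hd : ∀ y y' : Eu d, liftL B (x + r • y) - liftL B (x + r • y') =
      r • (liftL B y - liftL B y') := fun y y' => by
    simp only [map_add, map_smul, smul_sub]; abel
  have h1 : μHE[d] (liftL B '' closedBall x r) =
      ENNReal.ofReal r ^ d * μHE[d] (liftL B '' closedBall 0 1) := by
    rw [e, image_image]
    refine le_antisymm ?_ ?_
    · refine hausdorff_image_le_of_norm d hr.le fun y _ y' _ => ?_
      rw [hd, norm_smul, Real.norm_of_nonneg hr.le]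
    · have h2 : μHE[d] (liftL B '' closedBall 0 1) ≤ ENNReal.ofReal r⁻¹ ^ d *
          μHE[d] ((fun y => liftL B (x + r • y)) '' closedBall 0 1) := by
        refine hausdorff_image_le_of_norm d (inv_nonneg.mpr hr.le) fun y _ y' _ => ?_
        rw [hd, norm_smul, Real.norm_of_nonneg hr.le, inv_mul_cancel_left₀ hr.ne']
      refine (mul_le_mul_right h2 _).trans ?_
      rw [← mul_assoc, ← mul_pow, ← ENNReal.ofReal_mul hr.le, mul_inv_cancel₀ hr.ne']
      simp
  have h3 : volume (closedBall x r) = ENNReal.ofReal r ^ d * volume (closedBall (0 : Eu d) 1) := by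
    rw [Measure.addHaar_closedBall' _ _ hr.le, finrank_euclideanSpace_fin,
      ENNReal.ofReal_pow hr.le]
  rw [h1, h3, areaRatio]
  refine ENNReal.mul_div_mul_left _ _ (pow_ne_zero _ ?_) (by simp)
  simpa using hr

/-- `ψ` is a `C¹` function with small and Lipschitz derivative. -/
structure FlatMap (ψ : Eu d → Eu m) (ε L : ℝ) : Prop where
  lip_nonneg : 0 ≤ L
  contDiff : ContDiff ℝ 1 ψ
  small : ∀ x, ‖fderiv ℝ ψ x‖ ≤ ε
  lip : ∀ x y, ‖fderiv ℝ ψ x - fderiv ℝ ψ y‖ ≤ L * ‖x - y‖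

/-- The parametrization `y ↦ (y, ψ y)` of the graph. -/
def graphMap (ψ : Eu d → Eu m) (y : Eu d) : Amb d m := pt y (ψ y)

variable {ψ : Eu d → Eu m} {ε L : ℝ}

namespace FlatMap

lemma eps_nonneg (h : FlatMap ψ ε L) : 0 ≤ ε := (norm_nonneg _).trans (h.small 0)

lemma differentiable (h : FlatMap ψ ε L) : Differentiable ℝ ψ :=
  h.contDiff.differentiable one_ne_zero

lemma continuous (h : FlatMap ψ ε L) : Continuous ψ := h.contDiff.continuous

lemma continuous_fderiv (h : FlatMap ψ ε L) : Continuous (fderiv ℝ ψ) :=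
  h.contDiff.continuous_fderiv one_ne_zero

lemma norm_sub_le (h : FlatMap ψ ε L) (x y : Eu d) : ‖ψ x - ψ y‖ ≤ ε * ‖x - y‖ :=
  convex_univ.norm_image_sub_le_of_norm_fderiv_le (fun z _ => h.differentiable z)
    (fun z _ => h.small z) (mem_univ y) (mem_univ x)

lemma measurableEmbedding (h : FlatMap ψ ε L) : MeasurableEmbedding (graphMap ψ) := by
  refine IsClosedEmbedding.measurableEmbedding ?_
  refine IsClosedEmbedding.of_continuous_injective_isClosedMap ?_ ?_ ?_
  · exact (ptL d m).continuous.comp (continuous_id.prodMk h.continuous)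
  · intro x y hxy
    exact congrArg WithLp.fst hxy
  · have ha : AntilipschitzWith 1 (graphMap ψ) := AntilipschitzWith.of_le_mul_dist fun x y => by
      rw [dist_eq_norm, dist_eq_norm, NNReal.coe_one, one_mul]
      exact norm_fst_le (graphMap ψ x - graphMap ψ y)
    refine (ha.isClosedEmbedding ?_).isClosedMap
    have : LipschitzWith (1 + ε).toNNReal (graphMap ψ) := by
      refine LipschitzWith.of_dist_le_mul fun x y => ?_
      rw [dist_eq_norm, dist_eq_norm, Real.coe_toNNReal _ (by linarith [h.eps_nonneg])]
      have := norm_pt_le (x - y) (ψ x - ψ y)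
      have := h.norm_sub_le x y
      change ‖pt (x - y) (ψ x - ψ y)‖ ≤ _
      linarith
    exact this.uniformContinuous

end FlatMap

/-- The graph measure in the coordinates of `ℝ^d`. -/
noncomputable def graphMeasure (ψ : Eu d → Eu m) : Measure (Eu d) :=
  Measure.comap (graphMap ψ) μHE[d]

lemma graphMeasure_apply (h : FlatMap ψ ε L) (s : Set (Eu d)) :
    graphMeasure ψ s = μHE[d] (graphMap ψ '' s) :=
  h.measurableEmbedding.comap_apply _ _

lemma graphMeasure_le (h : FlatMap ψ ε L) (s : Set (Eu d)) :
    graphMeasure ψ s ≤ ENNReal.ofReal (1 + ε) ^ d * volume s := by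
  rw [graphMeasure_apply h, ← EuclideanSpace.euclideanHausdorffMeasure_eq_volume]
  have hε := h.eps_nonneg
  have := hausdorff_image_le_of_norm (f := graphMap ψ) (g := fun y : Eu d => y) (s := s) d
    (c := 1 + ε) (by linarith) fun x _ y _ => by
      have h1 := norm_pt_le (x - y) (ψ x - ψ y)
      have h2 := h.norm_sub_le x y
      change ‖pt (x - y) (ψ x - ψ y)‖ ≤ _
      linarith
  simpa using this

lemma graphMeasure_absolutelyContinuous (h : FlatMap ψ ε L) : graphMeasure ψ ≪ volume := by
  intro s hs
  have := graphMeasure_le h s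
  rw [hs, mul_zero] at this
  exact le_antisymm this bot_le

lemma isLocallyFinite_graphMeasure (h : FlatMap ψ ε L) :
    IsLocallyFiniteMeasure (graphMeasure ψ) := by
  refine ⟨fun x => ⟨closedBall x 1, closedBall_mem_nhds x one_pos, ?_⟩⟩
  exact (graphMeasure_le h _).trans_lt (ENNReal.mul_lt_top (by simp) measure_closedBall_lt_top)

lemma graphMap_sub_le (h : FlatMap ψ ε L) (x : Eu d) {r : ℝ} {y y' : Eu d}
    (hy : y ∈ closedBall x r) (hy' : y' ∈ closedBall x r) :
    ‖ψ y - ψ y' - fderiv ℝ ψ x (y - y')‖ ≤ L * r * ‖y - y'‖ := by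
  refine (convex_closedBall x r).norm_image_sub_le_of_norm_fderiv_le' (𝕜 := ℝ) (f := ψ)
    (fun z _ => h.differentiable z) (fun z hz => (h.lip z x).trans ?_) hy' hy
  rw [mem_closedBall, dist_eq_norm] at hz
  exact mul_le_mul_of_nonneg_left hz h.lip_nonneg

/-- On the ball of radius r about x, distances on the graph and on its tangent plane agree up to the
factor 1 + Lr in both directions. The ratios of measures of balls are thus squeezed to that of the
linear graph, and the Besicovitch theorem identifies the limit with the density. -/
lemma rnDeriv_graphMeasure (h : FlatMap ψ ε L) :
    ∀ᵐ x, (graphMeasure ψ).rnDeriv volume x = areaRatio (fderiv ℝ ψ x) := by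
  have := isLocallyFinite_graphMeasure h
  filter_upwards [Besicovitch.ae_tendsto_rnDeriv (graphMeasure ψ) volume] with x hx
  set B := fderiv ℝ ψ x
  have hL := h.lip_nonneg
  have hc : Tendsto (fun r : ℝ => ENNReal.ofReal (1 + L * r) ^ d) (𝓝[>] 0) (𝓝 1) := by
    have : Continuous fun r : ℝ => ENNReal.ofReal (1 + L * r) ^ d :=
      (ENNReal.continuous_pow d).comp (ENNReal.continuous_ofReal.comp (by fun_prop))
    have h0 := this.tendsto 0
    simp only [mul_zero, add_zero, ENNReal.ofReal_one, one_pow] at h0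
    exact h0.mono_left nhdsWithin_le_nhds
  have h1 : ∀ᶠ r in 𝓝[>] (0 : ℝ), graphMeasure ψ (closedBall x r) / volume (closedBall x r) ≤
      ENNReal.ofReal (1 + L * r) ^ d * areaRatio B := by
    filter_upwards [self_mem_nhdsWithin] with r hr
    have hr : 0 < r := hr
    rw [← liftL_image_closedBall B x hr, ← mul_div_assoc, graphMeasure_apply h]
    refine ENNReal.div_le_div_right (hausdorff_image_le_of_norm d (by positivity) ?_) _
    intro y hy y' hy'
    have h2 := graphMap_sub_le h x hy hy'
    rw [← map_sub]
    have e : graphMap ψ y - graphMap ψ y' =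
        liftL B (y - y') + pt 0 (ψ y - ψ y' - B (y - y')) := by
      simp [graphMap, pt_add, pt_sub]
    rw [e]
    refine (norm_add_le _ _).trans ?_
    rw [norm_pt_zero_left]
    have h3 : ‖y - y'‖ ≤ ‖liftL B (y - y')‖ := norm_le_norm_pt _ _
    have h4 := mul_le_mul_of_nonneg_left h3 (mul_nonneg h.lip_nonneg hr.le)
    linarith
  have h2 : ∀ᶠ r in 𝓝[>] (0 : ℝ), areaRatio B ≤ ENNReal.ofReal (1 + L * r) ^ d *
      (graphMeasure ψ (closedBall x r) / volume (closedBall x r)) := by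
    filter_upwards [self_mem_nhdsWithin] with r hr
    have hr : 0 < r := hr
    rw [← liftL_image_closedBall B x hr, ← mul_div_assoc, graphMeasure_apply h]
    refine ENNReal.div_le_div_right (hausdorff_image_le_of_norm d (by positivity) ?_) _
    intro y hy y' hy'
    have h2 := graphMap_sub_le h x hy hy'
    rw [← map_sub]
    have e : liftL B (y - y') = graphMap ψ y - graphMap ψ y' -
        pt 0 (ψ y - ψ y' - B (y - y')) := by
      simp [graphMap, pt_sub]
    rw [e]
    refine (_root_.norm_sub_le _ _).trans ?_
    rw [norm_pt_zero_left]
    have h3 : ‖y - y'‖ ≤ ‖graphMap ψ y - graphMap ψ y'‖ := norm_le_norm_pt _ _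
    have h4 := mul_le_mul_of_nonneg_left h3 (mul_nonneg h.lip_nonneg hr.le)
    linarith
  have h3 := ENNReal.Tendsto.mul hc (Or.inl one_ne_zero) hx (Or.inr ENNReal.one_ne_top)
  have h4 := ENNReal.Tendsto.mul hc (Or.inl one_ne_zero) (tendsto_const_nhds (x := areaRatio B))
    (Or.inr ENNReal.one_ne_top)
  rw [one_mul] at h3 h4
  exact le_antisymm (le_of_tendsto_of_tendsto hx h4 h1) (ge_of_tendsto h3 h2)

lemma graphSet_eq_range (ψ : Eu d → Eu m) : graphSet ψ = range (graphMap ψ) := rfl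

/-- The area formula for the graph of `ψ`. -/
lemma integral_graphSet (h : FlatMap ψ ε L) (f : Amb d m → ℝ) :
    ∫ Y in graphSet ψ, f Y ∂μHE[d] = ∫ y, areaFactor (fderiv ℝ ψ y) * f (graphMap ψ y) := by
  have := isLocallyFinite_graphMeasure h
  rw [graphSet_eq_range, ← h.measurableEmbedding.map_comap, h.measurableEmbedding.integral_map]
  change ∫ y, f (graphMap ψ y) ∂(graphMeasure ψ) = _
  rw [← integral_rnDeriv_smul (graphMeasure_absolutelyContinuous h)]
  refine integral_congr_ae ?_
  filter_upwards [rnDeriv_graphMeasure h] with x hx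
  rw [hx, areaFactor, smul_eq_mul]

lemma integrableOn_graphSet_iff (h : FlatMap ψ ε L) (f : Amb d m → ℝ) :
    IntegrableOn f (graphSet ψ) μHE[d] ↔
      Integrable fun y => areaFactor (fderiv ℝ ψ y) * f (graphMap ψ y) := by
  have := isLocallyFinite_graphMeasure h
  rw [graphSet_eq_range, IntegrableOn, ← h.measurableEmbedding.map_comap,
    h.measurableEmbedding.integrable_map_iff]
  change Integrable (f ∘ graphMap ψ) (graphMeasure ψ) ↔ _
  rw [← integrable_rnDeriv_smul_iff (graphMeasure_absolutelyContinuous h)]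
  refine integrable_congr ?_
  filter_upwards [rnDeriv_graphMeasure h] with x hx
  rw [hx, areaFactor, smul_eq_mul, Function.comp_apply]

end Area

end HigherCodim

namespace HigherCodim

/-! ### Orthonormal frames of the normal spaces -/

section Frame

open InnerProductSpace

variable {d m : ℕ}

/-- The normal vectors `(-Bᵀ e_j, e_j)` of the graph of `B`. -/
noncomputable def normalVec (B : Eu d →L[ℝ] Eu m) (j : Fin m) : Amb d m :=
  pt (-(ContinuousLinearMap.adjoint B (EuclideanSpace.single j 1))) (EuclideanSpace.single j 1)

/-- The isometry of `ℝ^m` onto the normal space of the graph of `B` given by the Gram-Schmidt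
orthonormalization of the vectors `(-Bᵀ e_j, e_j)`. -/
noncomputable def frame (B : Eu d →L[ℝ] Eu m) : Eu m →L[ℝ] Amb d m :=
  ∑ j, ContinuousLinearMap.smulRight (innerSL ℝ (EuclideanSpace.single j (1 : ℝ) : Eu m))
    (gramSchmidtNormed ℝ (normalVec B) j : Amb d m)

lemma frame_apply (B : Eu d →L[ℝ] Eu m) (s : Eu m) :
    frame B s = ∑ j, s j • gramSchmidtNormed ℝ (normalVec B) j := by
  simp [frame, EuclideanSpace.inner_single_left]

lemma linearIndependent_normalVec (B : Eu d →L[ℝ] Eu m) : LinearIndependent ℝ (normalVec B) := by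
  refine LinearIndependent.of_comp (sndA d m).toLinearMap ?_
  have : ((sndA d m).toLinearMap ∘ normalVec B) = EuclideanSpace.basisFun (Fin m) ℝ := by
    ext1 j
    simp [normalVec]
  rw [this]
  exact (EuclideanSpace.basisFun (Fin m) ℝ).orthonormal.linearIndependent

/-- Induction on the index: each vector is a rational expression in the earlier ones, and linear
independence keeps the denominators away from zero. -/
lemma contDiff_gramSchmidt {P : Type*} [NormedAddCommGroup P] [NormedSpace ℝ P] {E : Type*}
    [NormedAddCommGroup E] [InnerProductSpace ℝ E] {n : ℕ∞} {v : P → Fin m → E}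
    (hv : ∀ j, ContDiff ℝ n fun p => v p j) (hi : ∀ p, LinearIndependent ℝ (v p)) (j : Fin m) :
    ContDiff ℝ n fun p => gramSchmidt ℝ (v p) j := by
  induction j using WellFoundedLT.induction with
  | ind j ih =>
    have e : (fun p => gramSchmidt ℝ (v p) j) = fun p => v p j - ∑ i ∈ Finset.Iio j,
        (inner ℝ (gramSchmidt ℝ (v p) i) (v p j) / ‖gramSchmidt ℝ (v p) i‖ ^ 2) •
          gramSchmidt ℝ (v p) i := by
      funext p
      rw [gramSchmidt_def]
      congr 1
      refine Finset.sum_congr rfl fun i _ => ?_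
      rw [Submodule.starProjection_singleton]
      rfl
    rw [e]
    refine (hv j).sub (ContDiff.sum fun i hi' => ?_)
    have h := ih i (Finset.mem_Iio.mp hi')
    refine ContDiff.smul (ContDiff.div (h.inner ℝ (hv j)) (h.norm_sq ℝ) fun p => ?_) h
    exact pow_ne_zero _ (norm_ne_zero_iff.mpr (gramSchmidt_ne_zero i (hi p)))

lemma contDiff_gramSchmidtNormed {P : Type*} [NormedAddCommGroup P] [NormedSpace ℝ P] {E : Type*}
    [NormedAddCommGroup E] [InnerProductSpace ℝ E] {n : ℕ∞} {v : P → Fin m → E}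
    (hv : ∀ j, ContDiff ℝ n fun p => v p j) (hi : ∀ p, LinearIndependent ℝ (v p)) (j : Fin m) :
    ContDiff ℝ n fun p => gramSchmidtNormed ℝ (v p) j := by
  have h := contDiff_gramSchmidt hv hi j
  have h0 : ∀ p, gramSchmidt ℝ (v p) j ≠ 0 := fun p => gramSchmidt_ne_zero j (hi p)
  exact ((h.norm ℝ h0).inv fun p => norm_ne_zero_iff.mpr (h0 p)).smul h

lemma contDiff_frame {n : ℕ∞} : ContDiff ℝ n (frame : (Eu d →L[ℝ] Eu m) → (Eu m →L[ℝ] Amb d m)) := by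
  have hv : ∀ j, ContDiff ℝ n fun B : Eu d →L[ℝ] Eu m => normalVec B j := fun j => by
    have h1 : ContDiff ℝ n fun B : Eu d →L[ℝ] Eu m =>
        -(ContinuousLinearMap.adjoint B (EuclideanSpace.single j 1)) :=
      ((ContinuousLinearMap.adjoint (𝕜 := ℝ) (E := Eu d)
        (F := Eu m)).toContinuousLinearEquiv.contDiff.clm_apply contDiff_const).neg
    exact (ptL d m).contDiff.comp (h1.prodMk contDiff_const)
  refine ContDiff.sum fun j _ => ?_
  exact contDiff_const.smulRight (contDiff_gramSchmidtNormed hv linearIndependent_normalVec j)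

lemma norm_frame_apply (B : Eu d →L[ℝ] Eu m) (s : Eu m) : ‖frame B s‖ = ‖s‖ := by
  have ho := gramSchmidtNormed_orthonormal (linearIndependent_normalVec B)
  have h1 : ‖frame B s‖ ^ 2 = ‖s‖ ^ 2 := by
    rw [← real_inner_self_eq_norm_sq, frame_apply, ho.inner_sum, EuclideanSpace.norm_sq_eq]
    refine Finset.sum_congr rfl fun j _ => ?_
    simp [sq]
  exact (pow_left_inj₀ (norm_nonneg _) (norm_nonneg _) two_ne_zero).mp h1

/-- The vectors (-Bᵀe_j, e_j) are orthogonal to the graph of B, and orthonormalization does not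
leave their span. -/
lemma inner_liftL_frame (B : Eu d →L[ℝ] Eu m) (u : Eu d) (s : Eu m) :
    inner ℝ (liftL B u) (frame B s) = 0 := by
  have h1 : ∀ j, inner ℝ (liftL B u) (normalVec B j) = (0 : ℝ) := fun j => by
    rw [inner_amb]
    simp only [liftL_apply, pt_fst, pt_snd, normalVec, inner_neg_right,
      ContinuousLinearMap.adjoint_inner_right]
    ring
  have h2 : ∀ j, inner ℝ (liftL B u) (gramSchmidtNormed ℝ (normalVec B) j) = (0 : ℝ) := fun j => by
    have hm : gramSchmidtNormed ℝ (normalVec B) j ∈ Submodule.span ℝ (range (normalVec B)) := by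
      rw [← span_gramSchmidt ℝ, ← span_gramSchmidtNormed_range]
      exact Submodule.subset_span ⟨j, rfl⟩
    have h3 : Submodule.span ℝ (range (normalVec B)) ≤
        LinearMap.ker (innerSL ℝ (liftL B u)).toLinearMap := by
      rw [Submodule.span_le]
      rintro _ ⟨i, rfl⟩
      exact h1 i
    exact h3 hm
  rw [frame_apply, inner_sum]
  refine Finset.sum_eq_zero fun j _ => ?_
  rw [inner_smul_right, h2, mul_zero]

/-- For B = 0 the normal vectors are already orthonormal. This is the reference value for the
smallness estimates of the stretching. -/
lemma frame_zero : frame (0 : Eu d →L[ℝ] Eu m) = inrL d m := by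
  have hn : normalVec (0 : Eu d →L[ℝ] Eu m) = fun j => pt 0 (EuclideanSpace.single j 1) := by
    ext1 j; simp [normalVec]
  have h1 : gramSchmidt ℝ (normalVec (0 : Eu d →L[ℝ] Eu m)) = normalVec 0 := by
    refine gramSchmidt_of_orthogonal ℝ fun i j hij => ?_
    rw [hn]
    simp [EuclideanSpace.inner_single_left, hij]
  ext1 s
  have h2 : ∀ j, gramSchmidtNormed ℝ (normalVec (0 : Eu d →L[ℝ] Eu m)) j =
      inrL d m (EuclideanSpace.single j 1) := fun j => by
    rw [gramSchmidtNormed, h1, hn]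
    simp
  rw [frame_apply]
  simp only [h2]
  simp only [← map_smul, ← map_sum]
  congr 1
  ext i
  simp [Finset.sum_apply, Pi.single_apply]

end Frame

end HigherCodim

namespace HigherCodim

/-! ### Differentiation under the integral sign and rescaling -/

section Integrals

variable {P V W Z : Type*} [NormedAddCommGroup P] [NormedSpace ℝ P]
  [NormedAddCommGroup V] [NormedSpace ℝ V] [NormedAddCommGroup W] [NormedSpace ℝ W]
  [NormedAddCommGroup Z] [NormedSpace ℝ Z] {d m : ℕ}

lemma integrable_of_zero_off {f : Eu d → W} (hf : Continuous f) (h : ∀ z, 1 < ‖z‖ → f z = 0) :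
    Integrable f := by
  refine hf.integrable_of_hasCompactSupport
    (HasCompactSupport.intro (isCompact_closedBall (0 : Eu d) 1) fun z hz => h z ?_)
  rwa [mem_closedBall_zero_iff, not_le] at hz

/-- Differentiation under the integral sign for kernels of compact support. -/
lemma hasFDerivAt_integral_of_compact [ProperSpace P] {G : P → Eu d → W}
    {G' : P → Eu d → P →L[ℝ] W} {p₀ : P} {δ : ℝ} {K : Set (Eu d)} (hδ : 0 < δ) (hK : IsCompact K)
    (hG : ∀ p ∈ closedBall p₀ δ, ∀ y, HasFDerivAt (fun p => G p y) (G' p y) p)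
    (hc : ContinuousOn (Function.uncurry G') (closedBall p₀ δ ×ˢ univ))
    (hcG : ∀ p ∈ closedBall p₀ δ, Continuous (G p))
    (hs : ∀ p ∈ closedBall p₀ δ, ∀ y ∉ K, G p y = 0)
    (hs' : ∀ p ∈ closedBall p₀ δ, ∀ y ∉ K, G' p y = 0) :
    HasFDerivAt (fun p => ∫ y, G p y) (∫ y, G' p₀ y) p₀ := by
  obtain ⟨M, hM⟩ := ((isCompact_closedBall p₀ δ).prod hK).exists_bound_of_continuousOn
    (hc.mono (prod_mono_right (subset_univ K)))
  have h0 : p₀ ∈ closedBall p₀ δ := mem_closedBall_self hδ.le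
  have hc0 : Continuous (G' p₀) := by
    rw [← continuousOn_univ]
    exact hc.comp (f := fun y : Eu d => (p₀, y)) (by fun_prop) fun y _ => ⟨h0, mem_univ _⟩
  refine hasFDerivAt_integral_of_dominated_of_fderiv_le (bound := K.indicator fun _ => M)
    (closedBall_mem_nhds p₀ hδ) ?_ ?_ hc0.aestronglyMeasurable ?_ ?_ ?_
  · filter_upwards [closedBall_mem_nhds p₀ hδ] with p hp
    exact (hcG p hp).aestronglyMeasurable
  · exact (hcG p₀ h0).integrable_of_hasCompactSupport (HasCompactSupport.intro hK (hs p₀ h0))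
  · refine Filter.Eventually.of_forall fun y p hp => ?_
    by_cases hy : y ∈ K
    · rw [indicator_of_mem hy]
      exact hM (p, y) ⟨hp, hy⟩
    · rw [indicator_of_notMem hy, hs' p hp y hy, norm_zero]
  · exact (integrable_indicator_iff hK.measurableSet).mpr (integrableOn_const hK.measure_ne_top)
  · exact Filter.Eventually.of_forall fun y p hp => hG p hp y

lemma integral_comp_add_smul (f : Eu d → W) (x : Eu d) {r : ℝ} (hr : 0 < r) :
    ∫ z, f (x + r • z) = (r ^ d)⁻¹ • ∫ y, f y := by
  rw [Measure.integral_comp_smul volume (fun w => f (x + w)) r, integral_add_left_eq_self,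
    finrank_euclideanSpace_fin, abs_of_pos (by positivity)]

end Integrals

/-! ### Mollification of ψ and difference quotients up to r = 0 -/

section Mollify

variable {W : Type*} [NormedAddCommGroup W] [NormedSpace ℝ W] {d m : ℕ}
  {η : Eu d → ℝ} {ψ : Eu d → Eu m} {ε L : ℝ}

namespace IsMollifier

lemma continuous (hη : IsMollifier η) : Continuous η := hη.smooth.continuous

lemma even (hη : IsMollifier η) (z : Eu d) : η (-z) = η z := hη.radial _ _ (norm_neg z)

lemma integrable (hη : IsMollifier η) : Integrable η :=
  integrable_of_zero_off hη.continuous fun z hz => hη.supp z hz.le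

lemma integrable_smul (hη : IsMollifier η) {f : Eu d → W} (hf : Continuous f) :
    Integrable fun z => η z • f z :=
  integrable_of_zero_off (hη.continuous.smul hf) fun z hz => by
    rw [hη.supp z hz.le, zero_smul]

lemma norm_integral_le (hη : IsMollifier η) {f : Eu d → W} {C : ℝ}
    (h : ∀ z, ‖z‖ ≤ 1 → ‖f z‖ ≤ C) : ‖∫ z, η z • f z‖ ≤ C := by
  have h1 : ‖∫ z, η z • f z‖ ≤ ∫ z, η z * C := by
    refine integral_lipschitz_bound (hη.integrable.mul_const C) fun z => ?_
    rw [norm_smul, Real.norm_of_nonneg (hη.nonneg z)]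
    by_cases hz : ‖z‖ ≤ 1
    · exact mul_le_mul_of_nonneg_left (h z hz) (hη.nonneg z)
    · rw [hη.supp z (not_le.mp hz).le, zero_mul, zero_mul]
  rwa [integral_mul_const, hη.integral_eq_one, one_mul] at h1

lemma lipOn_integral {E : Type*} [NormedAddCommGroup E] (hη : IsMollifier η) {f : E → Eu d → W}
    {C : ℝ} {s : Set E} (hf : ∀ p, Continuous (f p)) (h : ∀ z, ‖z‖ ≤ 1 → LipOn C (f · z) s) :
    LipOn C (fun p => ∫ z, η z • f p z) s := fun p hp p' hp' => by
  rw [← integral_sub (hη.integrable_smul (hf p)) (hη.integrable_smul (hf p'))]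
  simp_rw [← smul_sub]
  exact hη.norm_integral_le fun z hz => h z hz p hp p' hp'

lemma integral_smul_const (hη : IsMollifier η) (c : W) [CompleteSpace W] :
    ∫ z, η z • c = c := by
  rw [_root_.integral_smul_const, hη.integral_eq_one, one_smul]

/-- The symmetry of η makes its first moments vanish. This kills the first-order terms at r = 0 in
`relPos_zero` and `mollDeriv_zero`. -/
lemma integral_smul_odd (hη : IsMollifier η) {f : Eu d → W} (hf : ∀ z, f (-z) = -f z) :
    ∫ z, η z • f z = 0 := by
  have h := integral_neg_eq_self (fun z => η z • f z) (volume : Measure (Eu d))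
  simp_rw [hη.even, hf, smul_neg, integral_neg] at h
  have h2 : (2 : ℝ) • ∫ z, η z • f z = 0 := by
    rw [two_smul]; nth_rewrite 1 [← h]; exact neg_add_cancel _
  exact (smul_eq_zero.mp h2).resolve_left two_ne_zero

end IsMollifier

/-- The difference quotient `(ψ(x + r z) - ψ(x)) / r`, extended to `r = 0`. -/
noncomputable def diffQuot (ψ : Eu d → Eu m) (p : Eu d × ℝ) (z : Eu d) : Eu m :=
  ∫ τ in (0 : ℝ)..1, fderiv ℝ ψ (p.1 + (τ * p.2) • z) z

namespace FlatMap

lemma continuous_diffQuot (h : FlatMap ψ ε L) :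
    Continuous fun q : (Eu d × ℝ) × Eu d => diffQuot ψ q.1 q.2 := by
  have := h.continuous_fderiv
  unfold diffQuot
  refine intervalIntegral.continuous_parametric_intervalIntegral_of_continuous' ?_ 0 1
  simp only [Function.uncurry_def]
  fun_prop

lemma smul_diffQuot (h : FlatMap ψ ε L) (p : Eu d × ℝ) (z : Eu d) :
    p.2 • diffQuot ψ p z = ψ (p.1 + p.2 • z) - ψ p.1 := by
  have := h.continuous_fderiv
  have hd : ∀ τ ∈ uIcc (0 : ℝ) 1, HasDerivAt (fun τ : ℝ => ψ (p.1 + (τ * p.2) • z))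
      (p.2 • fderiv ℝ ψ (p.1 + (τ * p.2) • z) z) τ := fun τ _ => by
    have h1 : HasDerivAt (fun τ : ℝ => p.1 + (τ * p.2) • z) (p.2 • z) τ := by
      have := (((hasDerivAt_id τ).mul_const p.2).smul_const z).const_add p.1
      simpa using this
    have h2 := (h.differentiable (p.1 + (τ * p.2) • z)).hasFDerivAt.comp_hasDerivAt τ h1
    exact h2.congr_deriv (by simp)
  have h3 := intervalIntegral.integral_eq_sub_of_hasDerivAt hd
    (Continuous.intervalIntegrable (by fun_prop) 0 1)
  rw [diffQuot, ← intervalIntegral.integral_smul, h3]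
  simp

lemma diffQuot_zero (p : Eu d × ℝ) (hp : p.2 = 0) (z : Eu d) :
    diffQuot ψ p z = fderiv ℝ ψ p.1 z := by
  simp [diffQuot, hp]

lemma norm_diffQuot_le (h : FlatMap ψ ε L) (p : Eu d × ℝ) (z : Eu d) :
    ‖diffQuot ψ p z‖ ≤ ε * ‖z‖ := by
  have := intervalIntegral.norm_integral_le_of_norm_le_const (a := (0 : ℝ)) (b := 1)
    (f := fun τ => fderiv ℝ ψ (p.1 + (τ * p.2) • z) z) (C := ε * ‖z‖) fun τ _ =>
      ContinuousLinearMap.le_of_opNorm_le _ (h.small _) z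
  rw [diffQuot]
  simpa using this

/-- Writing the quotient as an average of ∇ψ along a segment removes the division by r, so that its
dependence on (x, r) is Lipschitz across r = 0 although ∇ψ is only Lipschitz. -/
lemma lipOn_diffQuot (h : FlatMap ψ ε L) (z : Eu d) :
    LipOn (L * (1 + ‖z‖) * ‖z‖) (fun p => diffQuot ψ p z) univ := fun p _ p' _ => by
  have hc := h.continuous_fderiv
  have hi : ∀ p : Eu d × ℝ, IntervalIntegrable (fun τ : ℝ => fderiv ℝ ψ (p.1 + (τ * p.2) • z) z)
      volume 0 1 := fun p => Continuous.intervalIntegrable (by fun_prop) 0 1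
  change ‖diffQuot ψ p z - diffQuot ψ p' z‖ ≤ _
  rw [diffQuot, diffQuot, ← intervalIntegral.integral_sub (hi p) (hi p')]
  have := intervalIntegral.norm_integral_le_of_norm_le_const (a := (0 : ℝ)) (b := 1)
    (f := fun τ => fderiv ℝ ψ (p.1 + (τ * p.2) • z) z - fderiv ℝ ψ (p'.1 + (τ * p'.2) • z) z)
    (C := L * (1 + ‖z‖) * ‖z‖ * ‖p - p'‖) fun τ hτ => by
      rw [uIoc_of_le zero_le_one] at hτ
      rw [← _root_.sub_apply]
      have h1 := ContinuousLinearMap.le_of_opNorm_le _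
        (h.lip (p.1 + (τ * p.2) • z) (p'.1 + (τ * p'.2) • z)) z
      have h2 : ‖p.1 + (τ * p.2) • z - (p'.1 + (τ * p'.2) • z)‖ ≤ (1 + ‖z‖) * ‖p - p'‖ := by
        have e : p.1 + (τ * p.2) • z - (p'.1 + (τ * p'.2) • z) =
            (p - p').1 + (τ * (p - p').2) • z := by
          simp only [Prod.fst_sub, Prod.snd_sub, mul_sub, sub_smul]; abel
        rw [e]
        refine (norm_add_le _ _).trans ?_
        rw [norm_smul, norm_mul, Real.norm_of_nonneg hτ.1.le]
        have h3 : ‖(p - p').1‖ ≤ ‖p - p'‖ := _root_.norm_fst_le _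
        have h4 : ‖(p - p').2‖ ≤ ‖p - p'‖ := _root_.norm_snd_le _
        have h5 : τ * ‖(p - p').2‖ ≤ 1 * ‖p - p'‖ :=
          mul_le_mul hτ.2 h4 (norm_nonneg _) zero_le_one
        have h6 := mul_le_mul_of_nonneg_right h5 (norm_nonneg z)
        linarith
      have h3 := mul_le_mul_of_nonneg_right (mul_le_mul_of_nonneg_left h2 h.lip_nonneg)
        (norm_nonneg z)
      linarith
  simpa using this

end FlatMap

/-- The quotient `(ψ_r(x) - ψ(x + r z)) / r`, extended to `r = 0`. -/
noncomputable def relPos (η : Eu d → ℝ) (ψ : Eu d → Eu m) (p : Eu d × ℝ) (z : Eu d) : Eu m :=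
  (∫ ζ, η ζ • diffQuot ψ p (-ζ)) - diffQuot ψ p z

/-- The derivative of `(x, r) ↦ ψ_r(x)`. -/
noncomputable def mollDeriv (η : Eu d → ℝ) (ψ : Eu d → Eu m) (p : Eu d × ℝ) :
    (Eu d × ℝ) →L[ℝ] Eu m :=
  ∫ z, η z • (fderiv ℝ ψ (p.1 - p.2 • z) ∘L
    (ContinuousLinearMap.fst ℝ (Eu d) ℝ - (ContinuousLinearMap.snd ℝ (Eu d) ℝ).smulRight z))

/-- The mollification of the derivative of `ψ`. -/
noncomputable def mollB (η : Eu d → ℝ) (ψ : Eu d → Eu m) (p : Eu d × ℝ) : Eu d →L[ℝ] Eu m :=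
  ∫ z, η z • fderiv ℝ ψ (p.1 - p.2 • z)

section

variable (hη : IsMollifier η) (h : FlatMap ψ ε L)
include hη h

lemma continuous_relPos (p : Eu d × ℝ) : Continuous (relPos η ψ p) := by
  have := h.continuous_diffQuot.comp (f := fun z : Eu d => (p, z)) (by fun_prop)
  exact continuous_const.sub this

lemma smul_relPos (p : Eu d × ℝ) (z : Eu d) :
    p.2 • relPos η ψ p z = phiS η ψ p.2 p.1 - ψ (p.1 + p.2 • z) := by
  have hc : Continuous fun ζ => diffQuot ψ p (-ζ) :=
    h.continuous_diffQuot.comp (f := fun z : Eu d => (p, -z)) (by fun_prop)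
  have e : ∀ ζ, p.2 • η ζ • diffQuot ψ p (-ζ) = η ζ • ψ (p.1 - p.2 • ζ) - η ζ • ψ p.1 := by
    intro ζ
    rw [smul_comm, h.smul_diffQuot, smul_neg, ← sub_eq_add_neg, smul_sub]
  have hψ := h.continuous
  rw [relPos, smul_sub, h.smul_diffQuot, ← integral_smul]
  simp_rw [e]
  rw [integral_sub (hη.integrable_smul (by fun_prop)) (hη.integrable_smul continuous_const),
    hη.integral_smul_const, phiS]
  abel

lemma relPos_zero (p : Eu d × ℝ) (hp : p.2 = 0) (z : Eu d) :
    relPos η ψ p z = -fderiv ℝ ψ p.1 z := by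
  rw [relPos, hη.integral_smul_odd, FlatMap.diffQuot_zero p hp, zero_sub]
  intro ζ
  rw [FlatMap.diffQuot_zero p hp, FlatMap.diffQuot_zero p hp, map_neg, map_neg, neg_neg]

lemma norm_relPos_le (p : Eu d × ℝ) (z : Eu d) : ‖relPos η ψ p z‖ ≤ ε * (1 + ‖z‖) := by
  have h1 : ‖∫ ζ, η ζ • diffQuot ψ p (-ζ)‖ ≤ ε := hη.norm_integral_le fun ζ hζ => by
    refine (h.norm_diffQuot_le p (-ζ)).trans ?_
    rw [norm_neg]
    exact mul_le_of_le_one_right h.eps_nonneg hζ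
  have h2 := h.norm_diffQuot_le p z
  have := norm_sub_le (∫ ζ, η ζ • diffQuot ψ p (-ζ)) (diffQuot ψ p z)
  rw [relPos]
  linarith

lemma lipOn_relPos (z : Eu d) :
    LipOn (2 * L * (1 + ‖z‖) ^ 2) (fun p => relPos η ψ p z) univ := fun p hp p' hp' => by
  have h1 : LipOn (2 * L) (fun p => ∫ ζ, η ζ • diffQuot ψ p (-ζ)) univ := by
    refine hη.lipOn_integral (fun p => ?_) fun ζ hζ => ?_
    · exact h.continuous_diffQuot.comp (f := fun z : Eu d => (p, -z)) (by fun_prop)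
    · refine (h.lipOn_diffQuot (-ζ)).mono ?_ subset_rfl
      rw [norm_neg]
      have := h.lip_nonneg
      have h2 : (1 + ‖ζ‖) * ‖ζ‖ ≤ 2 := by nlinarith [norm_nonneg ζ]
      nlinarith
  have h2 := h1 p hp p' hp'
  have h3 := h.lipOn_diffQuot z p hp p' hp'
  have e : relPos η ψ p z - relPos η ψ p' z = ((∫ ζ, η ζ • diffQuot ψ p (-ζ)) -
      ∫ ζ, η ζ • diffQuot ψ p' (-ζ)) - (diffQuot ψ p z - diffQuot ψ p' z) := by
    simp only [relPos]; abel
  rw [e]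
  refine (norm_sub_le _ _).trans ?_
  have hz := norm_nonneg z
  have h4 : 2 * L * ‖p - p'‖ + L * (1 + ‖z‖) * ‖z‖ * ‖p - p'‖ ≤
      2 * L * (1 + ‖z‖) ^ 2 * ‖p - p'‖ := by
    rw [← add_mul]
    refine mul_le_mul_of_nonneg_right ?_ (norm_nonneg _)
    have h5 : 2 + (1 + ‖z‖) * ‖z‖ ≤ 2 * (1 + ‖z‖) ^ 2 := by nlinarith
    have := mul_le_mul_of_nonneg_left h5 h.lip_nonneg
    linarith
  linarith

/-- With z fixed in the convolution the derivative falls on ψ, which is C¹. Nothing is divided by r,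
so the formula holds for every real r, zero included. -/
lemma hasFDerivAt_phiS (p : Eu d × ℝ) :
    HasFDerivAt (fun p : Eu d × ℝ => phiS η ψ p.2 p.1) (mollDeriv η ψ p) p := by
  have hc := h.continuous_fderiv
  have hψ := h.continuous
  have hηc := hη.continuous
  have h0 : ∀ y ∉ closedBall (0 : Eu d) 1, η y = 0 := fun y hy =>
    hη.supp y (by rw [mem_closedBall_zero_iff, not_le] at hy; exact hy.le)
  refine hasFDerivAt_integral_of_compact (G := fun (p : Eu d × ℝ) z => η z • ψ (p.1 - p.2 • z))
    (G' := fun (p : Eu d × ℝ) z => η z • (fderiv ℝ ψ (p.1 - p.2 • z) ∘L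
      (ContinuousLinearMap.fst ℝ (Eu d) ℝ -
        (ContinuousLinearMap.snd ℝ (Eu d) ℝ).smulRight z)))
    (K := closedBall (0 : Eu d) 1) one_pos (isCompact_closedBall _ _) (fun p _ z => ?_) ?_
    (fun p _ => by fun_prop) (fun p _ y hy => ?_) (fun p _ y hy => ?_)
  · have h1 : HasFDerivAt (fun p : Eu d × ℝ => p.1 - p.2 • z)
        (ContinuousLinearMap.fst ℝ (Eu d) ℝ -
          (ContinuousLinearMap.snd ℝ (Eu d) ℝ).smulRight z) p :=
      (ContinuousLinearMap.fst ℝ (Eu d) ℝ -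
          (ContinuousLinearMap.snd ℝ (Eu d) ℝ).smulRight z).hasFDerivAt
    exact ((h.differentiable _).hasFDerivAt.comp p h1).const_smul (η z)
  · refine Continuous.continuousOn ?_
    simp only [Function.uncurry_def]
    fun_prop
  · rw [h0 y hy, zero_smul]
  · rw [h0 y hy]
    exact zero_smul ℝ _

lemma continuous_mollDeriv_integrand (p : Eu d × ℝ) : Continuous fun z =>
    (fderiv ℝ ψ (p.1 - p.2 • z) ∘L (ContinuousLinearMap.fst ℝ (Eu d) ℝ -
      (ContinuousLinearMap.snd ℝ (Eu d) ℝ).smulRight z)) := by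
  have hc := h.continuous_fderiv
  fun_prop

lemma mollDeriv_inl (p : Eu d × ℝ) :
    mollDeriv η ψ p ∘L ContinuousLinearMap.inl ℝ (Eu d) ℝ = mollB η ψ p := by
  have hc := h.continuous_fderiv
  ext1 u
  rw [ContinuousLinearMap.comp_apply, mollDeriv, mollB,
    ContinuousLinearMap.integral_apply
      (hη.integrable_smul (continuous_mollDeriv_integrand hη h p)),
    ContinuousLinearMap.integral_apply (hη.integrable_smul (by fun_prop))]
  simp

lemma norm_shear_le {z : Eu d} (hz : ‖z‖ ≤ 1) : ‖ContinuousLinearMap.fst ℝ (Eu d) ℝ -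
    (ContinuousLinearMap.snd ℝ (Eu d) ℝ).smulRight z‖ ≤ 2 := by
  refine ContinuousLinearMap.opNorm_le_bound _ zero_le_two fun q => ?_
  simp only [_root_.sub_apply, ContinuousLinearMap.coe_fst',
    ContinuousLinearMap.smulRight_apply, ContinuousLinearMap.coe_snd']
  refine (norm_sub_le _ _).trans ?_
  rw [norm_smul]
  have h3 : ‖q.1‖ ≤ ‖q‖ := _root_.norm_fst_le _
  have h4 : ‖q.2‖ ≤ ‖q‖ := _root_.norm_snd_le _
  have := mul_le_mul h4 hz (norm_nonneg _) (norm_nonneg _)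
  linarith

lemma norm_sub_arg_le (p p' : Eu d × ℝ) {z : Eu d} (hz : ‖z‖ ≤ 1) :
    ‖p.1 - p.2 • z - (p'.1 - p'.2 • z)‖ ≤ 2 * ‖p - p'‖ := by
  have e : p.1 - p.2 • z - (p'.1 - p'.2 • z) = (ContinuousLinearMap.fst ℝ (Eu d) ℝ -
    (ContinuousLinearMap.snd ℝ (Eu d) ℝ).smulRight z) (p - p') := by
    simp [sub_smul]; abel
  rw [e]
  exact ContinuousLinearMap.le_of_opNorm_le _ (norm_shear_le hη h hz) _

lemma norm_mollDeriv_le (p : Eu d × ℝ) : ‖mollDeriv η ψ p‖ ≤ 2 * ε :=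
  hη.norm_integral_le fun z hz => by
    refine (ContinuousLinearMap.opNorm_comp_le _ _).trans ?_
    have := mul_le_mul (h.small (p.1 - p.2 • z)) (norm_shear_le hη h hz) (norm_nonneg _)
      h.eps_nonneg
    linarith

lemma lipOn_mollDeriv : LipOn (4 * L) (mollDeriv η ψ) univ := by
  refine hη.lipOn_integral (continuous_mollDeriv_integrand hη h) fun z hz p _ p' _ => ?_
  rw [← ContinuousLinearMap.sub_comp]
  refine (ContinuousLinearMap.opNorm_comp_le _ _).trans ?_
  have h1 := mul_le_mul_of_nonneg_left (norm_sub_arg_le hη h p p' hz) h.lip_nonneg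
  have := mul_le_mul ((h.lip (p.1 - p.2 • z) (p'.1 - p'.2 • z)).trans h1) (norm_shear_le hη h hz)
    (norm_nonneg _) ((norm_nonneg _).trans ((h.lip _ _).trans h1))
  linarith

lemma norm_mollB_le (p : Eu d × ℝ) : ‖mollB η ψ p‖ ≤ ε :=
  hη.norm_integral_le fun z _ => h.small (p.1 - p.2 • z)

lemma lipOn_mollB : LipOn (2 * L) (mollB η ψ) univ := by
  have hc := h.continuous_fderiv
  refine hη.lipOn_integral (fun p => by fun_prop) fun z hz p _ p' _ => ?_
  have h1 := mul_le_mul_of_nonneg_left (norm_sub_arg_le hη h p p' hz) h.lip_nonneg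
  have := (h.lip (p.1 - p.2 • z) (p'.1 - p'.2 • z)).trans h1
  linarith

lemma mollB_zero (p : Eu d × ℝ) (hp : p.2 = 0) : mollB η ψ p = fderiv ℝ ψ p.1 := by
  simp only [mollB, hp, zero_smul, sub_zero]
  exact hη.integral_smul_const _

/-- The r-derivative of ψ_r at r = 0 is minus the first moment of η applied to ∇ψ(x), hence zero. -/
lemma mollDeriv_zero (p : Eu d × ℝ) (hp : p.2 = 0) :
    mollDeriv η ψ p = fderiv ℝ ψ p.1 ∘L ContinuousLinearMap.fst ℝ (Eu d) ℝ := by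
  have e : ∀ z, η z • (fderiv ℝ ψ (p.1 - p.2 • z) ∘L (ContinuousLinearMap.fst ℝ (Eu d) ℝ -
      (ContinuousLinearMap.snd ℝ (Eu d) ℝ).smulRight z)) =
      η z • (fderiv ℝ ψ p.1 ∘L ContinuousLinearMap.fst ℝ (Eu d) ℝ) -
      η z • (ContinuousLinearMap.snd ℝ (Eu d) ℝ).smulRight (fderiv ℝ ψ p.1 z) := fun z => by
    rw [hp, zero_smul, sub_zero]
    refine ContinuousLinearMap.ext fun q => ?_
    simp [smul_sub]
  rw [mollDeriv]
  simp_rw [e]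
  rw [integral_sub (hη.integrable_smul continuous_const) (hη.integrable_smul (by fun_prop)),
    hη.integral_smul_const, hη.integral_smul_odd, sub_zero]
  intro z
  refine ContinuousLinearMap.ext fun q => ?_
  simp

/-- At r = 0 the two terms are -∇ψ(x)z and ∇ψ(x)z. Both are Lipschitz in r, so the sum is O(r). This
cancellation later tames the cross term of the distance to the graph. -/
lemma relPos_add_mollB_le (p : Eu d × ℝ) (hp : 0 ≤ p.2) (z : Eu d) :
    ‖relPos η ψ p z + mollB η ψ p z‖ ≤ 4 * L * (1 + ‖z‖) ^ 2 * p.2 := by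
  have h0 : relPos η ψ (p.1, 0) z + mollB η ψ (p.1, 0) z = 0 := by
    rw [relPos_zero hη h _ rfl, mollB_zero hη h _ rfl, neg_add_cancel]
  have h1 := lipOn_relPos hη h z p (mem_univ _) (p.1, 0) (mem_univ _)
  have h2 := lipOn_mollB hη h p (mem_univ _) (p.1, 0) (mem_univ _)
  have h3 : ‖p - (p.1, 0)‖ = p.2 := by
    rw [Prod.norm_def]
    simp [hp]
  rw [h3] at h1 h2
  have h4 := ContinuousLinearMap.le_of_opNorm_le _ h2 z
  rw [_root_.sub_apply] at h4
  have e : relPos η ψ p z + mollB η ψ p z = (relPos η ψ p z - relPos η ψ (p.1, 0) z) +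
      (mollB η ψ p z - mollB η ψ (p.1, 0) z) := by
    rw [sub_add_sub_comm, h0, sub_zero]
  rw [e]
  refine (norm_add_le _ _).trans ?_
  have hz := norm_nonneg z
  have h5 : 2 * L * p.2 * ‖z‖ ≤ 2 * L * p.2 * (1 + ‖z‖) ^ 2 :=
    mul_le_mul_of_nonneg_left (by nlinarith) (by have := h.lip_nonneg; positivity)
  linarith

lemma lipOn_relPos_add_mollB (z : Eu d) :
    LipOn (4 * L * (1 + ‖z‖) ^ 2) (fun p => relPos η ψ p z + mollB η ψ p z) univ := by
  have h1 : LipOn (2 * L * ‖z‖) (fun p => mollB η ψ p z) univ := fun p hp p' hp' => by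
    rw [← _root_.sub_apply]
    have := ContinuousLinearMap.le_of_opNorm_le _ (lipOn_mollB hη h p hp p' hp') z
    linarith
  refine ((lipOn_relPos hη h z).add h1).mono ?_ subset_rfl
  have := h.lip_nonneg
  have h2 : ‖z‖ ≤ (1 + ‖z‖) ^ 2 := by nlinarith [norm_nonneg z]
  have := mul_le_mul_of_nonneg_left h2 this
  linarith

end

end Mollify

end HigherCodim

namespace HigherCodim

/-! ### Functions f with f and r∇f Lipschitz up to r = 0 -/

section Conic

variable {d m : ℕ} {V W U Y : Type*} [NormedAddCommGroup V] [NormedSpace ℝ V]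
  [NormedAddCommGroup W] [NormedSpace ℝ W] [NormedAddCommGroup U] [NormedSpace ℝ U]
  [NormedAddCommGroup Y] [NormedSpace ℝ Y]

/-- Functions of `(x, r)` that are Lipschitz up to `r = 0`, and whose derivative multiplied by `r`
is Lipschitz as well. -/
structure ConicReg (f : Eu d × ℝ → V) (C : ℝ) : Prop where
  bound : ∀ p ∈ slab d 1, ‖f p‖ ≤ C
  lip : LipOn C f (slab d 1)
  diff : ∀ p ∈ slab d 1, 0 < p.2 → DifferentiableAt ℝ f p
  lip_smul_fderiv : LipOn C (fun p => p.2 • fderiv ℝ f p) (slab d 1)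

lemma slab_nonempty : ((0, 0) : Eu d × ℝ) ∈ slab d 1 := ⟨le_rfl, one_pos⟩

namespace ConicReg

variable {f : Eu d × ℝ → V} {g : Eu d × ℝ → W} {C C' : ℝ}

lemma nonneg (h : ConicReg f C) : 0 ≤ C := (norm_nonneg _).trans (h.bound _ slab_nonempty)

lemma norm_smul_fderiv_le (h : ConicReg f C) {p : Eu d × ℝ} (hp : p ∈ slab d 1) :
    ‖p.2 • fderiv ℝ f p‖ ≤ C * p.2 := by
  rcases hp.1.eq_or_lt with h0 | h0
  · rw [← h0]; simp
  · rw [norm_smul, Real.norm_of_nonneg hp.1, mul_comm]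
    exact mul_le_mul_of_nonneg_right
      (h.lip.norm_fderiv_le h.nonneg (slab_mem_nhds h0 hp.2)) hp.1

lemma norm_smul_fderiv_le' (h : ConicReg f C) {p : Eu d × ℝ} (hp : p ∈ slab d 1) :
    ‖p.2 • fderiv ℝ f p‖ ≤ C :=
  (h.norm_smul_fderiv_le hp).trans (mul_le_of_le_one_right h.nonneg hp.2.le)

/-- It suffices to control `r ∇f` for `r > 0`. -/
lemma of_pos (hC : 0 ≤ C) (hb : ∀ p ∈ slab d 1, ‖f p‖ ≤ C) (hl : LipOn C f (slab d 1))
    {f₁ : Eu d × ℝ → (Eu d × ℝ) →L[ℝ] V}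
    (hd : ∀ p ∈ slab d 1, 0 < p.2 → HasFDerivAt f (p.2⁻¹ • f₁ p) p)
    (h1 : LipOn C f₁ (slab d 1)) : ConicReg f C := by
  have key : ∀ p ∈ slab d 1, 0 < p.2 → p.2 • fderiv ℝ f p = f₁ p := fun p hp h0 => by
    rw [(hd p hp h0).fderiv, smul_smul, mul_inv_cancel₀ h0.ne', one_smul]
  have key0 : ∀ p ∈ slab d 1, ‖p.2 • fderiv ℝ f p‖ ≤ C * p.2 := fun p hp => by
    rcases hp.1.eq_or_lt with h0 | h0
    · rw [← h0]; simp
    · rw [norm_smul, Real.norm_of_nonneg hp.1, mul_comm]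
      exact mul_le_mul_of_nonneg_right (hl.norm_fderiv_le hC (slab_mem_nhds h0 hp.2)) hp.1
  refine ⟨hb, hl, fun p hp h0 => (hd p hp h0).differentiableAt, fun p hp p' hp' => ?_⟩
  have h2 : |p.2 - p'.2| ≤ ‖p - p'‖ := _root_.norm_snd_le (p - p')
  -- If one point has r = 0, its weighted derivative is zero whatever `fderiv` is there, and |r∇f| ≤
  -- C r at the other point is at most C times the distance.
  rcases hp.1.eq_or_lt with h0 | h0
  · have := key0 p' hp'
    simp only [← h0, zero_smul, zero_sub, norm_neg]
    refine this.trans (mul_le_mul_of_nonneg_left ?_ hC)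
    rw [← h0, zero_sub, abs_neg] at h2
    exact (le_abs_self _).trans h2
  rcases hp'.1.eq_or_lt with h0' | h0'
  · have := key0 p hp
    simp only [← h0', zero_smul, sub_zero]
    refine this.trans (mul_le_mul_of_nonneg_left ?_ hC)
    rw [← h0', sub_zero] at h2
    exact (le_abs_self _).trans h2
  · simp only [key p hp h0, key p' hp' h0']
    exact h1 p hp p' hp'

lemma prodMk (hf : ConicReg f C) (hg : ConicReg g C') :
    ConicReg (fun p => (f p, g p)) (max C C') := by
  have hd : ∀ p ∈ slab d 1, 0 < p.2 → HasFDerivAt (fun p => (f p, g p))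
      (p.2⁻¹ • ((p.2 • fderiv ℝ f p).prod (p.2 • fderiv ℝ g p))) p := fun p hp h0 => by
    have h1 := (hf.diff p hp h0).hasFDerivAt.prodMk (hg.diff p hp h0).hasFDerivAt
    refine h1.congr_fderiv (ContinuousLinearMap.ext fun v => ?_)
    simp [smul_smul, inv_mul_cancel₀ h0.ne']
  refine of_pos (le_max_of_le_left hf.nonneg) (fun p hp => ?_) (hf.lip.prodMk hg.lip) hd ?_
  · rw [Prod.norm_mk]
    exact max_le_max (hf.bound p hp) (hg.bound p hp)
  · intro p hp p' hp'
    have h1 := hf.lip_smul_fderiv p hp p' hp'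
    have h2 := hg.lip_smul_fderiv p hp p' hp'
    have hm : 0 ≤ max C C' * ‖p - p'‖ :=
      mul_nonneg (le_max_of_le_left hf.nonneg) (norm_nonneg _)
    refine ContinuousLinearMap.opNorm_le_bound _ hm fun v => ?_
    have e : ((p.2 • fderiv ℝ f p).prod (p.2 • fderiv ℝ g p) -
        (p'.2 • fderiv ℝ f p').prod (p'.2 • fderiv ℝ g p')) v =
        ((p.2 • fderiv ℝ f p - p'.2 • fderiv ℝ f p') v,
          (p.2 • fderiv ℝ g p - p'.2 • fderiv ℝ g p') v) := rfl
    rw [e, Prod.norm_mk]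
    refine max_le ?_ ?_
    · refine ContinuousLinearMap.le_of_opNorm_le _ (h1.trans ?_) v
      exact mul_le_mul_of_nonneg_right (le_max_left _ _) (norm_nonneg _)
    · refine ContinuousLinearMap.le_of_opNorm_le _ (h2.trans ?_) v
      exact mul_le_mul_of_nonneg_right (le_max_right _ _) (norm_nonneg _)

end ConicReg

/-- The class is stable under composition with `C²` maps, with uniform constants. -/
lemma exists_conicReg_comp {G : V → W} {O K : Set V} (hO : IsOpen O) (hG : ContDiffOn ℝ 2 G O)
    (hK : IsCompact K) (hKO : K ⊆ O) (C : ℝ) : ∃ C', ∀ f : Eu d × ℝ → V, ConicReg f C →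
      MapsTo f (slab d 1) K → ConicReg (fun p => G (f p)) C' := by
  obtain ⟨C₁, hC₁, hl₁, hb₁⟩ := LipOn.of_contDiffOn hO (hG.of_le (by norm_num)) hK hKO
  obtain ⟨C₂, hC₂, hl₂, hb₂⟩ := LipOn.of_contDiffOn hO
    (hG.fderiv_of_isOpen (m := 1) hO (by norm_num)) hK hKO
  refine ⟨max C₁ (max (C₁ * C) (C₂ * C * C + C₂ * C)), fun f hf hfK => ?_⟩
  refine ConicReg.of_pos (le_max_of_le_left hC₁)
    (f₁ := fun p => fderiv ℝ G (f p) ∘L (p.2 • fderiv ℝ f p))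
    (fun p hp => (hb₁ _ (hfK hp)).trans (le_max_left _ _)) ?_ ?_ ?_
  · exact (hl₁.comp hf.lip hfK hC₁).mono
      ((le_max_left _ _).trans (le_max_right _ _)) subset_rfl
  · intro p hp h0
    have h1 : HasFDerivAt G (fderiv ℝ G (f p)) (f p) :=
      ((hG.differentiableOn (by norm_num)).differentiableAt
        (hO.mem_nhds (hKO (hfK hp)))).hasFDerivAt
    have h2 := h1.comp p (hf.diff p hp h0).hasFDerivAt
    refine h2.congr_fderiv ?_
    rw [ContinuousLinearMap.comp_smul, smul_smul, inv_mul_cancel₀ h0.ne', one_smul]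
  · exact ((hl₂.comp hf.lip hfK hC₂).clmComp hf.lip_smul_fderiv (fun p hp => hb₂ _ (hfK hp))
      fun p hp => hf.norm_smul_fderiv_le' hp).mono
      ((le_max_right _ _).trans (le_max_right _ _)) subset_rfl

/-- Integrals over the unit ball of `C¹` kernels depend in a Lipschitz way on Lipschitz data, with
uniform constants. -/
lemma exists_lipOn_kernel_integral [FiniteDimensional ℝ Y] {κ : Eu d × Y → U}
    (hκ : ContDiff ℝ 1 κ) (hκ0 : ∀ z y, 1 < ‖z‖ → κ (z, y) = 0) (b : U →L[ℝ] V →L[ℝ] W)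
    (A M : ℝ) :
    ∃ C, 0 ≤ C ∧ ∀ (Ly Lw : ℝ), 0 ≤ Ly → 0 ≤ Lw → ∀ (y : Eu d × ℝ → Eu d → Y) (w : Eu d → V), (∀ p, Continuous (y p)) →
      (∀ p z, ‖z‖ ≤ 1 → ‖y p z‖ ≤ A) → (∀ z, ‖z‖ ≤ 1 → LipOn Ly (y · z) univ) →
      Continuous w → (∀ x, ‖w x‖ ≤ M) → LipOn Lw w univ →
      (∀ p, ‖∫ z, b (κ (z, y p z)) (w (p.1 + p.2 • z))‖ ≤ C) ∧
      LipOn (C * (Ly + Lw)) (fun p => ∫ z, b (κ (z, y p z)) (w (p.1 + p.2 • z))) univ := by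
  obtain ⟨C₁, hC₁, hl₁, hb₁⟩ := LipOn.of_contDiff hκ (max 1 A)
  set v := (volume (closedBall (0 : Eu d) 1)).toReal
  have hci : ∀ c : ℝ, Integrable ((closedBall (0 : Eu d) 1).indicator fun _ => c) := fun c =>
    (integrable_indicator_iff measurableSet_closedBall).mpr
      (integrableOn_const measure_closedBall_lt_top.ne)
  have hcv : ∀ c : ℝ, ∫ z, (closedBall (0 : Eu d) 1).indicator (fun _ => c) z = v * c := fun c => by
    rw [integral_indicator measurableSet_closedBall, setIntegral_const, smul_eq_mul]
    rfl
  set c₁ := ‖b‖ * (C₁ * max M 0)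
  set c₂ := ‖b‖ * (C₁ * max M 0 + C₁ * 2)
  have hc₁ : 0 ≤ c₁ := by positivity
  have hc₂ : 0 ≤ c₂ := by positivity
  refine ⟨max (v * c₁) (v * c₂), le_max_of_le_left (by positivity),
    fun Ly Lw hLy hLw y w hyc hyA hyL hwc hwM hwL => ?_⟩
  have hmem : ∀ (p : Eu d × ℝ) (z : Eu d), ‖z‖ ≤ 1 → (z, y p z) ∈ closedBall (0 : Eu d × Y)
      (max 1 A) := fun p z hz => by
    rw [mem_closedBall_zero_iff, Prod.norm_mk]
    exact max_le_max hz (hyA p z hz)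
  have hcont : ∀ p : Eu d × ℝ, Continuous fun z => b (κ (z, y p z)) (w (p.1 + p.2 • z)) :=
    fun p => by
      have h1 : Continuous fun z => κ (z, y p z) :=
        hκ.continuous.comp (continuous_id.prodMk (hyc p))
      have h2 : Continuous fun z : Eu d => w (p.1 + p.2 • z) := hwc.comp (by fun_prop)
      exact b.continuous₂.comp (h1.prodMk h2)
  have hint : ∀ p : Eu d × ℝ, Integrable fun z => b (κ (z, y p z)) (w (p.1 + p.2 • z)) :=
    fun p => integrable_of_zero_off (hcont p) fun z hz => by rw [hκ0 _ _ hz, map_zero,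
      _root_.zero_apply]
  constructor
  · intro p
    refine le_trans ?_ (le_max_left _ _)
    rw [← hcv]
    refine integral_lipschitz_bound (hci _) fun z => ?_
    by_cases hz : ‖z‖ ≤ 1
    · rw [indicator_of_mem (by simpa using hz)]
      refine (b.le_opNorm₂ _ _).trans ?_
      rw [mul_assoc]
      exact mul_le_mul_of_nonneg_left (mul_le_mul (hb₁ _ (hmem p z hz))
        ((hwM _).trans (le_max_left _ _)) (norm_nonneg _) hC₁) (norm_nonneg b)
    · rw [indicator_of_notMem (by simpa using hz), hκ0 _ _ (not_le.mp hz), map_zero,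
        _root_.zero_apply, norm_zero]
  · have hc₃ : v * (‖b‖ * (C₁ * Ly * max M 0 + C₁ * (Lw * 2))) ≤
        max (v * c₁) (v * c₂) * (Ly + Lw) := by
      have h1 : ‖b‖ * (C₁ * Ly * max M 0 + C₁ * (Lw * 2)) ≤ c₂ * (Ly + Lw) := by
        have h2 : 0 ≤ ‖b‖ * (C₁ * max M 0) * Lw := by positivity
        have h3 : 0 ≤ ‖b‖ * (C₁ * 2) * Ly := by positivity
        have h4 : c₂ * (Ly + Lw) = ‖b‖ * (C₁ * Ly * max M 0 + C₁ * (Lw * 2)) +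
          ‖b‖ * (C₁ * max M 0) * Lw + ‖b‖ * (C₁ * 2) * Ly := by simp only [c₂]; ring
        linarith
      have hv : 0 ≤ v := ENNReal.toReal_nonneg
      refine (mul_le_mul_of_nonneg_left h1 hv).trans ?_
      rw [← mul_assoc]
      exact mul_le_mul_of_nonneg_right (le_max_right _ _) (by positivity)
    refine LipOn.mono ?_ hc₃ subset_rfl
    rw [← hcv]
    refine LipOn.integral (fun p _ => hint p) (hci _) fun z => ?_
    by_cases hz : ‖z‖ ≤ 1
    · rw [indicator_of_mem (by simpa using hz)]
      refine LipOn.bilin b ?_ ?_ (fun p _ => hb₁ _ (hmem p z hz))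
        fun p _ => (hwM _).trans (le_max_left _ _)
      · have := hl₁.comp ((LipOn.const z univ).prodMk (hyL z hz)) (fun p _ => hmem p z hz) hC₁
        rwa [max_eq_right hLy] at this
      · refine hwL.comp (g := fun p : Eu d × ℝ => p.1 + p.2 • z) (fun p _ p' _ => ?_)
          (fun _ _ => mem_univ _) hLw
        have e : p.1 + p.2 • z - (p'.1 + p'.2 • z) = (p - p').1 + (p - p').2 • z := by
          simp [sub_smul]; abel
        rw [e]
        refine (norm_add_le _ _).trans ?_
        rw [norm_smul]
        have h3 : ‖(p - p').1‖ ≤ ‖p - p'‖ := _root_.norm_fst_le _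
        have h4 : ‖(p - p').2‖ ≤ ‖p - p'‖ := _root_.norm_snd_le _
        have := mul_le_mul h4 hz (norm_nonneg _) (norm_nonneg _)
        linarith
    · rw [indicator_of_notMem (by simpa using hz)]
      intro p _ p' _
      simp [hκ0 _ _ (not_le.mp hz)]

end Conic

end HigherCodim

namespace HigherCodim

/-! ### Conic regularity of rescaled kernel integrals -/

section Kernel

variable {d m : ℕ} {V : Type*} [NormedAddCommGroup V] [NormedSpace ℝ V]

/-- `r` times the derivative in `(x, r)` of `r⁻ᵈ k((y - x) / r, q(x, r))`, up to the factor `r⁻ᵈ`,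
where `z = (y - x) / r`, `r q = ψ_r(x) - ψ(y)` and `P` is the derivative of `ψ_r(x)`. -/
noncomputable def kerDeriv (k : Eu d × Eu m → ℝ)
    (v : Eu d × (Eu m × ((Eu d × ℝ) →L[ℝ] Eu m))) : (Eu d × ℝ) →L[ℝ] ℝ :=
  fderiv ℝ k (v.1, v.2.1) ∘L
    (ContinuousLinearMap.inl ℝ (Eu d) (Eu m) ∘L (-ContinuousLinearMap.fst ℝ (Eu d) ℝ -
      (ContinuousLinearMap.snd ℝ (Eu d) ℝ).smulRight v.1) +
    ContinuousLinearMap.inr ℝ (Eu d) (Eu m) ∘L (v.2.2 -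
      (ContinuousLinearMap.snd ℝ (Eu d) ℝ).smulRight v.2.1)) -
  ((d : ℝ) * k (v.1, v.2.1)) • ContinuousLinearMap.snd ℝ (Eu d) ℝ

lemma kerDeriv_apply (k : Eu d × Eu m → ℝ) (v : Eu d × (Eu m × ((Eu d × ℝ) →L[ℝ] Eu m)))
    (q : Eu d × ℝ) : kerDeriv k v q = fderiv ℝ k (v.1, v.2.1)
      (-q.1 - q.2 • v.1, v.2.2 q - q.2 • v.2.1) - d * k (v.1, v.2.1) * q.2 := by
  have e : (ContinuousLinearMap.inl ℝ (Eu d) (Eu m) ∘L (-ContinuousLinearMap.fst ℝ (Eu d) ℝ -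
      (ContinuousLinearMap.snd ℝ (Eu d) ℝ).smulRight v.1) +
    ContinuousLinearMap.inr ℝ (Eu d) (Eu m) ∘L (v.2.2 -
      (ContinuousLinearMap.snd ℝ (Eu d) ℝ).smulRight v.2.1)) q =
      (-q.1 - q.2 • v.1, v.2.2 q - q.2 • v.2.1) := Prod.ext (by simp) (by simp)
  rw [kerDeriv, sub_apply, ContinuousLinearMap.comp_apply, e]
  rfl

lemma contDiff_kerDeriv {k : Eu d × Eu m → ℝ} (hk : ContDiff ℝ 2 k) :
    ContDiff ℝ 1 (kerDeriv k) := by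
  have h1 : ContDiff ℝ 1 (fderiv ℝ k) := hk.fderiv_right (by norm_num)
  have h2 : ContDiff ℝ 1 k := hk.of_le (by norm_num)
  unfold kerDeriv
  have hv : ContDiff ℝ 1 fun v : Eu d × (Eu m × ((Eu d × ℝ) →L[ℝ] Eu m)) => (v.1, v.2.1) := by
    fun_prop
  refine ContDiff.sub (ContDiff.clm_comp (h1.comp hv) (ContDiff.add ?_ ?_)) ?_
  · exact contDiff_const.clm_comp (contDiff_const.sub (contDiff_const.smulRight contDiff_fst))
  · refine contDiff_const.clm_comp (ContDiff.sub (by fun_prop) ?_)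
    exact contDiff_const.smulRight (by fun_prop)
  · exact (contDiff_const.mul (h2.comp hv)).smul contDiff_const

lemma fderiv_eq_zero_of_off {k : Eu d × Eu m → ℝ} (hk0 : ∀ z q, 1 < ‖z‖ → k (z, q) = 0)
    {z : Eu d} (q : Eu m) (hz : 1 < ‖z‖) : fderiv ℝ k (z, q) = 0 := by
  have : k =ᶠ[nhds (z, q)] fun _ => 0 := by
    have ho : IsOpen {v : Eu d × Eu m | 1 < ‖v.1‖} := isOpen_lt continuous_const (by fun_prop)
    filter_upwards [ho.mem_nhds hz] with v hv
    exact hk0 v.1 v.2 hv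
  rw [this.fderiv_eq, fderiv_fun_const, Pi.zero_apply]

lemma kerDeriv_off {k : Eu d × Eu m → ℝ} (hk0 : ∀ z q, 1 < ‖z‖ → k (z, q) = 0)
    (z : Eu d) (y : Eu m × ((Eu d × ℝ) →L[ℝ] Eu m)) (hz : 1 < ‖z‖) : kerDeriv k (z, y) = 0 := by
  rw [kerDeriv, fderiv_eq_zero_of_off hk0 _ hz, hk0 _ _ hz]
  simp

lemma hasDerivAt_inv_pow (d : ℕ) {r : ℝ} (hr : r ≠ 0) :
    HasDerivAt (fun r : ℝ => (r ^ d)⁻¹) (-((d : ℝ) * r⁻¹ * (r ^ d)⁻¹)) r := by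
  have h := (hasDerivAt_pow d r).inv (pow_ne_zero d hr)
  refine h.congr_deriv ?_
  cases d with
  | zero => simp
  | succ n => field_simp; simpa using (pow_succ r n).symm

variable {η : Eu d → ℝ} {ψ : Eu d → Eu m} {ε L : ℝ}

/-- The integral `∫ k(z, (ψ_r(x) - ψ(x + r z)) / r) w(x + r z) dz`. -/
noncomputable def kerInt (k : Eu d × Eu m → ℝ) (η : Eu d → ℝ) (ψ : Eu d → Eu m) (w : Eu d → V)
    (p : Eu d × ℝ) : V :=
  ∫ z, k (z, relPos η ψ p z) • w (p.1 + p.2 • z)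

/-- The derivative of `kerInt`, multiplied by `r`. -/
noncomputable def kerIntDeriv (k : Eu d × Eu m → ℝ) (η : Eu d → ℝ) (ψ : Eu d → Eu m) (w : Eu d → V)
    (p : Eu d × ℝ) : (Eu d × ℝ) →L[ℝ] V :=
  ∫ z, (kerDeriv k (z, relPos η ψ p z, mollDeriv η ψ p)).smulRight (w (p.1 + p.2 • z))

section

variable (hη : IsMollifier η) (h : FlatMap ψ ε L)
include hη h

lemma relPos_eq {p : Eu d × ℝ} (hp : p.2 ≠ 0) (z : Eu d) :
    relPos η ψ p z = p.2⁻¹ • (phiS η ψ p.2 p.1 - ψ (p.1 + p.2 • z)) := by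
  rw [← smul_relPos hη h, smul_smul, inv_mul_cancel₀ hp, one_smul]

/-- In the variable y the weight `w`, which need not be differentiable, does not depend on (x, r)
any more. Derivatives then meet only the smooth kernel and ψ_r. -/
lemma kerInt_eq (k : Eu d × Eu m → ℝ) (w : Eu d → V) {p : Eu d × ℝ} (hp : 0 < p.2) :
    kerInt k η ψ w p = ∫ y, ((p.2 ^ d)⁻¹ * k (p.2⁻¹ • (y - p.1),
      p.2⁻¹ • (phiS η ψ p.2 p.1 - ψ y))) • w y := by
  have := integral_comp_add_smul (fun y => k (p.2⁻¹ • (y - p.1),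
      p.2⁻¹ • (phiS η ψ p.2 p.1 - ψ y)) • w y) p.1 hp
  simp_rw [mul_smul]
  rw [integral_smul, ← this, kerInt]
  congr 1
  funext z
  rw [relPos_eq hη h hp.ne', add_sub_cancel_left, smul_smul, inv_mul_cancel₀ hp.ne', one_smul]

lemma smul_kerIntDeriv_eq (k : Eu d × Eu m → ℝ) (w : Eu d → V) {p : Eu d × ℝ} (hp : 0 < p.2) :
    p.2⁻¹ • kerIntDeriv k η ψ w p = ∫ y, ((p.2 ^ d)⁻¹ * p.2⁻¹) • (kerDeriv k (p.2⁻¹ • (y - p.1),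
      p.2⁻¹ • (phiS η ψ p.2 p.1 - ψ y), mollDeriv η ψ p)).smulRight (w y) := by
  have := integral_comp_add_smul (fun y => (kerDeriv k (p.2⁻¹ • (y - p.1),
      p.2⁻¹ • (phiS η ψ p.2 p.1 - ψ y), mollDeriv η ψ p)).smulRight (w y)) p.1 hp
  rw [integral_smul, mul_comm, mul_smul, ← this, kerIntDeriv]
  congr 2
  funext z
  rw [relPos_eq hη h hp.ne', add_sub_cancel_left, smul_smul, inv_mul_cancel₀ hp.ne', one_smul]

lemma hasFDerivAt_kernel {k : Eu d × Eu m → ℝ} (hk : ContDiff ℝ 2 k) (y : Eu d) (c : V)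
    {p : Eu d × ℝ} (hp : 0 < p.2) :
    HasFDerivAt (fun p : Eu d × ℝ => ((p.2 ^ d)⁻¹ * k (p.2⁻¹ • (y - p.1),
      p.2⁻¹ • (phiS η ψ p.2 p.1 - ψ y))) • c)
      (((p.2 ^ d)⁻¹ * p.2⁻¹) • (kerDeriv k (p.2⁻¹ • (y - p.1),
      p.2⁻¹ • (phiS η ψ p.2 p.1 - ψ y), mollDeriv η ψ p)).smulRight c) p := by
  have hs : HasFDerivAt (fun p : Eu d × ℝ => p.2) (ContinuousLinearMap.snd ℝ (Eu d) ℝ) p :=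
    hasFDerivAt_snd
  have hi : HasFDerivAt (fun p : Eu d × ℝ => p.2⁻¹)
      ((-(p.2 ^ 2)⁻¹) • ContinuousLinearMap.snd ℝ (Eu d) ℝ) p :=
    (hasDerivAt_inv hp.ne').comp_hasFDerivAt p hs
  have hn : HasFDerivAt (fun p : Eu d × ℝ => (p.2 ^ d)⁻¹)
      ((-((d : ℝ) * p.2⁻¹ * (p.2 ^ d)⁻¹)) • ContinuousLinearMap.snd ℝ (Eu d) ℝ) p :=
    (hasDerivAt_inv_pow d hp.ne').comp_hasFDerivAt p hs
  have h1 : HasFDerivAt (fun p : Eu d × ℝ => y - p.1) (-ContinuousLinearMap.fst ℝ (Eu d) ℝ) p :=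
    hasFDerivAt_fst.const_sub y
  have h2 : HasFDerivAt (fun p : Eu d × ℝ => phiS η ψ p.2 p.1 - ψ y) (mollDeriv η ψ p) p :=
    (hasFDerivAt_phiS hη h p).sub_const _
  have h3 : HasFDerivAt (fun p : Eu d × ℝ => (p.2⁻¹ • (y - p.1),
      p.2⁻¹ • (phiS η ψ p.2 p.1 - ψ y))) _ p := (hi.smul h1).prodMk (hi.smul h2)
  have h4 : HasFDerivAt (fun p : Eu d × ℝ => k (p.2⁻¹ • (y - p.1),
      p.2⁻¹ • (phiS η ψ p.2 p.1 - ψ y))) (fderiv ℝ k (p.2⁻¹ • (y - p.1),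
      p.2⁻¹ • (phiS η ψ p.2 p.1 - ψ y)) ∘L _) p :=
    ((hk.differentiable two_ne_zero) _).hasFDerivAt.comp p h3
  have h5 := (hn.mul h4).smul_const c
  refine h5.congr_fderiv (ContinuousLinearMap.ext fun q => ?_)
  set z := p.2⁻¹ • (y - p.1) with hz
  set v := p.2⁻¹ • (phiS η ψ p.2 p.1 - ψ y) with hv
  simp only [ContinuousLinearMap.smulRight_apply, smul_apply,
    add_apply, ContinuousLinearMap.comp_apply, ContinuousLinearMap.prod_apply,
    kerDeriv_apply, ContinuousLinearMap.coe_fst', ContinuousLinearMap.coe_snd',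
    neg_apply, smul_eq_mul, smul_smul]
  congr 1
  have e : (p.2⁻¹ • -q.1 + (-(p.2 ^ 2)⁻¹ * q.2) • (y - p.1),
      p.2⁻¹ • mollDeriv η ψ p q + (-(p.2 ^ 2)⁻¹ * q.2) • (phiS η ψ p.2 p.1 - ψ y)) =
      p.2⁻¹ • (-q.1 - q.2 • z, mollDeriv η ψ p q - q.2 • v) := by
    rw [Prod.smul_mk, hz, hv]
    congr 1 <;> module
  rw [e, map_smul, smul_eq_mul]
  ring

lemma hasFDerivAt_kerInt {k : Eu d × Eu m → ℝ} (hk : ContDiff ℝ 2 k)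
    (hk0 : ∀ z q, 1 < ‖z‖ → k (z, q) = 0) {w : Eu d → V} (hw : Continuous w) {p : Eu d × ℝ}
    (hp : 0 < p.2) : HasFDerivAt (kerInt k η ψ w) (p.2⁻¹ • kerIntDeriv k η ψ w p) p := by
  have hφ : Continuous fun p : Eu d × ℝ => phiS η ψ p.2 p.1 :=
    continuous_iff_continuousAt.mpr fun p => (hasFDerivAt_phiS hη h p).continuousAt
  have hm : Continuous (mollDeriv η ψ) :=
    continuousOn_univ.mp (lipOn_mollDeriv hη h).continuousOn
  have hψ := h.continuous
  have hkd := (contDiff_kerDeriv hk).continuous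
  have hkc := hk.continuous
  -- For p' within r/2 of p the kernel lives in |y - x'| ≤ r' ≤ 3r/2 and |x' - x| ≤ r/2, so the ball
  -- of radius 2r about x contains all the supports, and r' stays away from zero.
  have hpos : ∀ p' ∈ closedBall p (p.2 / 2), 0 < p'.2 ∧ p'.2 ≤ 3 / 2 * p.2 ∧
      ‖p'.1 - p.1‖ ≤ p.2 / 2 := fun p' hp' => by
    rw [mem_closedBall, dist_eq_norm] at hp'
    have h1 : |p'.2 - p.2| ≤ p.2 / 2 := (_root_.norm_snd_le (p' - p)).trans hp'
    have h2 : ‖p'.1 - p.1‖ ≤ p.2 / 2 := (_root_.norm_fst_le (p' - p)).trans hp'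
    rw [abs_le] at h1
    exact ⟨by linarith, by linarith, h2⟩
  have hoff : ∀ p' ∈ closedBall p (p.2 / 2), ∀ y ∉ closedBall p.1 (2 * p.2),
      1 < ‖p'.2⁻¹ • (y - p'.1)‖ := fun p' hp' y hy => by
    obtain ⟨h1, h2, h3⟩ := hpos p' hp'
    rw [mem_closedBall, not_le, dist_eq_norm] at hy
    rw [norm_smul, norm_inv, Real.norm_of_nonneg h1.le, ← div_eq_inv_mul, lt_div_iff₀ h1, one_mul]
    have h4 : ‖y - p.1‖ ≤ ‖y - p'.1‖ + ‖p'.1 - p.1‖ := norm_sub_le_norm_sub_add_norm_sub _ _ _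
    linarith
  rw [smul_kerIntDeriv_eq hη h k w hp]
  have key := hasFDerivAt_integral_of_compact (p₀ := p) (δ := p.2 / 2)
    (K := closedBall p.1 (2 * p.2))
    (G := fun p y => ((p.2 ^ d)⁻¹ * k (p.2⁻¹ • (y - p.1),
      p.2⁻¹ • (phiS η ψ p.2 p.1 - ψ y))) • w y)
    (G' := fun p y => ((p.2 ^ d)⁻¹ * p.2⁻¹) • (kerDeriv k (p.2⁻¹ • (y - p.1),
      p.2⁻¹ • (phiS η ψ p.2 p.1 - ψ y), mollDeriv η ψ p)).smulRight (w y))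
    (half_pos hp) (isCompact_closedBall _ _)
    (fun p' hp' y => hasFDerivAt_kernel hη h hk y (w y) (hpos p' hp').1) ?_
    (fun p' _ => by fun_prop)
    (fun p' hp' y hy => by rw [hk0 _ _ (hoff p' hp' y hy), mul_zero, zero_smul])
    (fun p' hp' y hy => ?_)
  · refine key.congr_of_eventuallyEq ?_
    have ho : IsOpen {p : Eu d × ℝ | 0 < p.2} := isOpen_lt continuous_const continuous_snd
    filter_upwards [ho.mem_nhds hp] with p' hp'
    exact kerInt_eq hη h k w hp'
  · have hinv : ContinuousOn (fun u : (Eu d × ℝ) × Eu d => u.1.2⁻¹)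
        (closedBall p (p.2 / 2) ×ˢ univ) :=
      ContinuousOn.inv₀ (by fun_prop) fun u hu => (hpos u.1 hu.1).1.ne'
    have hinv' : ContinuousOn (fun u : (Eu d × ℝ) × Eu d => (u.1.2 ^ d)⁻¹)
        (closedBall p (p.2 / 2) ×ˢ univ) :=
      ContinuousOn.inv₀ (by fun_prop) fun u hu => (pow_pos (hpos u.1 hu.1).1 d).ne'
    have h1 : ContinuousOn (fun u : (Eu d × ℝ) × Eu d => (u.1.2⁻¹ • (u.2 - u.1.1),
        u.1.2⁻¹ • (phiS η ψ u.1.2 u.1.1 - ψ u.2), mollDeriv η ψ u.1))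
        (closedBall p (p.2 / 2) ×ˢ univ) := by
      refine ContinuousOn.prodMk (hinv.smul (by fun_prop)) (ContinuousOn.prodMk (hinv.smul ?_) ?_)
      · exact ((hφ.comp continuous_fst).sub (hψ.comp continuous_snd)).continuousOn
      · exact (hm.comp continuous_fst).continuousOn
    have h2 := hkd.comp_continuousOn h1
    have h3 : Continuous fun q : ((Eu d × ℝ) →L[ℝ] ℝ) × V => q.1.smulRight q.2 :=
      (ContinuousLinearMap.smulRightL ℝ (Eu d × ℝ) V).continuous₂
    exact (hinv'.mul hinv).smul (h3.comp_continuousOn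
      (h2.prodMk (hw.comp continuous_snd).continuousOn))
  · rw [kerDeriv_off hk0 _ _ (hoff p' hp' y hy)]
    simp

end

/-- The integrals `kerInt` are regular, with uniform constants. -/
lemma exists_conicReg_kerInt (hη : IsMollifier η) {k : Eu d × Eu m → ℝ} (hk : ContDiff ℝ 2 k)
    (hk0 : ∀ z q, 1 < ‖z‖ → k (z, q) = 0) (L M Lw : ℝ) (hLw : 0 ≤ Lw) :
    ∃ C, ∀ (ψ : Eu d → Eu m) (w : Eu d → V), FlatMap ψ 1 L → Continuous w → (∀ x, ‖w x‖ ≤ M) →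
      LipOn Lw w univ → ConicReg (kerInt k η ψ w) C := by
  obtain ⟨C₁, hC₁, h₁⟩ := exists_lipOn_kernel_integral (κ := k) (hk.of_le (by norm_num)) hk0
    (ContinuousLinearMap.lsmul ℝ ℝ : ℝ →L[ℝ] V →L[ℝ] V) 2 M
  obtain ⟨C₂, hC₂, h₂⟩ := exists_lipOn_kernel_integral (κ := kerDeriv k) (contDiff_kerDeriv hk)
    (kerDeriv_off hk0) (ContinuousLinearMap.smulRightL ℝ (Eu d × ℝ) V) 2 M
  refine ⟨max (max C₁ (C₁ * (8 * L + Lw))) (C₂ * (8 * L + Lw)), fun ψ w hψ hwc hwM hwL => ?_⟩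
  have hL : 0 ≤ 8 * L := by have := hψ.lip_nonneg; positivity
  have hq : ∀ (p : Eu d × ℝ) (z : Eu d), ‖z‖ ≤ 1 → ‖relPos η ψ p z‖ ≤ 2 := fun p z hz => by
    have := norm_relPos_le hη hψ p z
    linarith
  have hql : ∀ z : Eu d, ‖z‖ ≤ 1 → LipOn (8 * L) (fun p => relPos η ψ p z) univ := fun z hz => by
    refine (lipOn_relPos hη hψ z).mono ?_ subset_rfl
    have h4 : (1 + ‖z‖) ^ 2 ≤ 4 := by nlinarith [norm_nonneg z]
    have := mul_le_mul_of_nonneg_left h4 hψ.lip_nonneg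
    linarith
  obtain ⟨hb, hl⟩ := h₁ _ _ hL hLw (relPos η ψ) w (continuous_relPos hη hψ) hq hql hwc hwM hwL
  obtain ⟨-, hl'⟩ := h₂ _ _ hL hLw (fun p z => (relPos η ψ p z, mollDeriv η ψ p)) w
    (fun p => (continuous_relPos hη hψ p).prodMk continuous_const)
    (fun p z hz => by
      rw [Prod.norm_mk]
      exact max_le (hq p z hz) (by simpa using norm_mollDeriv_le hη hψ p))
    (fun z hz => by
      refine ((hql z hz).prodMk (lipOn_mollDeriv hη hψ)).mono ?_ subset_rfl
      exact max_le le_rfl (by have := hψ.lip_nonneg; linarith)) hwc hwM hwL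
  exact ConicReg.of_pos (le_max_of_le_left (le_max_of_le_left hC₁))
    (fun p _ => (hb p).trans ((le_max_left _ _).trans (le_max_left _ _)))
    (hl.mono ((le_max_right _ _).trans (le_max_left _ _)) (subset_univ _))
    (fun p _ h0 => hasFDerivAt_kerInt hη hψ hk hk0 hwc h0)
    (hl'.mono (le_max_right _ _) (subset_univ _))

end Kernel

end HigherCodim

namespace HigherCodim

/-! ### The density, the stretching factor and the model of ρ -/

section Density

variable {d m : ℕ} {θ : Amb d m → ℝ} {η : Eu d → ℝ} {ψ : Eu d → Eu m} {ε L : ℝ}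

namespace IsCutoff

lemma nonneg (hθ : IsCutoff θ) (X : Amb d m) : 0 ≤ θ X :=
  (indicator_nonneg (fun _ _ => zero_le_one) X).trans (hθ.lower X)

lemma off (hθ : IsCutoff θ) {X : Amb d m} (hX : 1 ≤ ‖X‖) : θ X = 0 := by
  refine le_antisymm ((hθ.upper X).trans ?_) (hθ.nonneg X)
  rw [indicator_of_notMem]
  simpa using hX

lemma le_one (hθ : IsCutoff θ) (X : Amb d m) : θ X ≤ 1 :=
  (hθ.upper X).trans (indicator_le_self' (fun _ _ => zero_le_one) X)

lemma continuous (hθ : IsCutoff θ) : Continuous θ := hθ.smooth.continuous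

lemma continuous_slice (hθ : IsCutoff θ) : Continuous fun y : Eu d => θ (pt y 0) :=
  hθ.continuous.comp (inlL d m).continuous

lemma off_pt (hθ : IsCutoff θ) {x : Eu d} (hx : 1 ≤ ‖x‖) (t : Eu m) : θ (pt x t) = 0 :=
  hθ.off (hx.trans (norm_le_norm_pt x t))

end IsCutoff

/-- The integral of the cut-off over `ℝ^d`. -/
noncomputable def lam0 (θ : Amb d m → ℝ) : ℝ := ∫ y : Eu d, θ (pt y 0)

lemma lam0_pos (hθ : IsCutoff θ) : 0 < lam0 θ := by
  have hi : Integrable fun y : Eu d => θ (pt y 0) :=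
    integrable_of_zero_off hθ.continuous_slice fun z hz => hθ.off_pt hz.le 0
  refine (integral_pos_iff_support_of_nonneg (fun y => hθ.nonneg _) hi).mpr ?_
  refine lt_of_lt_of_le (measure_ball_pos volume (0 : Eu d) (half_pos one_pos)) (measure_mono ?_)
  intro y hy
  have h1 := hθ.lower (pt y 0)
  rw [indicator_of_mem (by simpa using hy)] at h1
  exact (lt_of_lt_of_le one_pos h1).ne'

/-- The kernel of the density. -/
noncomputable def thetaKer (θ : Amb d m → ℝ) (v : Eu d × Eu m) : ℝ := θ (pt (-v.1) v.2)

lemma contDiff_thetaKer (hθ : IsCutoff θ) {n : ℕ∞} : ContDiff ℝ n (thetaKer θ) := by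
  have h1 : ContDiff ℝ n fun v : Eu d × Eu m => ptL d m (-v.1, v.2) :=
    (ptL d m).contDiff.comp (by fun_prop)
  exact (hθ.smooth.of_le (by exact_mod_cast le_top)).comp h1

lemma thetaKer_off (hθ : IsCutoff θ) (z : Eu d) (q : Eu m) (hz : 1 < ‖z‖) :
    thetaKer θ (z, q) = 0 := hθ.off_pt (by simpa using hz.le) q

/-- The area density of the graph of `ψ`. -/
noncomputable def areaW (ψ : Eu d → Eu m) (y : Eu d) : ℝ := areaFactor (fderiv ℝ ψ y)

lemma areaW_nonneg (ψ : Eu d → Eu m) (y : Eu d) : 0 ≤ areaW ψ y := areaFactor_nonneg _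

lemma exists_areaW_bounds (d m : ℕ) : ∃ C, 0 ≤ C ∧ ∀ (ψ : Eu d → Eu m) (ε L : ℝ), FlatMap ψ ε L →
    ε ≤ 1 → (∀ y, |areaW ψ y - 1| ≤ C * ε) ∧ LipOn (C * L) (areaW ψ) univ := by
  obtain ⟨C, hC, hl⟩ := areaFactor_lipschitz d m
  refine ⟨C, hC, fun ψ ε L h hε => ⟨fun y => ?_, ?_⟩⟩
  · have hy := h.small y
    have := hl (fderiv ℝ ψ y) (by simpa using hy.trans hε) 0 (by simp)
    rw [areaFactor_zero, sub_zero] at this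
    exact this.trans (mul_le_mul_of_nonneg_left hy hC)
  · refine hl.comp (fun x _ y _ => h.lip x y) (fun y _ => ?_) hC
    simpa using (h.small y).trans hε

/-- The density `λ(x, r)` of the graph, normalised by `a₀ = 1` and extended to `r = 0`. -/
noncomputable def lamT (η : Eu d → ℝ) (θ : Amb d m → ℝ) (ψ : Eu d → Eu m) (p : Eu d × ℝ) : ℝ :=
  kerInt (thetaKer θ) η ψ (areaW ψ) p

lemma lamT_nonneg (hθ : IsCutoff θ) (p : Eu d × ℝ) : 0 ≤ lamT η θ ψ p :=
  integral_nonneg fun _ => mul_nonneg (hθ.nonneg _) (areaW_nonneg _ _)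

lemma density_eq (hη : IsMollifier η) (h : FlatMap ψ ε L) (a₀ : ℝ) (x : Eu d) {r : ℝ}
    (hr : 0 < r) : density η θ a₀ (graphSet ψ) ψ x r = a₀⁻¹ * lamT η θ ψ (x, r) := by
  rw [density, lamT, kerInt_eq hη h _ _ hr, integral_graphSet h, mul_assoc]
  congr 1
  rw [← integral_const_mul]
  congr 1
  funext y
  have e : r⁻¹ • (PhiS η ψ r x - graphMap ψ y) =
      pt (-(r⁻¹ • (y - x))) (r⁻¹ • (phiS η ψ r x - ψ y)) := by
    rw [PhiS, graphMap, pt_sub, smul_pt, ← smul_neg, neg_sub]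
  rw [e, thetaKer, smul_eq_mul, areaW]
  ring

lemma mollB_eq_kerInt (hη : IsMollifier η) (ψ : Eu d → Eu m) :
    mollB η ψ = kerInt (fun v : Eu d × Eu m => η v.1) η ψ (fderiv ℝ ψ) := by
  funext p
  have := integral_neg_eq_self (fun z => η z • fderiv ℝ ψ (p.1 + p.2 • z))
    (volume : Measure (Eu d))
  rw [kerInt, ← this, mollB]
  simp_rw [hη.even, smul_neg, ← sub_eq_add_neg]

/-- The normalised stretching factor `(λ(x, r) / λ₀)^{1/β}`. -/
noncomputable def scal (η : Eu d → ℝ) (θ : Amb d m → ℝ) (β : ℝ) (ψ : Eu d → Eu m)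
    (p : Eu d × ℝ) : ℝ := (lamT η θ ψ p / lam0 θ) ^ (1 / β)

/-- The matrix `h R` restricted to `ℝ^m` and normalised by `κ = 1`. -/
noncomputable def stretch (η : Eu d → ℝ) (θ : Amb d m → ℝ) (β : ℝ) (ψ : Eu d → Eu m)
    (p : Eu d × ℝ) : Eu m →L[ℝ] Amb d m := scal η θ β ψ p • frame (mollB η ψ p)

/-- Dividing the density by its flat value λ₀ isolates κ, through which alone c_β and a₀ enter. The
remaining factor is close to 1. -/
lemma hFun_eq (hη : IsMollifier η) (hθ : IsCutoff θ) (h : FlatMap ψ ε L) {a₀ β : ℝ} (ha : 0 < a₀)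
    (x : Eu d) {r : ℝ} (hr : 0 < r) : hFun η θ a₀ β (graphSet ψ) ψ x r =
      flatStretch θ a₀ β * scal η θ β ψ (x, r) := by
  have h0 := lam0_pos hθ
  have hc : 0 ≤ cBeta d β := integral_nonneg fun y => by positivity
  rw [hFun, density_eq hη h a₀ x hr, flatStretch, scal, ← Real.mul_rpow]
  · change _ = (cBeta d β * (a₀⁻¹ * lam0 θ) * _) ^ _
    field_simp
  · exact mul_nonneg hc (mul_nonneg (inv_nonneg.mpr ha.le) h0.le)
  · exact div_nonneg (lamT_nonneg hθ _) h0.le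

/-- The gradient of the j-th component of ψ_r is the transpose of `mollB` applied to e_j, so the ŵ^j
are the `normalVec`. The v^i do not contribute to the image of (0, t). -/
lemma rot_eq (hη : IsMollifier η) (h : FlatMap ψ ε L) (x : Eu d) (r : ℝ) (t : Eu m) :
    rot η ψ x r (pt 0 t) = frame (mollB η ψ (x, r)) t := by
  have hw : wHat η ψ x r = normalVec (mollB η ψ (x, r)) := by
    funext j
    have h1 : HasFDerivAt (fun y => phiS η ψ r y) (mollB η ψ (x, r)) x := by
      have h2 := (hasFDerivAt_phiS hη h (x, r)).comp x (hasFDerivAt_prodMk_left (𝕜 := ℝ) x r)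
      rwa [mollDeriv_inl hη h] at h2
    have h3 : HasFDerivAt (fun y => phiS η ψ r y j)
        (innerSL ℝ (EuclideanSpace.single j (1 : ℝ)) ∘L mollB η ψ (x, r)) x := by
      have h4 := (innerSL ℝ (EuclideanSpace.single j (1 : ℝ) : Eu m)).hasFDerivAt.comp x h1
      refine h4.congr_of_eventuallyEq (Filter.Eventually.of_forall fun y => ?_)
      simp [EuclideanSpace.inner_single_left]
    rw [wHat, normalVec]
    congr 2
    refine ext_inner_right ℝ fun u => ?_
    rw [gradient, InnerProductSpace.toDual_symm_apply, h3.fderiv,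
      ContinuousLinearMap.adjoint_inner_left]
    rfl
  rw [rot, frame_apply, hw]
  simp

/-- The model of `ρ` for the graph of `ψ`. -/
noncomputable def modelRho (η : Eu d → ℝ) (θ : Amb d m → ℝ) (β κ : ℝ) (ψ : Eu d → Eu m)
    (X : Amb d m) : Amb d m :=
  pt X.fst (phiS η ψ ‖X.snd‖ X.fst) + κ • stretch η θ β ψ (cyl X) X.snd

lemma rho_graph_eq (hη : IsMollifier η) (hθ : IsCutoff θ) (h : FlatMap ψ ε L) {a₀ β : ℝ}
    (ha : 0 < a₀) (X : Amb d m) :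
    rho η θ a₀ β (graphSet ψ) ψ X = modelRho η θ β (flatStretch θ a₀ β) ψ X := by
  rw [rho, modelRho, PhiS, rot_eq hη h]
  congr 1
  by_cases hX : X.snd = 0
  · simp [hX]
  · rw [hFun_eq hη hθ h ha _ (norm_pos_iff.mpr hX), mul_smul]
    rfl

end Density

/-! ### Size and regularity of the stretching -/

section FirstOrder

variable {d m : ℕ}

/-- On [1/2, ∞) the derivative a s^{a-1} is at most 2 for every exponent in [0, 1]. With a = 1/β the
bounds are uniform in β, which is why the radius r̄ does not depend on β. -/
lemma rpow_sub_le {s t a : ℝ} (hs : 1 / 2 ≤ s) (ht : 1 / 2 ≤ t) (ha0 : 0 ≤ a) (ha : a ≤ 1) :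
    |s ^ a - t ^ a| ≤ 2 * |s - t| := by
  have := (convex_Ici (1 / 2 : ℝ)).norm_image_sub_le_of_norm_hasDerivWithin_le (C := 2)
    (f := fun s : ℝ => s ^ a) (f' := fun s => a * s ^ (a - 1)) (fun s hs => by
      have hs : (1 / 2 : ℝ) ≤ s := hs
      exact (Real.hasDerivAt_rpow_const (Or.inl (by linarith : s ≠ 0))).hasDerivWithinAt)
    (fun s hs => by
      have hs : (1 / 2 : ℝ) ≤ s := hs
      have h0 : 0 ≤ s ^ (a - 1) := Real.rpow_nonneg (by linarith) _
      rw [Real.norm_of_nonneg (mul_nonneg ha0 h0)]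
      have h1 : s ^ (a - 1) ≤ (1 / 2 : ℝ) ^ (a - 1) :=
        Real.rpow_le_rpow_of_nonpos (by norm_num) hs (by linarith)
      have h2 : (1 / 2 : ℝ) ^ (a - 1) ≤ (1 / 2 : ℝ) ^ (-1 : ℝ) :=
        Real.rpow_le_rpow_of_exponent_ge (by norm_num) (by norm_num) (by linarith)
      have h3 : (1 / 2 : ℝ) ^ (-1 : ℝ) = 2 := by rw [Real.rpow_neg_one]; norm_num
      nlinarith) (show t ∈ Ici (1 / 2 : ℝ) from ht) (show s ∈ Ici (1 / 2 : ℝ) from hs)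
  simpa using this

variable {θ : Amb d m → ℝ} {η : Eu d → ℝ}

/-- The density departs from its flat value λ₀ through the vertical argument of θ, of size 2ε, and
through the area factor, which is 1 + O(ε). -/
lemma exists_lamT_bounds (hη : IsMollifier η) (hθ : IsCutoff θ) : ∃ C, 0 ≤ C ∧
    ∀ (ψ : Eu d → Eu m) (ε L : ℝ), FlatMap ψ ε L → ε ≤ 1 →
      (∀ p, |lamT η θ ψ p - lam0 θ| ≤ C * ε) ∧ LipOn (C * L) (lamT η θ ψ) univ := by
  obtain ⟨Cw, hCw, hw⟩ := exists_areaW_bounds d m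
  obtain ⟨C₁, hC₁, h₁⟩ := exists_lipOn_kernel_integral (κ := thetaKer θ)
    (contDiff_thetaKer hθ (n := 1)) (thetaKer_off hθ)
    (ContinuousLinearMap.lsmul ℝ ℝ : ℝ →L[ℝ] ℝ →L[ℝ] ℝ) 2 (1 + Cw)
  have hk1 : ContDiff ℝ 1 (thetaKer θ) := contDiff_thetaKer hθ (n := 1)
  obtain ⟨C₂, hC₂, hl₂, -⟩ := LipOn.of_contDiff hk1 2
  set v := (volume (closedBall (0 : Eu d) 1)).toReal
  have hv : 0 ≤ v := ENNReal.toReal_nonneg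
  refine ⟨max (v * (C₂ * 2 * (1 + Cw) + Cw)) (C₁ * (8 + Cw)), le_max_of_le_left (by positivity),
    fun ψ ε L h hε => ?_⟩
  obtain ⟨hw1, hwl⟩ := hw ψ ε L h hε
  have hε0 := h.eps_nonneg
  have hL := h.lip_nonneg
  have hwM : ∀ y, ‖areaW ψ y‖ ≤ 1 + Cw := fun y => by
    have h1 := hw1 y
    rw [Real.norm_of_nonneg (areaW_nonneg _ _)]
    have h2 := (abs_le.mp h1).2
    nlinarith
  have hwc : Continuous (areaW ψ) := continuousOn_univ.mp hwl.continuousOn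
  have hq : ∀ (p : Eu d × ℝ) (z : Eu d), ‖z‖ ≤ 1 → ‖relPos η ψ p z‖ ≤ 2 * ε := fun p z hz => by
    have := norm_relPos_le hη h p z
    nlinarith
  constructor
  · intro p
    have hci : Integrable ((closedBall (0 : Eu d) 1).indicator
        fun _ => (C₂ * 2 * (1 + Cw) + Cw) * ε) :=
      (integrable_indicator_iff measurableSet_closedBall).mpr
        (integrableOn_const measure_closedBall_lt_top.ne)
    have e1 : lam0 θ = ∫ z : Eu d, thetaKer θ (z, 0) := by
      have := integral_neg_eq_self (fun y : Eu d => θ (pt y 0)) volume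
      rw [lam0, ← this]
      rfl
    have hrel := continuous_relPos hη h p
    have hkc := (contDiff_thetaKer hθ (n := 0)).continuous
    have hi1 : Integrable fun z => thetaKer θ (z, relPos η ψ p z) • areaW ψ (p.1 + p.2 • z) :=
      integrable_of_zero_off (by fun_prop) fun z hz => by rw [thetaKer_off hθ _ _ hz, zero_smul]
    have hi2 : Integrable fun z : Eu d => thetaKer θ (z, 0) :=
      integrable_of_zero_off (by fun_prop) fun z hz => thetaKer_off hθ _ _ hz
    rw [lamT, kerInt, e1, ← integral_sub hi1 hi2, ← Real.norm_eq_abs]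
    refine (integral_lipschitz_bound hci fun z => ?_).trans ?_
    · by_cases hz : ‖z‖ ≤ 1
      · rw [indicator_of_mem (by simpa using hz)]
        have h2 := hl₂ (z, relPos η ψ p z) (by
          rw [mem_closedBall_zero_iff, Prod.norm_mk]
          exact max_le (by linarith) ((hq p z hz).trans (by linarith))) (z, 0) (by
          rw [mem_closedBall_zero_iff, Prod.norm_mk, norm_zero]
          exact max_le (by linarith) (by norm_num))
        have h3 : ‖((z, relPos η ψ p z) : Eu d × Eu m) - (z, 0)‖ ≤ 2 * ε := by
          rw [Prod.mk_sub_mk, Prod.norm_mk, sub_self, norm_zero, sub_zero]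
          exact max_le (by linarith) (hq p z hz)
        have h4 := h2.trans (mul_le_mul_of_nonneg_left h3 hC₂)
        have h5 := hw1 (p.1 + p.2 • z)
        have h6 : |thetaKer θ (z, 0)| ≤ 1 := by
          rw [thetaKer, abs_of_nonneg (hθ.nonneg _)]; exact hθ.le_one _
        have e : thetaKer θ (z, relPos η ψ p z) • areaW ψ (p.1 + p.2 • z) - thetaKer θ (z, 0) =
            (thetaKer θ (z, relPos η ψ p z) - thetaKer θ (z, 0)) * areaW ψ (p.1 + p.2 • z) +
            thetaKer θ (z, 0) * (areaW ψ (p.1 + p.2 • z) - 1) := by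
          rw [smul_eq_mul]; ring
        rw [e]
        refine (norm_add_le _ _).trans ?_
        rw [norm_mul, norm_mul]
        have h7 := mul_le_mul h4 (hwM (p.1 + p.2 • z)) (norm_nonneg _) (by positivity)
        have h8 := mul_le_mul h6 h5 (abs_nonneg _) zero_le_one
        simp only [Real.norm_eq_abs] at h7 ⊢
        nlinarith
      · rw [indicator_of_notMem (by simpa using hz), thetaKer_off hθ _ _ (not_le.mp hz),
          thetaKer_off hθ _ _ (not_le.mp hz)]
        simp
    · rw [integral_indicator measurableSet_closedBall, setIntegral_const, smul_eq_mul]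
      change v * _ ≤ _
      rw [← mul_assoc]
      exact mul_le_mul_of_nonneg_right (le_max_left _ _) hε0
  · obtain ⟨-, hl⟩ := h₁ (8 * L) (Cw * L) (by positivity) (by positivity) (relPos η ψ) (areaW ψ)
      (continuous_relPos hη h) (fun p z hz => (hq p z hz).trans (by linarith)) (fun z hz => by
        refine (lipOn_relPos hη h z).mono ?_ subset_rfl
        have h4 : (1 + ‖z‖) ^ 2 ≤ 4 := by nlinarith [norm_nonneg z]
        have := mul_le_mul_of_nonneg_left h4 hL
        linarith) hwc hwM hwl
    refine LipOn.mono hl ?_ subset_rfl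
    calc C₁ * (8 * L + Cw * L) = C₁ * (8 + Cw) * L := by ring
      _ ≤ _ := mul_le_mul_of_nonneg_right (le_max_right _ _) hL

/-- First order control of the stretching matrix, uniform in `β`. -/
lemma exists_stretch_bounds (hη : IsMollifier η) (hθ : IsCutoff θ) : ∃ ε₀ C, 0 < ε₀ ∧ ε₀ ≤ 1 ∧
    0 ≤ C ∧ ∀ (ψ : Eu d → Eu m) (ε L β : ℝ), FlatMap ψ ε L → ε ≤ ε₀ → 1 ≤ β →
      (∀ p, lamT η θ ψ p / lam0 θ ∈ Icc (1 / 2 : ℝ) (3 / 2)) ∧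
      (∀ p, |scal η θ β ψ p - 1| ≤ C * ε) ∧ (∀ p, |scal η θ β ψ p - 1| ≤ 1 / 2) ∧
      LipOn (C * L) (scal η θ β ψ) univ ∧
      (∀ p, ‖stretch η θ β ψ p - inrL d m‖ ≤ C * ε) ∧ LipOn (C * L) (stretch η θ β ψ) univ := by
  obtain ⟨C₁, hC₁, h₁⟩ := exists_lamT_bounds hη hθ
  obtain ⟨C₂, hC₂, hl₂, hb₂⟩ := LipOn.of_contDiff (contDiff_frame (d := d) (m := m) (n := 1)) 1
  have h0 := lam0_pos hθ
  set C₃ := C₁ / lam0 θ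
  have hC₃ : 0 ≤ C₃ := by positivity
  -- This ε₀ gives C₃ε ≤ 1/4. The density ratio then lies in [1/2, 3/2], where the power has
  -- Lipschitz constant at most 2, and the stretching factor deviates from 1 by at most 1/2.
  refine ⟨min 1 (1 / (4 * (C₃ + 1))), max (2 * C₃ * 1 + C₂) (2 * C₃ + 2 * (C₂ * 2)), by positivity,
    min_le_left _ _, le_max_of_le_left (by positivity), fun ψ ε L β h hε hβ => ?_⟩
  have hε1 : ε ≤ 1 := hε.trans (min_le_left _ _)
  have hε0 := h.eps_nonneg
  have hL := h.lip_nonneg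
  have hβ0 : 0 < β := by linarith
  have ha0 : 0 ≤ 1 / β := by positivity
  have ha1 : 1 / β ≤ 1 := by rw [div_le_one hβ0]; exact hβ
  obtain ⟨hb, hl⟩ := h₁ ψ ε L h hε1
  have hq : ∀ p, |lamT η θ ψ p / lam0 θ - 1| ≤ C₃ * ε := fun p => by
    have e : lamT η θ ψ p / lam0 θ - 1 = (lamT η θ ψ p - lam0 θ) / lam0 θ := by field_simp
    rw [e, abs_div, abs_of_pos h0, div_le_iff₀ h0]
    refine (hb p).trans (le_of_eq ?_)
    simp only [C₃]; field_simp
  have hsm : C₃ * ε ≤ 1 / 4 := by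
    have h2 : ε ≤ 1 / (4 * (C₃ + 1)) := hε.trans (min_le_right _ _)
    rw [le_div_iff₀ (by positivity)] at h2
    nlinarith
  have hmem : ∀ p, lamT η θ ψ p / lam0 θ ∈ Icc (1 / 2 : ℝ) (3 / 2) := fun p => by
    have := abs_le.mp ((hq p).trans hsm)
    exact ⟨by linarith, by linarith⟩
  have hs1 : ∀ p, |scal η θ β ψ p - 1| ≤ 2 * (C₃ * ε) := fun p => by
    have := rpow_sub_le (hmem p).1 (t := 1) (by norm_num) ha0 ha1
    rw [Real.one_rpow] at this
    exact this.trans (mul_le_mul_of_nonneg_left (hq p) zero_le_two)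
  have hs2 : ∀ p, |scal η θ β ψ p - 1| ≤ 1 / 2 := fun p => (hs1 p).trans (by linarith)
  have hsl : LipOn (2 * C₃ * L) (scal η θ β ψ) univ := fun p hp p' hp' => by
    have h2 := rpow_sub_le (hmem p).1 (hmem p').1 ha0 ha1
    have h3 := hl p hp p' hp'
    have e : |lamT η θ ψ p / lam0 θ - lamT η θ ψ p' / lam0 θ| ≤ C₃ * L * ‖p - p'‖ := by
      rw [← sub_div, abs_div, abs_of_pos h0, div_le_iff₀ h0]
      refine h3.trans (le_of_eq ?_)
      simp only [C₃]; field_simp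
    refine h2.trans ?_
    linarith
  have hB : ∀ p, mollB η ψ p ∈ closedBall (0 : Eu d →L[ℝ] Eu m) 1 := fun p => by
    rw [mem_closedBall_zero_iff]; exact (norm_mollB_le hη h p).trans hε1
  have hsn : ∀ p, ‖scal η θ β ψ p‖ ≤ 2 := fun p => by
    have := abs_le.mp (hs2 p)
    rw [Real.norm_eq_abs, abs_le]
    constructor <;> linarith
  have hfr1 : ∀ B : Eu d →L[ℝ] Eu m, ‖frame B‖ ≤ 1 := fun B =>
    ContinuousLinearMap.opNorm_le_bound _ zero_le_one fun s => by rw [norm_frame_apply, one_mul]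
  refine ⟨hmem, fun p => (hs1 p).trans ?_, hs2, hsl.mono ?_ subset_rfl, fun p => ?_, ?_⟩
  · rw [← mul_assoc]
    exact mul_le_mul_of_nonneg_right (le_max_of_le_left (by linarith)) hε0
  · exact mul_le_mul_of_nonneg_right (le_max_of_le_left (by linarith)) hL
  · have e : stretch η θ β ψ p - inrL d m = (scal η θ β ψ p - 1) • frame (mollB η ψ p) +
        (frame (mollB η ψ p) - frame 0) := by
      rw [stretch, frame_zero]; module
    rw [e]
    refine (norm_add_le _ _).trans ?_
    rw [norm_smul]
    have h3 := hl₂ _ (hB p) 0 (by simp)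
    rw [sub_zero] at h3
    have h4 := mul_le_mul_of_nonneg_left (norm_mollB_le hη h p) hC₂
    have h5 := mul_le_mul (hs1 p) (hfr1 (mollB η ψ p)) (norm_nonneg _) (by positivity)
    have h6 : (2 * C₃ * 1 + C₂) * ε ≤ max (2 * C₃ * 1 + C₂) (2 * C₃ + 2 * (C₂ * 2)) * ε :=
      mul_le_mul_of_nonneg_right (le_max_left _ _) hε0
    rw [Real.norm_eq_abs]
    linarith
  · have h3 := hsl.smul (hl₂.comp (lipOn_mollB hη h) (fun p _ => hB p) hC₂)
      (fun p _ => hsn p) (fun p _ => hfr1 _)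
    refine LipOn.mono h3 ?_ subset_rfl
    have h6 : (2 * C₃ + 2 * (C₂ * 2)) * L ≤ max (2 * C₃ * 1 + C₂) (2 * C₃ + 2 * (C₂ * 2)) * L :=
      mul_le_mul_of_nonneg_right (le_max_right _ _) hL
    linarith

/-- Second order regularity of the stretching matrix. -/
lemma exists_conicReg_stretch (hη : IsMollifier η) (hθ : IsCutoff θ) (L β : ℝ) (hL : 0 ≤ L) :
    ∃ C, ∀ (ψ : Eu d → Eu m), FlatMap ψ 1 L →
      (∀ p, lamT η θ ψ p / lam0 θ ∈ Icc (1 / 2 : ℝ) (3 / 2)) →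
      ConicReg (stretch η θ β ψ) C := by
  obtain ⟨Cw, hCw, hw⟩ := exists_areaW_bounds d m
  have h0 := lam0_pos hθ
  obtain ⟨C₁, h₁⟩ := exists_conicReg_kerInt (V := ℝ) hη (contDiff_thetaKer hθ (n := 2))
    (thetaKer_off hθ) L (1 + Cw) (Cw * L) (by positivity)
  obtain ⟨C₂, h₂⟩ := exists_conicReg_kerInt (V := Eu d →L[ℝ] Eu m) (k := fun v : Eu d × Eu m => η v.1)
    hη ((contDiff_infty.mp hη.smooth 2).comp contDiff_fst)
    (fun z q hz => hη.supp z hz.le) L 1 L hL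
  have hG : ContDiffOn ℝ 2 (fun v : ℝ × (Eu d →L[ℝ] Eu m) =>
      (v.1 / lam0 θ) ^ (1 / β) • frame v.2) (Ioi 0 ×ˢ univ) := by
    have hf : ContDiff ℝ 2 fun v : ℝ × (Eu d →L[ℝ] Eu m) => frame v.2 :=
      (contDiff_frame (n := 2)).comp contDiff_snd
    have hr : ContDiffOn ℝ 2 (fun v : ℝ × (Eu d →L[ℝ] Eu m) => (v.1 / lam0 θ) ^ (1 / β))
        (Ioi 0 ×ˢ univ) :=
      ContDiffOn.rpow_const_of_ne (contDiff_fst.div_const _).contDiffOn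
        fun v hv => (div_pos hv.1 h0).ne'
    exact hr.smul hf.contDiffOn
  -- The bounds on the density and on `mollB` confine the data to a fixed compact set on which the
  -- power is smooth, so the constant does not depend on ψ.
  obtain ⟨C, h⟩ := exists_conicReg_comp (isOpen_Ioi.prod isOpen_univ) hG
    ((isCompact_Icc (a := lam0 θ / 2) (b := 3 / 2 * lam0 θ)).prod
      (isCompact_closedBall (0 : Eu d →L[ℝ] Eu m) 1))
    (prod_mono (fun x hx => lt_of_lt_of_le (half_pos h0) hx.1) (subset_univ _)) (max C₁ C₂)
  refine ⟨C, fun ψ hψ hmem => ?_⟩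
  obtain ⟨hw1, hwl⟩ := hw ψ 1 L hψ le_rfl
  have hf : ConicReg (lamT η θ ψ) C₁ := h₁ ψ (areaW ψ) hψ
    (continuousOn_univ.mp hwl.continuousOn) (fun y => by
      rw [Real.norm_of_nonneg (areaW_nonneg _ _)]
      have h2 := (abs_le.mp (hw1 y)).2
      linarith) hwl
  have hg : ConicReg (mollB η ψ) C₂ := by
    rw [mollB_eq_kerInt hη ψ]
    exact h₂ ψ (fderiv ℝ ψ) hψ hψ.continuous_fderiv hψ.small fun x _ y _ => hψ.lip x y
  refine h _ (hf.prodMk hg) fun p _ => ⟨?_, ?_⟩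
  · have := hmem p
    rw [mem_Icc, le_div_iff₀ h0, div_le_iff₀ h0] at this
    exact ⟨by linarith [this.1], this.2⟩
  · rw [mem_closedBall_zero_iff]
    exact norm_mollB_le hη hψ p

end FirstOrder

end HigherCodim

namespace HigherCodim

/-! ### The differential of the model map and its Lipschitz bounds -/

section ModelMap

variable {d m : ℕ} {W Z : Type*} [NormedAddCommGroup W] [NormedSpace ℝ W]
  [NormedAddCommGroup Z] [NormedSpace ℝ Z]

lemma LipOn.const_smul {E : Type*} [NormedAddCommGroup E] {C κ K : ℝ} {f : E → W} {s : Set E}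
    (hf : LipOn C f s) (hκ : |κ| ≤ K) : LipOn (K * C) (fun x => κ • f x) s := fun x hx y hy => by
  rw [← smul_sub, norm_smul]
  have := mul_le_mul hκ (hf x hx y hy) (norm_nonneg _) ((abs_nonneg _).trans hκ)
  rw [Real.norm_eq_abs]
  linarith

/-- A Lipschitz function that vanishes on `{t = 0}` stays Lipschitz when multiplied by `t / |t|`. -/
lemma LipOn.mul_dirT {C M : ℝ} {f : Amb d m → W} {s : Set (Amb d m)} (b : W → Eu m → Z)
    (hM : 0 ≤ M) (hb₁ : ∀ x y ν, b (x - y) ν = b x ν - b y ν)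
    (hb₂ : ∀ x ν ν', b x (ν - ν') = b x ν - b x ν') (hb : ∀ x ν, ‖b x ν‖ ≤ M * ‖x‖ * ‖ν‖)
    (hf : LipOn C f s) (h0 : ∀ X ∈ s, ‖f X‖ ≤ C * ‖X.snd‖) :
    LipOn (M * (3 * C)) (fun X => b (f X) (dirT X)) s := fun X hX Y hY => by
  have e : b (f X) (dirT X) - b (f Y) (dirT Y) =
      b (f X - f Y) (dirT X) + b (f Y) (dirT X - dirT Y) := by rw [hb₁, hb₂]; abel
  rw [e]
  refine (norm_add_le _ _).trans ?_
  have h1 := hb (f X - f Y) (dirT X)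
  have h2 := hb (f Y) (dirT X - dirT Y)
  have hC0 : 0 ≤ C * ‖X - Y‖ := (norm_nonneg _).trans (hf X hX Y hY)
  have h3 : M * ‖f X - f Y‖ * ‖dirT X‖ ≤ M * (C * ‖X - Y‖) * 1 := by
    gcongr
    · exact hf X hX Y hY
    · exact norm_dirT_le X
  -- The variation of the direction costs 2|X - Y|/|t| at Y, and the vanishing of `f` on {t = 0}
  -- pays for it.
  have h5 : ‖f Y‖ * ‖dirT X - dirT Y‖ ≤ 2 * (C * ‖X - Y‖) := by
    by_cases hY0 : Y.snd = 0
    · have : ‖f Y‖ ≤ 0 := by simpa [hY0] using h0 Y hY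
      have h' : ‖f Y‖ = 0 := le_antisymm this (norm_nonneg _)
      rw [h', zero_mul]; positivity
    · have hC : 0 ≤ C := by
        by_contra hC
        have h6 := (norm_nonneg _).trans (h0 Y hY)
        have h7 := norm_pos_iff.mpr hY0
        nlinarith
      calc ‖f Y‖ * ‖dirT X - dirT Y‖ ≤ C * ‖Y.snd‖ * ‖dirT X - dirT Y‖ :=
            mul_le_mul_of_nonneg_right (h0 Y hY) (norm_nonneg _)
        _ = C * (‖Y.snd‖ * ‖dirT X - dirT Y‖) := by ring
        _ ≤ C * (2 * ‖X - Y‖) := mul_le_mul_of_nonneg_left (norm_snd_mul_dirT_sub X Y) hC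
        _ = _ := by ring
  have h6 := mul_le_mul_of_nonneg_left h5 hM
  nlinarith

lemma LipOn.norm_smul_fderiv_le {f : W → Z} {C r R : ℝ} (hf : LipOn C f univ) (hC : 0 ≤ C)
    (hr : |r| ≤ R) (x : W) : ‖r • fderiv ℝ f x‖ ≤ C * R := by
  rw [norm_smul, mul_comm]
  exact mul_le_mul (hf.norm_fderiv_le hC Filter.univ_mem) hr (norm_nonneg _) hC

lemma hasFDerivAt_norm_of_ne {t : Eu m} (ht : t ≠ 0) :
    HasFDerivAt (fun t : Eu m => ‖t‖) (innerSL ℝ (‖t‖⁻¹ • t)) t := by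
  have h0 := norm_pos_iff.mpr ht
  have h := (hasStrictFDerivAt_norm_sq t).hasFDerivAt.sqrt (pow_pos h0 2).ne'
  simp_rw [Real.sqrt_sq (norm_nonneg _)] at h
  refine h.congr_fderiv (ContinuousLinearMap.ext fun s => ?_)
  simp only [smul_apply, innerSL_apply_apply, inner_smul_left, smul_eq_mul, conj_trivial,
    two_smul, add_apply]
  field_simp
  ring

/-- The derivative of `cyl` off `{t = 0}`. -/
noncomputable def cylD (X : Amb d m) : Amb d m →L[ℝ] Eu d × ℝ :=
  (fstA d m).prod (innerSL ℝ (dirT X) ∘L sndA d m)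

lemma cylD_apply (X v : Amb d m) : cylD X v = (v.fst, inner ℝ (dirT X) v.snd) := rfl

lemma cylD_apply' (X v : Amb d m) :
    cylD X v = (v.fst, 0) + inner ℝ (dirT X) v.snd • ((0, 1) : Eu d × ℝ) := by
  simp [cylD_apply]

lemma norm_inner_dirT_le (X v : Amb d m) : ‖inner ℝ (dirT X) v.snd‖ ≤ ‖v‖ := by
  refine (norm_inner_le_norm _ _).trans ?_
  have := mul_le_mul (norm_dirT_le X) (norm_snd_le v) (norm_nonneg _) zero_le_one
  linarith

lemma norm_cylD_apply_le (X v : Amb d m) : ‖cylD X v‖ ≤ ‖v‖ := by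
  rw [cylD_apply, Prod.norm_mk]
  exact max_le (norm_fst_le v) (norm_inner_dirT_le X v)

lemma norm_cylD_le (X : Amb d m) : ‖cylD X‖ ≤ 1 :=
  ContinuousLinearMap.opNorm_le_bound _ zero_le_one fun v => by
    rw [one_mul]; exact norm_cylD_apply_le X v

lemma hasFDerivAt_cyl {X : Amb d m} (hX : X.snd ≠ 0) : HasFDerivAt cyl (cylD X) X :=
  (fstA d m).hasFDerivAt.prodMk
    ((hasFDerivAt_norm_of_ne hX).comp X (sndA d m).hasFDerivAt)

variable {θ : Amb d m → ℝ} {η : Eu d → ℝ} {ψ : Eu d → Eu m} {ε L β κ C K R : ℝ}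

/-- The term in the derivative of `modelRho` that involves the derivative of the stretching. -/
noncomputable def stretchD (F : Eu d × ℝ → Eu m →L[ℝ] Z) (X : Amb d m) : Amb d m →L[ℝ] Z :=
  (((cyl X).2 • fderiv ℝ F (cyl X)).flip (dirT X)) ∘L cylD X

/-- The derivative of `modelRho`, defined also at `t = 0`. -/
noncomputable def modelDeriv (η : Eu d → ℝ) (θ : Amb d m → ℝ) (β κ : ℝ) (ψ : Eu d → Eu m)
    (X : Amb d m) : Amb d m →L[ℝ] Amb d m :=
  inlL d m ∘L fstA d m + inrL d m ∘L (mollDeriv η ψ (cyl X) ∘L cylD X) +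
    κ • (stretch η θ β ψ (cyl X) ∘L sndA d m) + κ • stretchD (stretch η θ β ψ) X

lemma modelRho_eq (X : Amb d m) : modelRho η θ β κ ψ X =
    inlL d m X.fst + inrL d m (phiS η ψ ‖X.snd‖ X.fst) + κ • stretch η θ β ψ (cyl X) X.snd := by
  rw [modelRho, inlL_apply, inrL_apply, pt_add, add_zero, zero_add]

lemma hasFDerivAt_modelRho (hη : IsMollifier η) (h : FlatMap ψ ε L)
    (hF : ConicReg (stretch η θ β ψ) C) {X : Amb d m} (h0 : X.snd ≠ 0) (h1 : X ∈ tube d m 1) :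
    HasFDerivAt (modelRho η θ β κ ψ) (modelDeriv η θ β κ ψ X) X := by
  have hc := hasFDerivAt_cyl h0
  have e1 : HasFDerivAt (fun X : Amb d m => inlL d m X.fst) (inlL d m ∘L fstA d m) X :=
    (inlL d m ∘L fstA d m).hasFDerivAt
  have e2 := (inrL d m).hasFDerivAt.comp X ((hasFDerivAt_phiS hη h (cyl X)).comp X hc)
  have e3 := ((hF.diff _ (cyl_mem_slab h1) (norm_pos_iff.mpr h0)).hasFDerivAt.comp X hc).clm_apply
    (sndA d m).hasFDerivAt
  have e4 := (e1.add e2).add (e3.const_smul κ)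
  refine (e4.congr_of_eventuallyEq (Filter.Eventually.of_forall fun Y => modelRho_eq Y)).congr_fderiv
    (ContinuousLinearMap.ext fun v => ?_)
  -- Writing t = |t| (t/|t|) moves the factor r onto the derivative of the stretching, where conic
  -- regularity controls it.
  have e5 : (fderiv ℝ (stretch η θ β ψ) (cyl X) (cylD X v)) X.snd =
      stretchD (stretch η θ β ψ) X v := by
    conv_lhs => rw [← smul_dirT X]
    simp [stretchD, cyl]
  simp only [modelDeriv, _root_.add_apply, _root_.smul_apply, ← e5]
  simp
  module

/-- The derivative of |t| brings in a second factor t/|t|. The horizontal part contains the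
direction once and the radial part twice, so `LipOn.mul_dirT` is used once and twice respectively:
3C + 9C = 12C. -/
lemma lipOn_flip_dirT {D : Amb d m → (Eu d × ℝ) →L[ℝ] Eu m →L[ℝ] Z} {s : Set (Amb d m)}
    (hC : 0 ≤ C) (hD : LipOn C D s) (hD0 : ∀ X ∈ s, ‖D X‖ ≤ C * ‖X.snd‖) :
    LipOn (12 * C) (fun X => (D X).flip (dirT X) ∘L cylD X) s := by
  have h1 : LipOn (1 * (3 * C)) (fun X => (D X).flip (dirT X) ∘L
      (ContinuousLinearMap.inl ℝ (Eu d) ℝ ∘L fstA d m)) s := by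
    refine LipOn.mul_dirT (f := D) (fun D ν => D.flip ν ∘L (ContinuousLinearMap.inl ℝ (Eu d) ℝ ∘L fstA d m))
      zero_le_one (fun x y ν => ?_) (fun x ν ν' => ?_) (fun D ν => ?_) hD hD0
    · ext1 v; simp
    · ext1 v; simp
    · refine ContinuousLinearMap.opNorm_le_bound _ (by positivity) fun v => ?_
      refine (D.le_opNorm₂ (v.fst, 0) ν).trans ?_
      have : ‖((v.fst, 0) : Eu d × ℝ)‖ ≤ ‖v‖ := by
        rw [Prod.norm_mk, norm_zero]; exact max_le (norm_fst_le v) (norm_nonneg v)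
      have := mul_le_mul_of_nonneg_left this (mul_nonneg (norm_nonneg D) (norm_nonneg ν))
      linarith
  have hr : ∀ (D : (Eu d × ℝ) →L[ℝ] Eu m →L[ℝ] Z) (ν : Eu m),
      ‖D (0, 1) ν‖ ≤ 1 * ‖D‖ * ‖ν‖ := fun D ν => by
    refine (D.le_opNorm₂ (0, 1) ν).trans (le_of_eq ?_)
    simp [Prod.norm_mk]
  have h2 : LipOn (1 * (3 * C)) (fun X => D X (0, 1) (dirT X)) s :=
    hD.mul_dirT (fun D ν => D (0, 1) ν) zero_le_one (fun x y ν => by simp) (fun x ν ν' => by simp)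
      hr hD0
  have h20 : ∀ X ∈ s, ‖D X (0, 1) (dirT X)‖ ≤ 1 * (3 * C) * ‖X.snd‖ := fun X hX => by
    refine (hr _ _).trans ?_
    have := mul_le_mul (hD0 X hX) (norm_dirT_le X) (norm_nonneg _) (by positivity)
    have h5 : 0 ≤ C * ‖X.snd‖ := by positivity
    linarith
  have h3 := h2.mul_dirT (fun (w : Z) (ν : Eu m) => (innerSL ℝ ν ∘L sndA d m).smulRight w)
    zero_le_one (fun x y ν => ContinuousLinearMap.ext fun v => by simp [smul_sub])
    (fun x ν ν' => ContinuousLinearMap.ext fun v => by simp [sub_smul])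
    (fun w ν => by
      refine ContinuousLinearMap.opNorm_le_bound _ (by positivity) fun v => ?_
      rw [ContinuousLinearMap.smulRight_apply, norm_smul]
      have h6 := (norm_inner_le_norm (𝕜 := ℝ) ν v.snd).trans
        (mul_le_mul_of_nonneg_left (norm_snd_le v) (norm_nonneg ν))
      have h7 := mul_le_mul_of_nonneg_right h6 (norm_nonneg w)
      refine h7.trans (le_of_eq (by ring))) h20
  refine ((h1.add h3).mono (by linarith) subset_rfl).congr fun X _ => ContinuousLinearMap.ext fun v => ?_
  change (D X (cylD X v)) (dirT X) = (D X (v.fst, 0)) (dirT X) +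
    inner ℝ (dirT X) v.snd • (D X (0, 1)) (dirT X)
  rw [cylD_apply', map_add, map_smul]
  rfl

lemma lipOn_stretchD {F : Eu d × ℝ → Eu m →L[ℝ] Z} (hF : ConicReg F C) :
    LipOn (12 * C) (stretchD F) (tube d m 1) := by
  have hC := hF.nonneg
  have hD : LipOn C (fun X : Amb d m => (cyl X).2 • fderiv ℝ F (cyl X)) (tube d m 1) := by
    have := hF.lip_smul_fderiv.comp (lipOn_cyl (tube d m 1)) (fun X hX => cyl_mem_slab hX) hC
    rwa [mul_one] at this
  exact lipOn_flip_dirT hC hD fun X hX => hF.norm_smul_fderiv_le (cyl_mem_slab hX)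

/-- Only ∂_rψ_r meets the direction t/|t|, and it vanishes at r = 0 by `mollDeriv_zero`. The
constant is 4L + 3·4L. -/
lemma lipOn_mollDeriv_cylD (hη : IsMollifier η) (h : FlatMap ψ ε L) (s : Set (Amb d m)) :
    LipOn (16 * L) (fun X => mollDeriv η ψ (cyl X) ∘L cylD X) s := by
  have hL := h.lip_nonneg
  have hP : LipOn (4 * L) (fun X : Amb d m => mollDeriv η ψ (cyl X)) s := by
    have := (lipOn_mollDeriv hη h).comp (lipOn_cyl s) (fun _ _ => mem_univ _) (by positivity)
    rwa [mul_one] at this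
  have h1 : LipOn (4 * L) (fun X => mollDeriv η ψ (cyl X) ∘L
      (ContinuousLinearMap.inl ℝ (Eu d) ℝ ∘L fstA d m)) s := fun X hX Y hY => by
    rw [← ContinuousLinearMap.sub_comp]
    refine (ContinuousLinearMap.opNorm_le_bound _ (norm_nonneg _) fun v => ?_).trans (hP X hX Y hY)
    refine (ContinuousLinearMap.le_opNorm (mollDeriv η ψ (cyl X) - mollDeriv η ψ (cyl Y))
      (v.fst, 0)).trans (mul_le_mul_of_nonneg_left ?_ (norm_nonneg _))
    change ‖((v.fst, 0) : Eu d × ℝ)‖ ≤ ‖v‖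
    rw [Prod.norm_mk, norm_zero]
    exact max_le (norm_fst_le v) (norm_nonneg v)
  have hone : ‖((0, 1) : Eu d × ℝ)‖ = 1 := by simp [Prod.norm_mk]
  have h2 : LipOn (4 * L) (fun X : Amb d m => mollDeriv η ψ (cyl X) (0, 1)) s := fun X hX Y hY => by
    rw [← _root_.sub_apply]
    refine (ContinuousLinearMap.le_opNorm _ _).trans ?_
    rw [hone, mul_one]
    exact hP X hX Y hY
  have h20 : ∀ X ∈ s, ‖mollDeriv η ψ (cyl X) (0, 1)‖ ≤ 4 * L * ‖X.snd‖ := fun X hX => by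
    have e0 : mollDeriv η ψ (X.fst, 0) (0, 1) = 0 := by simp [mollDeriv_zero hη h]
    have h3 := lipOn_mollDeriv hη h (cyl X) (mem_univ _) (X.fst, 0) (mem_univ _)
    have h4 : ‖cyl X - (X.fst, 0)‖ = ‖X.snd‖ := by simp [cyl, Prod.norm_def]
    rw [h4] at h3
    have h5 := ContinuousLinearMap.le_of_opNorm_le _ h3 (0, 1)
    rwa [_root_.sub_apply, e0, sub_zero, hone, mul_one] at h5
  have h3 := h2.mul_dirT (fun (w : Eu m) (ν : Eu m) => (innerSL ℝ ν ∘L sndA d m).smulRight w)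
    zero_le_one (fun x y ν => ContinuousLinearMap.ext fun v => by simp [smul_sub])
    (fun x ν ν' => ContinuousLinearMap.ext fun v => by simp [sub_smul])
    (fun w ν => by
      refine ContinuousLinearMap.opNorm_le_bound _ (by positivity) fun v => ?_
      rw [ContinuousLinearMap.smulRight_apply, norm_smul]
      have h6 := (norm_inner_le_norm (𝕜 := ℝ) ν v.snd).trans
        (mul_le_mul_of_nonneg_left (norm_snd_le v) (norm_nonneg ν))
      have h7 := mul_le_mul_of_nonneg_right h6 (norm_nonneg w)
      refine h7.trans (le_of_eq (by ring))) h20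
  refine ((h1.add h3).mono (by linarith) subset_rfl).congr fun X _ => ContinuousLinearMap.ext fun v => ?_
  change mollDeriv η ψ (cyl X) (cylD X v) = mollDeriv η ψ (cyl X) (v.fst, 0) +
    inner ℝ (dirT X) v.snd • mollDeriv η ψ (cyl X) (0, 1)
  rw [cylD_apply', map_add, map_smul]

lemma lipOn_modelDeriv (hη : IsMollifier η) (h : FlatMap ψ ε L)
    (hF : ConicReg (stretch η θ β ψ) C) (hκ : |κ| ≤ K) :
    LipOn (16 * L + K * (13 * C)) (modelDeriv η θ β κ ψ) (tube d m 1) := by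
  have hL := h.lip_nonneg
  have hC := hF.nonneg
  have h1 : LipOn (16 * L) (fun X => inrL d m ∘L (mollDeriv η ψ (cyl X) ∘L cylD X)) (tube d m 1) :=
    fun X hX Y hY => by
      rw [← ContinuousLinearMap.comp_sub]
      refine (ContinuousLinearMap.opNorm_comp_le _ _).trans ?_
      have := mul_le_mul (norm_inrL_le (d := d) (m := m)) (lipOn_mollDeriv_cylD hη h _ X hX Y hY) (norm_nonneg _)
        zero_le_one
      rwa [one_mul] at this
  have h2 : LipOn C (fun X : Amb d m => stretch η θ β ψ (cyl X) ∘L sndA d m) (tube d m 1) :=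
    fun X hX Y hY => by
      rw [← ContinuousLinearMap.sub_comp]
      refine (ContinuousLinearMap.opNorm_comp_le _ _).trans ?_
      have h3 := hF.lip.comp (lipOn_cyl (tube d m 1)) (fun X hX => cyl_mem_slab hX) hC X hX Y hY
      simp only [mul_one] at h3
      have := mul_le_mul h3 (norm_sndA_le (d := d) (m := m)) (norm_nonneg _) (by positivity)
      linarith
  have := (((LipOn.const (inlL d m ∘L fstA d m) (tube d m 1)).add h1).add
    (h2.const_smul hκ)).add ((lipOn_stretchD hF).const_smul hκ)
  exact LipOn.mono this (by linarith) subset_rfl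

/-- The derivative of `(x, t) ↦ (x, κ t)`. -/
noncomputable def flatD (d m : ℕ) (κ : ℝ) : Amb d m →L[ℝ] Amb d m :=
  inlL d m ∘L fstA d m + κ • (inrL d m ∘L sndA d m)

lemma flatD_apply (V : Amb d m) : flatD d m κ V = pt V.fst (κ • V.snd) := by
  simp [flatD, pt_add, smul_pt]

lemma norm_flatD_le (hK : 1 ≤ K) (hκ0 : 0 ≤ κ) (hκ : κ ≤ K) (V : Amb d m) :
    ‖flatD d m κ V‖ ≤ K * ‖V‖ := by
  refine le_of_sq_le_sq ?_ (by positivity)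
  rw [flatD_apply, norm_sq_amb, mul_pow, norm_sq_amb, pt_fst, pt_snd, norm_smul,
    Real.norm_of_nonneg hκ0, mul_pow]
  have h1 : κ ^ 2 ≤ K ^ 2 := pow_le_pow_left₀ hκ0 hκ 2
  have h2 : 1 ≤ K ^ 2 := one_le_pow₀ hK
  have h3 := mul_le_mul_of_nonneg_right h1 (sq_nonneg ‖V.snd‖)
  have h4 := mul_le_mul_of_nonneg_right h2 (sq_nonneg ‖V.fst‖)
  linarith

lemma le_norm_flatD (hK : 1 ≤ K) (hκ : K⁻¹ ≤ κ) (V : Amb d m) :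
    ‖V‖ ≤ K * ‖flatD d m κ V‖ := by
  have hK0 : 0 < K := by linarith
  have hκ0 : 0 ≤ κ := (inv_pos.mpr hK0).le.trans hκ
  refine le_of_sq_le_sq ?_ (by positivity)
  rw [flatD_apply, mul_pow, norm_sq_amb, norm_sq_amb, pt_fst, pt_snd, norm_smul,
    Real.norm_of_nonneg hκ0, mul_add, ← mul_pow, ← mul_pow, ← mul_assoc]
  have h1 : 1 ≤ K * κ := by
    have := mul_le_mul_of_nonneg_left hκ hK0.le
    rwa [mul_inv_cancel₀ hK0.ne'] at this
  have h3 := pow_le_pow_left₀ (norm_nonneg V.snd)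
    (le_mul_of_one_le_left (norm_nonneg V.snd) h1) 2
  have h4 := pow_le_pow_left₀ (norm_nonneg V.fst)
    (le_mul_of_one_le_left (norm_nonneg V.fst) hK) 2
  linarith

/-- The gradient of the stretching is of size CL, not small. It occurs multiplied by r ≤ R, and LR ≤
ε makes the product small. -/
lemma norm_modelDeriv_sub_le (hη : IsMollifier η) (h : FlatMap ψ ε L) (hC : 0 ≤ C)
    (hb : ∀ p, ‖stretch η θ β ψ p - inrL d m‖ ≤ C * ε)
    (hl : LipOn (C * L) (stretch η θ β ψ) univ) (hκ : |κ| ≤ K) (hR : L * R ≤ ε) {X : Amb d m}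
    (hX : X ∈ tube d m R) : ‖modelDeriv η θ β κ ψ X - flatD d m κ‖ ≤ (2 + 2 * K * C) * ε := by
  have hL := h.lip_nonneg
  have hK : 0 ≤ K := (abs_nonneg _).trans hκ
  have hXR : ‖X.snd‖ < R := hX
  have e : modelDeriv η θ β κ ψ X - flatD d m κ = inrL d m ∘L (mollDeriv η ψ (cyl X) ∘L cylD X) +
      κ • ((stretch η θ β ψ (cyl X) - inrL d m) ∘L sndA d m) +
      κ • stretchD (stretch η θ β ψ) X := by
    refine ContinuousLinearMap.ext fun v => ?_
    simp only [modelDeriv, flatD, _root_.add_apply, _root_.sub_apply, _root_.smul_apply,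
      ContinuousLinearMap.comp_apply]
    module
  have h1 : ‖inrL d m ∘L (mollDeriv η ψ (cyl X) ∘L cylD X)‖ ≤ 2 * ε := by
    refine (ContinuousLinearMap.opNorm_comp_le _ _).trans ?_
    have h2 := (ContinuousLinearMap.opNorm_comp_le (mollDeriv η ψ (cyl X)) (cylD X)).trans
      (mul_le_mul (norm_mollDeriv_le hη h _) (norm_cylD_le X) (norm_nonneg _)
        (by have := h.eps_nonneg; positivity))
    have := mul_le_mul (norm_inrL_le (d := d) (m := m)) h2 (norm_nonneg _) zero_le_one
    linarith
  have h2 : ‖(stretch η θ β ψ (cyl X) - inrL d m) ∘L sndA d m‖ ≤ C * ε := by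
    refine (ContinuousLinearMap.opNorm_comp_le _ _).trans ?_
    have := mul_le_mul (hb (cyl X)) (norm_sndA_le (d := d) (m := m)) (norm_nonneg _)
      (mul_nonneg hC h.eps_nonneg)
    linarith
  have h3 : ‖stretchD (stretch η θ β ψ) X‖ ≤ C * ε := by
    have h4 : ‖(cyl X).2 • fderiv ℝ (stretch η θ β ψ) (cyl X)‖ ≤ C * ε := by
      have h6 : |(cyl X).2| ≤ R := by simpa [cyl] using hXR.le
      have h5 := hl.norm_smul_fderiv_le (by positivity) h6 (cyl X)
      have := mul_le_mul_of_nonneg_left hR hC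
      linarith
    refine ContinuousLinearMap.opNorm_le_bound _ (mul_nonneg hC h.eps_nonneg) fun v => ?_
    refine (ContinuousLinearMap.le_opNorm₂ ((cyl X).2 • fderiv ℝ (stretch η θ β ψ) (cyl X))
      (cylD X v) (dirT X)).trans ?_
    calc _ ≤ C * ε * ‖v‖ * 1 := mul_le_mul (mul_le_mul h4 (norm_cylD_apply_le X v) (norm_nonneg _)
          (mul_nonneg hC h.eps_nonneg)) (norm_dirT_le X) (norm_nonneg _)
          (mul_nonneg (mul_nonneg hC h.eps_nonneg) (norm_nonneg _))
      _ = _ := mul_one _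
  rw [e]
  refine (norm_add₃_le ..).trans ?_
  rw [norm_smul, norm_smul, Real.norm_eq_abs]
  have h5 := mul_le_mul hκ h2 (norm_nonneg _) hK
  have h6 := mul_le_mul hκ h3 (norm_nonneg _) hK
  linarith

/-- Increments of the stretching term are estimated directly, so that pairs of points on opposite
sides of {t = 0} need no separate treatment and no derivative is taken there. As for the
differential, LR ≤ ε absorbs the variation of the stretching. -/
lemma lipOn_modelRho_sub (hη : IsMollifier η) (h : FlatMap ψ ε L) (hC : 0 ≤ C)
    (hb : ∀ p, ‖stretch η θ β ψ p - inrL d m‖ ≤ C * ε)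
    (hl : LipOn (C * L) (stretch η θ β ψ) univ) (hκ : |κ| ≤ K) (hR : L * R ≤ ε) :
    LipOn ((2 + 2 * K * C) * ε) (fun X => modelRho η θ β κ ψ X - flatD d m κ X) (tube d m R) := by
  intro X hX Y hY
  have hL := h.lip_nonneg
  have hε := h.eps_nonneg
  have hK : 0 ≤ K := (abs_nonneg _).trans hκ
  have hXR : ‖X.snd‖ < R := hX
  have hcyl := lipOn_cyl (tube d m R) X hX Y hY
  rw [one_mul] at hcyl
  have h1 : ‖phiS η ψ ‖X.snd‖ X.fst - phiS η ψ ‖Y.snd‖ Y.fst‖ ≤ 2 * ε * ‖X - Y‖ := by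
    have h2 : LipOn (2 * ε) (fun p : Eu d × ℝ => phiS η ψ p.2 p.1) univ :=
      LipOn.of_hasFDerivAt convex_univ (fun p _ => hasFDerivAt_phiS hη h p)
        fun p _ => norm_mollDeriv_le hη h p
    exact (h2 (cyl X) (mem_univ _) (cyl Y) (mem_univ _)).trans
      (mul_le_mul_of_nonneg_left hcyl (by positivity))
  have e : modelRho η θ β κ ψ X - flatD d m κ X - (modelRho η θ β κ ψ Y - flatD d m κ Y) =
      inrL d m (phiS η ψ ‖X.snd‖ X.fst - phiS η ψ ‖Y.snd‖ Y.fst) +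
      κ • ((stretch η θ β ψ (cyl X) - stretch η θ β ψ (cyl Y)) X.snd) +
      κ • ((stretch η θ β ψ (cyl Y) - inrL d m) (X.snd - Y.snd)) := by
    rw [modelRho_eq, modelRho_eq]
    simp only [flatD, _root_.add_apply, _root_.sub_apply, _root_.smul_apply,
      ContinuousLinearMap.comp_apply, map_sub, fstA_apply, sndA_apply]
    module
  rw [e]
  refine (norm_add₃_le ..).trans ?_
  rw [norm_smul, norm_smul, Real.norm_eq_abs]
  have h2 := ((inrL d m).le_opNorm (phiS η ψ ‖X.snd‖ X.fst - phiS η ψ ‖Y.snd‖ Y.fst)).trans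
    (mul_le_mul (norm_inrL_le (d := d) (m := m)) h1 (norm_nonneg _) zero_le_one)
  have h3 : ‖(stretch η θ β ψ (cyl X) - stretch η θ β ψ (cyl Y)) X.snd‖ ≤ C * ε * ‖X - Y‖ := by
    have h4 := (hl (cyl X) (mem_univ _) (cyl Y) (mem_univ _)).trans
      (mul_le_mul_of_nonneg_left hcyl (by positivity))
    refine (ContinuousLinearMap.le_of_opNorm_le _ h4 _).trans ?_
    have h5 := mul_le_mul_of_nonneg_left hXR.le (show 0 ≤ C * L * ‖X - Y‖ by positivity)
    have h6 := mul_le_mul_of_nonneg_left hR (show 0 ≤ C * ‖X - Y‖ by positivity)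
    linarith
  have h4 : ‖(stretch η θ β ψ (cyl Y) - inrL d m) (X.snd - Y.snd)‖ ≤ C * ε * ‖X - Y‖ :=
    (ContinuousLinearMap.le_of_opNorm_le _ (hb _) _).trans
      (mul_le_mul_of_nonneg_left (norm_snd_le (X - Y)) (by positivity))
  have h5 := mul_le_mul hκ h3 (norm_nonneg _) hK
  have h6 := mul_le_mul hκ h4 (norm_nonneg _) hK
  linarith

/-- `modelRho` is bi-Lipschitz as soon as it is close to the map `(x, t) ↦ (x, κ t)`. -/
lemma bilipschitz_modelRho {δ : ℝ} (hK : 1 ≤ K) (hκ : K⁻¹ ≤ κ) (hκ' : κ ≤ K)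
    {f : Amb d m → Amb d m} {s : Set (Amb d m)}
    (hf : LipOn δ (fun X => f X - flatD d m κ X) s) (hδ : δ ≤ (2 * K)⁻¹) {X Y : Amb d m}
    (hX : X ∈ s) (hY : Y ∈ s) :
    ‖f X - f Y‖ ≤ 2 * K * ‖X - Y‖ ∧ ‖X - Y‖ ≤ 2 * K * ‖f X - f Y‖ := by
  have hK0 : 0 < K := by linarith
  have hκ0 : 0 ≤ κ := (inv_pos.mpr hK0).le.trans hκ
  have h1 := (hf X hX Y hY).trans (mul_le_mul_of_nonneg_right hδ (norm_nonneg _))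
  have e : f X - flatD d m κ X - (f Y - flatD d m κ Y) = (f X - f Y) - flatD d m κ (X - Y) := by
    rw [map_sub]; abel
  simp only [e] at h1
  have h2 := norm_flatD_le hK hκ0 hκ' (X - Y)
  have h3 := le_norm_flatD hK hκ (X - Y)
  have h4 := norm_sub_norm_le (f X - f Y) (flatD d m κ (X - Y))
  have h5 := norm_sub_norm_le (flatD d m κ (X - Y)) (f X - f Y)
  rw [norm_sub_rev (flatD d m κ (X - Y))] at h5
  have h6 : (2 * K)⁻¹ * ‖X - Y‖ ≤ K * ‖X - Y‖ := by
    refine mul_le_mul_of_nonneg_right ?_ (norm_nonneg _)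
    exact (inv_le_one_of_one_le₀ (by linarith)).trans hK
  refine ⟨by linarith, ?_⟩
  -- Multiplied by K, the perturbation costs half of |X - Y|, which is absorbed on the left and
  -- doubles the constant.
  have h7 : K * ((2 * K)⁻¹ * ‖X - Y‖) = ‖X - Y‖ / 2 := by field_simp
  have h8 : K * ‖flatD d m κ (X - Y)‖ ≤ K * (‖f X - f Y‖ + (2 * K)⁻¹ * ‖X - Y‖) :=
    mul_le_mul_of_nonneg_left (by linarith) hK0.le
  linarith

/-- At r = 0 the term with r∇ of the stretching and the r-derivative of ψ_r drop out. What remains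
maps ℝ^d into the tangent space and ℝ^m, by a multiple of an isometry, into the normal space. -/
lemma modelDeriv_of_snd_eq_zero (hη : IsMollifier η) (h : FlatMap ψ ε L) {X : Amb d m}
    (hX : X.snd = 0) (v : Amb d m) : modelDeriv η θ β κ ψ X v =
      liftL (fderiv ℝ ψ X.fst) v.fst +
        (κ * scal η θ β ψ (cyl X)) • frame (fderiv ℝ ψ X.fst) v.snd := by
  have h2 : (cyl X).2 = 0 := by simp [cyl, hX]
  have h3 : stretchD (stretch η θ β ψ) X v = 0 := by simp [stretchD, h2]
  simp only [modelDeriv, _root_.add_apply, _root_.smul_apply, h3, ContinuousLinearMap.comp_apply,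
    mollDeriv_zero hη h _ h2, stretch, mollB_zero hη h _ h2, smul_zero, add_zero]
  simp [liftL, cyl, cylD_apply, mul_smul, pt_add]

end ModelMap

end HigherCodim

namespace HigherCodim

/-! ### Inverse Gram matrices and determinants -/

section Gram

open ContinuousLinearMap

variable {E : Type*} [NormedAddCommGroup E] [InnerProductSpace ℝ E] [FiniteDimensional ℝ E]
  {Λ : ℝ}

/-- A linear map bounded from below has a bounded inverse. -/
lemma exists_inverse {M : E →L[ℝ] E} (hΛ : 0 ≤ Λ) (hM : ∀ v, ‖v‖ ≤ Λ * ‖M v‖) :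
    ∃ P : E →L[ℝ] E, P ∘L M = ContinuousLinearMap.id ℝ E ∧
      M ∘L P = ContinuousLinearMap.id ℝ E ∧ ‖P‖ ≤ Λ := by
  have hinj : Function.Injective (M : E →ₗ[ℝ] E) := by
    refine (injective_iff_map_eq_zero _).mpr fun v hv => ?_
    have h1 := hM v
    rw [show M v = 0 from hv, norm_zero, mul_zero] at h1
    exact norm_le_zero_iff.mp h1
  set e := LinearEquiv.ofInjectiveEndo (M : E →ₗ[ℝ] E) hinj
  have he : ∀ v, e v = M v := fun v => rfl
  refine ⟨(e.symm : E →ₗ[ℝ] E).toContinuousLinearMap, ?_, ?_, ?_⟩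
  · ext1 v
    change e.symm (M v) = v
    rw [← he, e.symm_apply_apply]
  · ext1 v
    change M (e.symm v) = v
    rw [← he, e.apply_symm_apply]
  · refine ContinuousLinearMap.opNorm_le_bound _ hΛ fun v => ?_
    refine (hM _).trans (le_of_eq ?_)
    change Λ * ‖M (e.symm v)‖ = _
    rw [← he, e.apply_symm_apply]

/-- The matrix `(N⁻¹)ᵀ N⁻¹` with `N = Mᵀ`. -/
noncomputable def gramInv (M : E →L[ℝ] E) : E →L[ℝ] E :=
  adjoint (adjoint M).inverse ∘L (adjoint M).inverse

lemma norm_adjoint_eq (M : E →L[ℝ] E) : ‖adjoint M‖ = ‖M‖ := LinearIsometryEquiv.norm_map _ M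

lemma gramInv_eq {M P : E →L[ℝ] E} (h1 : P ∘L M = ContinuousLinearMap.id ℝ E)
    (h2 : M ∘L P = ContinuousLinearMap.id ℝ E) : gramInv M = P ∘L adjoint P := by
  have h3 : adjoint M ∘L adjoint P = ContinuousLinearMap.id ℝ E := by
    rw [← adjoint_comp, h1, adjoint_id]
  have h4 : adjoint P ∘L adjoint M = ContinuousLinearMap.id ℝ E := by
    rw [← adjoint_comp, h2, adjoint_id]
  rw [gramInv, inverse_eq h3 h4, adjoint_adjoint]

lemma isSelfAdjoint_gramInv (M : E →L[ℝ] E) : IsSelfAdjoint (gramInv M) := by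
  rw [isSelfAdjoint_iff', gramInv, adjoint_comp, adjoint_adjoint]

/-- The condition `hw` says w = M⁻ᵀv, and then M⁻¹w = c⁻¹v'. Eigenvectors of M⁻¹M⁻ᵀ can thus be
exhibited without computing an inverse. -/
lemma gramInv_apply_of_adjoint {M : E →L[ℝ] E} (hΛ : 0 ≤ Λ) (hM : ∀ v, ‖v‖ ≤ Λ * ‖M v‖) {v w : E}
    (hw : ∀ u, inner ℝ w (M u) = inner ℝ v u) {c : ℝ} {v' : E} (hv' : M v' = c • w) :
    gramInv M v = c⁻¹ • v' ∨ c = 0 := by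
  by_cases hc : c = 0
  · exact Or.inr hc
  obtain ⟨P, h1, h2, -⟩ := exists_inverse hΛ hM
  refine Or.inl ?_
  have h3 : adjoint P v = w := by
    refine ext_inner_right ℝ fun u => ?_
    rw [adjoint_inner_left, ← hw, ← comp_apply, h2, id_apply]
  have h4 : P w = c⁻¹ • v' := by
    have h5 : w = c⁻¹ • M v' := by rw [hv', smul_smul, inv_mul_cancel₀ hc, one_smul]
    rw [h5, map_smul, ← comp_apply, h1, id_apply]
  rw [gramInv_eq h1 h2, comp_apply, h3, h4]

/-- The quadratic form of M⁻¹M⁻ᵀ at ξ is |M⁻ᵀξ|², and both Mᵀ and its inverse have norm at most Λ.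
-/
lemma elliptic_gramInv {M : E →L[ℝ] E} (hΛ : 0 < Λ) (hM : ∀ v, ‖v‖ ≤ Λ * ‖M v‖) (hM' : ‖M‖ ≤ Λ) :
    Elliptic (Λ ^ 2) (gramInv M) := fun ξ => by
  obtain ⟨P, h1, h2, h3⟩ := exists_inverse hΛ.le hM
  have e : inner ℝ (gramInv M ξ) ξ = ‖adjoint P ξ‖ ^ 2 := by
    rw [gramInv_eq h1 h2, comp_apply, ← adjoint_inner_right, real_inner_self_eq_norm_sq]
  rw [e]
  have h4 : ‖adjoint P ξ‖ ≤ Λ * ‖ξ‖ := le_of_opNorm_le _ (by rwa [norm_adjoint_eq]) ξ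
  have h5 : ‖ξ‖ ≤ Λ * ‖adjoint P ξ‖ := by
    have h6 : adjoint M (adjoint P ξ) = ξ := by
      rw [← comp_apply, ← adjoint_comp, h1, adjoint_id, id_apply]
    calc ‖ξ‖ = ‖adjoint M (adjoint P ξ)‖ := by rw [h6]
      _ ≤ _ := le_of_opNorm_le _ (by rwa [norm_adjoint_eq]) _
  constructor
  · rw [inv_mul_le_iff₀ (by positivity), ← mul_pow]
    exact pow_le_pow_left₀ (norm_nonneg _) h5 2
  · rw [← mul_pow]
    exact pow_le_pow_left₀ (norm_nonneg _) h4 2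

lemma norm_gramInv_le {M : E →L[ℝ] E} (hΛ : 0 ≤ Λ) (hM : ∀ v, ‖v‖ ≤ Λ * ‖M v‖) :
    ‖gramInv M‖ ≤ Λ ^ 2 := by
  obtain ⟨P, h1, h2, h3⟩ := exists_inverse hΛ hM
  rw [gramInv_eq h1 h2, sq]
  refine (opNorm_comp_le _ _).trans ?_
  rw [norm_adjoint_eq]
  exact mul_le_mul h3 h3 (norm_nonneg _) hΛ

lemma norm_gramInv_sub_le {M M' : E →L[ℝ] E} (hΛ : 0 ≤ Λ) (hM : ∀ v, ‖v‖ ≤ Λ * ‖M v‖)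
    (hM' : ∀ v, ‖v‖ ≤ Λ * ‖M' v‖) : ‖gramInv M - gramInv M'‖ ≤ 2 * Λ ^ 3 * ‖M - M'‖ := by
  obtain ⟨P, h1, h2, h3⟩ := exists_inverse hΛ hM
  obtain ⟨P', h1', h2', h3'⟩ := exists_inverse hΛ hM'
  rw [gramInv_eq h1 h2, gramInv_eq h1' h2']
  have e0 : P - P' = -(P ∘L ((M - M') ∘L P')) := by
    rw [sub_comp, h2', comp_sub, comp_id, ← comp_assoc, h1, id_comp, neg_sub]
  have h4 : ‖P - P'‖ ≤ Λ ^ 2 * ‖M - M'‖ := by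
    rw [e0, norm_neg]
    refine (opNorm_comp_le _ _).trans ?_
    have h5 := (opNorm_comp_le (M - M') P').trans (mul_le_mul_of_nonneg_left h3' (norm_nonneg _))
    have := mul_le_mul h3 h5 (norm_nonneg _) hΛ
    linarith
  have e : P ∘L adjoint P - P' ∘L adjoint P' =
      (P - P') ∘L adjoint P + P' ∘L adjoint (P - P') := by
    rw [map_sub, sub_comp, comp_sub]; abel
  rw [e]
  refine (norm_add_le _ _).trans ?_
  have h5 := opNorm_comp_le (P - P') (adjoint P)
  have h6 := opNorm_comp_le P' (adjoint (P - P'))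
  rw [norm_adjoint_eq] at h5 h6
  have h7 := mul_le_mul h4 h3 (norm_nonneg _) (by positivity)
  have h8 := mul_le_mul h3' h4 (norm_nonneg _) hΛ
  linarith

lemma contDiff_det : ContDiff ℝ 1 fun M : E →L[ℝ] E => M.det := by
  set b := Module.finBasis ℝ E
  have e : (fun M : E →L[ℝ] E => M.det) = fun M : E →L[ℝ] E =>
      ∑ σ : Equiv.Perm (Fin (Module.finrank ℝ E)), ((Equiv.Perm.sign σ : ℤ) : ℝ) *
        ∏ i, LinearMap.toMatrix b b (M : E →ₗ[ℝ] E) (σ i) i := by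
    funext M
    rw [ContinuousLinearMap.det, ← LinearMap.det_toMatrix b, Matrix.det_apply']
  rw [e]
  refine ContDiff.sum fun σ _ => contDiff_const.mul (contDiff_prod fun i _ => ?_)
  set l : (E →L[ℝ] E) →ₗ[ℝ] ℝ :=
    { toFun := fun M => LinearMap.toMatrix b b (M : E →ₗ[ℝ] E) (σ i) i
      map_add' := fun M M' => by simp
      map_smul' := fun c M => by simp }
  exact l.toContinuousLinearMap.contDiff

/-- The determinant is Lipschitz, bounded, and bounded away from zero. -/
lemma exists_det_bounds (E : Type*) [NormedAddCommGroup E] [InnerProductSpace ℝ E]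
    [FiniteDimensional ℝ E] (Λ : ℝ) : ∃ D, 1 ≤ D ∧ ∀ M : E →L[ℝ] E, ‖M‖ ≤ Λ →
      (∀ v, ‖v‖ ≤ Λ * ‖M v‖) → 0 ≤ Λ →
      D⁻¹ ≤ |(adjoint M).det| ∧ |(adjoint M).det| ≤ D ∧ ∀ M' : E →L[ℝ] E, ‖M'‖ ≤ Λ →
        abs (|(adjoint M).det| - |(adjoint M').det|) ≤ D * ‖M - M'‖ := by
  obtain ⟨C, hC, hl, hb⟩ := LipOn.of_contDiff (contDiff_det (E := E)) Λ
  refine ⟨max 1 C, le_max_left _ _, fun M hM hM' hΛ => ?_⟩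
  have hmem : ∀ N : E →L[ℝ] E, ‖N‖ ≤ Λ → N ∈ closedBall (0 : E →L[ℝ] E) Λ := fun N hN => by
    rwa [mem_closedBall_zero_iff]
  have hadj : ∀ N : E →L[ℝ] E, ‖N‖ ≤ Λ → adjoint N ∈ closedBall (0 : E →L[ℝ] E) Λ := fun N hN =>
    hmem _ (by rwa [norm_adjoint_eq])
  have hle : ∀ N : E →L[ℝ] E, ‖N‖ ≤ Λ → |(adjoint N).det| ≤ max 1 C := fun N hN =>
    (hb _ (hadj N hN)).trans (le_max_right _ _)
  refine ⟨?_, hle M hM, fun M' hM'' => ?_⟩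
  -- The inverse also has norm at most Λ, so the upper bound applies to its determinant, and the two
  -- determinants have product 1.
  · obtain ⟨P, h1, -, h3⟩ := exists_inverse hΛ hM'
    have h4 : (adjoint M).det * (adjoint P).det = 1 := by
      have h5 : adjoint M ∘L adjoint P = ContinuousLinearMap.id ℝ E := by
        rw [← adjoint_comp, h1, adjoint_id]
      have h6 : LinearMap.det ((adjoint M : E →ₗ[ℝ] E) ∘ₗ (adjoint P : E →ₗ[ℝ] E)) = 1 := by
        rw [← ContinuousLinearMap.toLinearMap_comp, h5, ContinuousLinearMap.coe_id,
          LinearMap.det_id]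
      rwa [LinearMap.det_comp] at h6
    have h7 : |(adjoint M).det| * |(adjoint P).det| = 1 := by rw [← abs_mul, h4, abs_one]
    rw [inv_le_iff_one_le_mul₀ (lt_of_lt_of_le one_pos (le_max_left _ _))]
    exact h7.ge.trans (mul_le_mul_of_nonneg_left (hle P h3) (abs_nonneg _))
  · refine (abs_abs_sub_abs_le _ _).trans ?_
    have h1 := hl _ (hadj M hM) _ (hadj M' hM'')
    have h2 : ‖adjoint M - adjoint M'‖ = ‖M - M'‖ := by rw [← map_sub, norm_adjoint_eq]
    rw [h2] at h1
    exact h1.trans (mul_le_mul_of_nonneg_right (le_max_right _ _) (norm_nonneg _))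

end Gram

/-! ### A criterion for the higher co-dimensional condition -/

section Condition

variable {d m : ℕ}

lemma isSelfAdjoint_compression {T : Amb d m →L[ℝ] Amb d m} (hT : IsSelfAdjoint T) :
    IsSelfAdjoint (fstA d m ∘L T ∘L inlL d m) := by
  rw [ContinuousLinearMap.isSelfAdjoint_iff_isSymmetric] at hT ⊢
  intro u v
  have h1 := hT (pt u 0) (pt v 0)
  simp only [ContinuousLinearMap.coe_coe, inner_amb, pt_fst, pt_snd, inner_zero_right,
    inner_zero_left, add_zero] at h1
  exact h1

/-- A symmetric operator that acts as a scalar on {0} × ℝ^m preserves the orthogonal complement, so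
there are no off-diagonal blocks. -/
lemma eq_blockOp {T : Amb d m →L[ℝ] Amb d m} (hT : IsSelfAdjoint T) {c : ℝ}
    (hc : ∀ s : Eu m, T (pt 0 s) = c • pt 0 s) :
    T = blockOp (fstA d m ∘L T ∘L inlL d m) c := by
  rw [ContinuousLinearMap.isSelfAdjoint_iff_isSymmetric] at hT
  refine ContinuousLinearMap.ext fun X => ?_
  have h0 : ∀ u : Eu d, (T (pt u 0)).snd = 0 := fun u => by
    refine ext_inner_right ℝ fun s => ?_
    have h1 := hT (pt u 0) (pt 0 s)
    simp only [ContinuousLinearMap.coe_coe, hc, inner_smul_right, inner_amb, pt_fst, pt_snd,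
      inner_zero_right, inner_zero_left, add_zero, zero_add, mul_zero] at h1
    rw [h1, inner_zero_left]
  have h2 : X = pt X.fst 0 + pt 0 X.snd := by rw [pt_add, add_zero, zero_add, pt_eta]
  have h3 : T (pt X.fst 0) = pt (T (pt X.fst 0)).fst 0 := by
    have h5 := pt_eta (T (pt X.fst 0))
    rw [h0] at h5
    exact h5.symm
  have h4 : blockOp (fstA d m ∘L T ∘L inlL d m) c X = pt (T (pt X.fst 0)).fst (c • X.snd) := rfl
  rw [h4]
  conv_lhs => rw [h2, map_add, hc, h3, smul_pt, pt_add, smul_zero, add_zero, zero_add]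

lemma hasFDerivAt_inv_norm_pow {X : Amb d m} (hX : X.snd ≠ 0) (k : ℕ) :
    ∃ f' : Amb d m →L[ℝ] ℝ, HasFDerivAt (fun X : Amb d m => (‖X.snd‖ ^ k)⁻¹) f' X ∧
      ‖f'‖ ≤ k * (‖X.snd‖ ^ (k + 1))⁻¹ := by
  have h0 := norm_pos_iff.mpr hX
  have h1 : HasFDerivAt (fun X : Amb d m => ‖X.snd‖) (innerSL ℝ (dirT X) ∘L sndA d m) X :=
    (hasFDerivAt_norm_of_ne hX).comp X (sndA d m).hasFDerivAt
  have h2 := ((hasDerivAt_pow k ‖X.snd‖).fun_inv (pow_ne_zero _ h0.ne')).comp_hasFDerivAt X h1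
  refine ⟨_, h2, ?_⟩
  have h3 : ‖innerSL ℝ (dirT X) ∘L sndA d m‖ ≤ 1 :=
    ContinuousLinearMap.opNorm_le_bound _ zero_le_one fun v => by
      rw [one_mul]; exact norm_inner_dirT_le X v
  rw [norm_smul]
  refine (mul_le_mul_of_nonneg_left h3 (norm_nonneg _)).trans ?_
  rw [mul_one, norm_div, norm_neg, norm_mul, norm_pow, norm_pow, norm_pow, norm_norm,
    Real.norm_natCast]
  rcases k with _ | k
  · simp
  · rw [Nat.add_sub_cancel, div_le_iff₀ (by positivity)]
    refine le_of_eq ?_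
    field_simp
    ring

lemma norm_fderiv_inv_pow_smul_le {W : Type*} [NormedAddCommGroup W] [NormedSpace ℝ W]
    {A cA : Amb d m → W} {C M : ℝ} {s : Set (Amb d m)} {X : Amb d m} (hm : 1 ≤ m)
    (hX : X.snd ≠ 0) (hX1 : ‖X.snd‖ ≤ 1) (hC : 0 ≤ C)
    (hA : ∀ᶠ Y in nhds X, A Y = (‖Y.snd‖ ^ (m - 1))⁻¹ • cA Y) (hl : LipOn C cA s)
    (hs : s ∈ nhds X) (hM : ‖cA X‖ ≤ M) : ‖fderiv ℝ A X‖ ≤ (C + m * M) * (‖X.snd‖ ^ m)⁻¹ := by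
  have hpos := norm_pos_iff.mpr hX
  have hM0 : 0 ≤ M := (norm_nonneg _).trans hM
  have hmm : m - 1 + 1 = m := Nat.sub_add_cancel hm
  by_cases hd : DifferentiableAt ℝ cA X
  · obtain ⟨f', hf', hfb⟩ := hasFDerivAt_inv_norm_pow hX (m - 1)
    have h1 : HasFDerivAt A _ X := (hf'.smul hd.hasFDerivAt).congr_of_eventuallyEq hA
    rw [h1.fderiv]
    have h2 := hl.norm_fderiv_le hC hs
    have h3 : (‖X.snd‖ ^ (m - 1))⁻¹ ≤ (‖X.snd‖ ^ m)⁻¹ :=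
      inv_anti₀ (by positivity) (pow_le_pow_of_le_one hpos.le hX1 (Nat.sub_le m 1))
    rw [hmm] at hfb
    have hm1 : ((m - 1 : ℕ) : ℝ) ≤ m := by exact_mod_cast Nat.sub_le m 1
    refine (norm_add_le _ _).trans ?_
    rw [norm_smul, ContinuousLinearMap.norm_smulRight_apply, Real.norm_of_nonneg (by positivity)]
    have h4 := mul_le_mul h3 h2 (norm_nonneg _) (by positivity)
    have h5 : ‖f'‖ * ‖cA X‖ ≤ (m * (‖X.snd‖ ^ m)⁻¹) * M :=
      mul_le_mul (hfb.trans (mul_le_mul_of_nonneg_right hm1 (by positivity))) hM (norm_nonneg _)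
        (by positivity)
    linarith
  -- Off {t = 0} the weight is smooth and nonzero, so the two fields are differentiable at the same
  -- points. Elsewhere `fderiv` is 0 by convention and the bound is trivial.
  · have hA' : ¬ DifferentiableAt ℝ A X := fun hA' => hd (by
      have h1 : DifferentiableAt ℝ (fun X : Amb d m => ‖X.snd‖ ^ (m - 1)) X :=
        (((sndA d m).differentiableAt).norm ℝ hX).pow _
      refine (h1.smul hA').congr_of_eventuallyEq ?_
      have h2 : ∀ᶠ Y : Amb d m in nhds X, Y.snd ≠ 0 :=
        (isOpen_ne_fun (sndA d m).continuous continuous_const).mem_nhds hX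
      filter_upwards [hA, h2] with Y hY hY0
      rw [Pi.smul_apply', hY, smul_smul,
        mul_inv_cancel₀ (pow_ne_zero _ (norm_ne_zero_iff.mpr hY0)), one_smul])
    rw [fderiv_zero_of_not_differentiableAt hA', norm_zero]
    positivity

/-- A matrix field of the form `|t|^{-(m-1)} 𝒜` with `𝒜` Lipschitz, elliptic, and of block form on
`{t = 0}`, satisfies the higher co-dimensional `C^{0,1}` condition. -/
lemma higherCodimC01_of_lipOn {A cA : Amb d m → (Amb d m →L[ℝ] Amb d m)} {R lam C M C₀ : ℝ}
    (hm : 1 ≤ m) (hR : R ≤ 1) (hC : 0 ≤ C)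
    (hA : ∀ X ∈ offPlane 0 R, A X = (‖X.snd‖ ^ (m - 1))⁻¹ • cA X)
    (hl : LipOn C cA (ball 0 R)) (hM : ∀ X ∈ ball 0 R, ‖cA X‖ ≤ M)
    (hs : ∀ X ∈ ball 0 R, IsSelfAdjoint (cA X)) (he : ∀ X ∈ ball 0 R, Elliptic lam (cA X))
    (hb : ∀ X ∈ ball 0 R, X.snd = 0 → ∃ c : ℝ, ∀ s : Eu m, cA X (pt 0 s) = c • pt 0 s)
    (hC₀ : 3 * C + m * M ≤ C₀) : HigherCodimC01 A 0 R lam C₀ := by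
  have hopen : IsOpen (offPlane (0 : Amb d m) R) :=
    isOpen_ball.inter (isOpen_ne_fun (sndA d m).continuous continuous_const)
  have hne : ∀ X ∈ offPlane (0 : Amb d m) R, ‖X.snd‖ ^ (m - 1) ≠ 0 := fun X hX =>
    pow_ne_zero _ (norm_ne_zero_iff.mpr hX.2)
  have hcA : ∀ X ∈ offPlane (0 : Amb d m) R, cA X = ‖X.snd‖ ^ (m - 1) • A X := fun X hX => by
    rw [hA X hX, smul_smul, mul_inv_cancel₀ (hne X hX), one_smul]
  have hlt : ∀ X ∈ ball (0 : Amb d m) R, ‖X.snd‖ ≤ 1 := fun X hX =>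
    (norm_snd_le X).trans ((mem_ball_zero_iff.mp hX).le.trans hR)
  have hproj : ∀ X ∈ ball (0 : Amb d m) R, pt X.fst 0 ∈ ball (0 : Amb d m) R := fun X hX => by
    rw [mem_ball_zero_iff] at hX ⊢
    rw [norm_pt_zero_right]
    exact (norm_fst_le X).trans_lt hX
  have hM0 : ∀ X ∈ ball (0 : Amb d m) R, 0 ≤ M := fun X hX => (norm_nonneg _).trans (hM X hX)
  obtain ⟨e₀, he₀⟩ : ∃ e₀ : Eu m, ‖e₀‖ = 1 :=
    ⟨EuclideanSpace.single ⟨0, hm⟩ 1, by simp⟩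
  -- The blocks are those of the trace on {t = 0}, extended constantly in t. The error is then 𝒜(x,
  -- t) - 𝒜(x, 0), which is O(|t|).
  set J : Amb d m → (Eu d →L[ℝ] Eu d) := fun X => fstA d m ∘L cA (pt X.fst 0) ∘L inlL d m
  set h : Amb d m → ℝ := fun X => inner ℝ (cA (pt X.fst 0) (pt 0 e₀)) (pt 0 e₀)
  have hpl : LipOn C (fun X : Amb d m => cA (pt X.fst 0)) (ball 0 R) := fun X hX Y hY => by
    refine (hl _ (hproj X hX) _ (hproj Y hY)).trans (mul_le_mul_of_nonneg_left ?_ hC)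
    rw [pt_sub, sub_zero, norm_pt_zero_right]
    exact norm_fst_le (X - Y)
  have hJl : LipOn C J (ball 0 R) := fun X hX Y hY => by
    refine (ContinuousLinearMap.opNorm_le_bound _ (norm_nonneg _) fun u => ?_).trans
      (hpl X hX Y hY)
    have e : (J X - J Y) u = ((cA (pt X.fst 0) - cA (pt Y.fst 0)) (pt u 0)).fst := rfl
    rw [e]
    refine (norm_fst_le _).trans ?_
    have := (cA (pt X.fst 0) - cA (pt Y.fst 0)).le_opNorm (pt u 0)
    rwa [norm_pt_zero_right] at this
  have hne0 : ‖(pt 0 e₀ : Amb d m)‖ = 1 := by rw [norm_pt_zero_left, he₀]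
  have hhl : LipOn C h (ball 0 R) := fun X hX Y hY => by
    have e : h X - h Y =
        inner ℝ ((cA (pt X.fst 0) - cA (pt Y.fst 0)) (pt 0 e₀)) (pt 0 e₀) := by
      rw [_root_.sub_apply, inner_sub_left]
    rw [e]
    refine (norm_inner_le_norm _ _).trans ?_
    rw [hne0, mul_one]
    have := (cA (pt X.fst 0) - cA (pt Y.fst 0)).le_opNorm (pt 0 e₀)
    rw [hne0, mul_one] at this
    exact this.trans (hpl X hX Y hY)
  refine ⟨fun X hX => ?_, fun X hX => ?_, fun X hX => ?_, fun X hX => ?_, cA, J, h, hcA,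
    ⟨C.toNNReal, hl.lipschitzOnWith, hJl.lipschitzOnWith, hhl.lipschitzOnWith⟩, fun X hX => ?_⟩
  · obtain ⟨f', hf', -⟩ := hasFDerivAt_inv_norm_pow hX.2 (m - 1)
    have hcd : ContDiffAt ℝ 1 (fun X : Amb d m => (‖X.snd‖ ^ (m - 1))⁻¹) X :=
      (((sndA d m).contDiff.contDiffAt.norm ℝ hX.2).pow _).inv (hne X hX)
    obtain ⟨k, t, ht, hk⟩ := hcd.exists_lipschitzOnWith
    have hbd : ∀ᶠ Y in nhds X, ‖(‖Y.snd‖ ^ (m - 1))⁻¹‖ < ‖(‖X.snd‖ ^ (m - 1))⁻¹‖ + 1 :=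
      hcd.continuousAt.norm.eventually_lt_const (lt_add_one _)
    set s := t ∩ ({Y | ‖(‖Y.snd‖ ^ (m - 1))⁻¹‖ < ‖(‖X.snd‖ ^ (m - 1))⁻¹‖ + 1} ∩ offPlane 0 R)
    have hkl : LipOn (k : ℝ) (fun X : Amb d m => (‖X.snd‖ ^ (m - 1))⁻¹) s := fun Y hY Z hZ => by
      have := hk.dist_le_mul Y hY.1 Z hZ.1
      rwa [dist_eq_norm, dist_eq_norm] at this
    have hprod := hkl.smul (hl.mono le_rfl (fun Y hY => hY.2.2.1 : s ⊆ ball 0 R))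
      (fun Y hY => le_of_lt hY.2.1) (fun Y hY => hM Y hY.2.2.1)
    exact ⟨_, s, mem_nhdsWithin_of_mem_nhds
      (Filter.inter_mem ht (Filter.inter_mem hbd (hopen.mem_nhds hX))),
      (hprod.congr fun Y hY => hA Y hY.2.2).lipschitzOnWith⟩
  · rw [hA X hX]
    exact (IsSelfAdjoint.all _).smul (hs X hX.1)
  · rw [← hcA X hX]
    exact he X hX.1
  · have hM0' := hM0 X hX.1
    refine (norm_fderiv_inv_pow_smul_le hm hX.2 (hlt X hX.1) hC
      (Filter.eventually_of_mem (hopen.mem_nhds hX) fun Y hY => hA Y hY) hl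
      (isOpen_ball.mem_nhds hX.1) (hM X hX.1)).trans
      (mul_le_mul_of_nonneg_right (by linarith) (by positivity))
  · have hP := hproj X hX
    have hM0' := hM0 X hX
    have hhb := he _ hP (pt 0 e₀)
    rw [hne0, one_pow, mul_one, mul_one] at hhb
    refine ⟨isSelfAdjoint_compression (hs _ hP), fun u => ?_, hhb.1, hhb.2, ?_, ?_⟩
    · have h1 := he _ hP (pt u 0)
      rw [norm_pt_zero_right, inner_amb, pt_fst, pt_snd, inner_zero_right, add_zero] at h1
      exact h1
    · have hb := isOpen_ball.mem_nhds hX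
      have h1 := hl.norm_fderiv_le hC hb
      have h2 := hJl.norm_fderiv_le hC hb
      have h3 := hhl.norm_fderiv_le hC hb
      have : 0 ≤ m * M := by positivity
      linarith
    · obtain ⟨c, hc⟩ := hb _ hP rfl
      have hch : h X = c := by
        simp only [h, hc, inner_smul_left, real_inner_self_eq_norm_sq, hne0]
        simp
      rw [hch, ← eq_blockOp (hs _ hP) hc]
      have h1 := hl X hX _ hP
      have e : ‖X - pt X.fst 0‖ = ‖X.snd‖ := by
        conv_lhs => rw [← pt_eta X, pt_sub]
        simp
      rw [e] at h1
      refine h1.trans (mul_le_mul_of_nonneg_right ?_ (norm_nonneg _))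
      have : 0 ≤ m * M := by positivity
      linarith

end Condition

end HigherCodim

namespace HigherCodim

/-! ### The rescaled squared distance from ρ(X) to the graph -/

section Distance

variable {d m : ℕ} {θ : Amb d m → ℝ} {η : Eu d → ℝ} {ψ : Eu d → Eu m} {ε L β κ C K : ℝ}

lemma rpow_neg_sub_le {c s t a : ℝ} (hc : 0 < c) (hs : c ≤ s) (ht : c ≤ t) (ha : 0 ≤ a) :
    |s ^ (-a) - t ^ (-a)| ≤ a * c ^ (-a - 1) * |s - t| := by
  have := (convex_Ici c).norm_image_sub_le_of_norm_hasDerivWithin_le (C := a * c ^ (-a - 1))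
    (f := fun s : ℝ => s ^ (-a)) (f' := fun s => -a * s ^ (-a - 1)) (fun s hs => by
      have hs : c ≤ s := hs
      exact (Real.hasDerivAt_rpow_const (Or.inl (by linarith : s ≠ 0))).hasDerivWithinAt)
    (fun s hs => by
      have hs : c ≤ s := hs
      have h0 : 0 ≤ s ^ (-a - 1) := Real.rpow_nonneg (by linarith) _
      rw [norm_mul, norm_neg, Real.norm_of_nonneg ha, Real.norm_of_nonneg h0]
      exact mul_le_mul_of_nonneg_left
        (Real.rpow_le_rpow_of_nonpos hc hs (by linarith)) ha)
    (show t ∈ Ici c from ht) (show s ∈ Ici c from hs)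
  simpa using this

/-- The square of `|t|⁻¹ |ρ(x, t) - Y|` for the point `Y` of the graph over `x + |t| z`. -/
noncomputable def distN (η : Eu d → ℝ) (θ : Amb d m → ℝ) (β κ : ℝ) (ψ : Eu d → Eu m)
    (X : Amb d m) (z : Eu d) : ℝ :=
  ‖z‖ ^ 2 + ‖relPos η ψ (cyl X) z‖ ^ 2 +
    2 * κ * inner ℝ (relPos η ψ (cyl X) z + mollB η ψ (cyl X) z)
      (stretch η θ β ψ (cyl X) (dirT X)).snd + (κ * scal η θ β ψ (cyl X)) ^ 2

/-- Divided by |t|, the difference is (-z, q) plus a vector normal to the graph of B = `mollB`.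
Writing (-z, q) = (0, q + Bz) - (z, Bz), the last vector is tangent and drops out of the cross term,
leaving the combination q + Bz, which is O(r). -/
lemma norm_modelRho_sub_graphMap_sq (hη : IsMollifier η) (h : FlatMap ψ ε L) {X : Amb d m}
    (hX : X.snd ≠ 0) (z : Eu d) :
    ‖modelRho η θ β κ ψ X - graphMap ψ (X.fst + ‖X.snd‖ • z)‖ ^ 2 =
      ‖X.snd‖ ^ 2 * distN η θ β κ ψ X z := by
  set p := cyl X
  have e1 : modelRho η θ β κ ψ X - graphMap ψ (X.fst + ‖X.snd‖ • z) =
      ‖X.snd‖ • (pt (-z) (relPos η ψ p z) + κ • stretch η θ β ψ p (dirT X)) := by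
    have h1 : ‖X.snd‖ • relPos η ψ p z = phiS η ψ ‖X.snd‖ X.fst - ψ (X.fst + ‖X.snd‖ • z) :=
      smul_relPos hη h p z
    have h2 : pt X.fst (phiS η ψ ‖X.snd‖ X.fst) - graphMap ψ (X.fst + ‖X.snd‖ • z) =
        ‖X.snd‖ • pt (-z) (relPos η ψ p z) := by
      rw [graphMap, pt_sub, smul_pt, h1, sub_add_cancel_left, smul_neg]
    have h3 : stretch η θ β ψ p X.snd = ‖X.snd‖ • stretch η θ β ψ p (dirT X) := by
      rw [← map_smul, smul_dirT]
    rw [modelRho, add_sub_right_comm, h2, h3, smul_add, smul_comm]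
  rw [e1, norm_smul, norm_norm, mul_pow, norm_add_sq_real]
  congr 1
  have h4 : pt (-z) (relPos η ψ p z) =
      pt 0 (relPos η ψ p z + mollB η ψ p z) - liftL (mollB η ψ p) z := by
    rw [liftL_apply, pt_sub, zero_sub, add_sub_cancel_right]
  have h5 : inner ℝ (pt (-z) (relPos η ψ p z)) (stretch η θ β ψ p (dirT X)) =
      inner ℝ (relPos η ψ p z + mollB η ψ p z) (stretch η θ β ψ p (dirT X)).snd := by
    rw [h4, inner_sub_left, inner_amb]
    have h6 : inner ℝ (liftL (mollB η ψ p) z) (stretch η θ β ψ p (dirT X)) = 0 := by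
      rw [stretch, _root_.smul_apply, inner_smul_right, inner_liftL_frame, mul_zero]
    rw [h6, pt_fst, pt_snd, inner_zero_left, zero_add, sub_zero]
  have h6 : ‖κ • stretch η θ β ψ p (dirT X)‖ ^ 2 = (κ * scal η θ β ψ p) ^ 2 := by
    rw [stretch, _root_.smul_apply, smul_smul, norm_smul, norm_frame_apply, norm_dirT hX, mul_one,
      Real.norm_eq_abs, sq_abs]
  rw [h6, inner_smul_right, h5, norm_sq_amb, pt_fst, pt_snd, norm_neg, distN]
  ring

section Bounds

variable (hη : IsMollifier η) (h : FlatMap ψ ε L)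
  (hs : ∀ p, |scal η θ β ψ p - 1| ≤ 1 / 2)

include hs

lemma abs_scal_le (p : Eu d × ℝ) : |scal η θ β ψ p| ≤ 3 / 2 := by
  have := abs_le.mp (hs p)
  rw [abs_le]; constructor <;> linarith

lemma norm_stretch_apply_le (p : Eu d × ℝ) (s : Eu m) : ‖stretch η θ β ψ p s‖ ≤ 3 / 2 * ‖s‖ := by
  rw [stretch, _root_.smul_apply, norm_smul, norm_frame_apply]
  exact mul_le_mul_of_nonneg_right (abs_scal_le hs p) (norm_nonneg _)

lemma norm_stretch_le (p : Eu d × ℝ) : ‖stretch η θ β ψ p‖ ≤ 3 / 2 :=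
  ContinuousLinearMap.opNorm_le_bound _ (by norm_num) fun s => norm_stretch_apply_le hs p s

include hη h

lemma norm_relPos_add_mollB_le (p : Eu d × ℝ) (z : Eu d) :
    ‖relPos η ψ p z + mollB η ψ p z‖ ≤ ε * (1 + 2 * ‖z‖) := by
  have h1 := norm_relPos_le hη h p z
  have h2 := ContinuousLinearMap.le_of_opNorm_le _ (norm_mollB_le hη h p) z
  have := norm_add_le (relPos η ψ p z) (mollB η ψ p z)
  linarith

lemma abs_inner_relPos_le (X : Amb d m) (z : Eu d) :
    |inner ℝ (relPos η ψ (cyl X) z + mollB η ψ (cyl X) z)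
      (stretch η θ β ψ (cyl X) (dirT X)).snd| ≤ 3 / 2 * (ε * (1 + 2 * ‖z‖)) := by
  refine (abs_real_inner_le_norm _ _).trans ?_
  have h1 := norm_relPos_add_mollB_le hη h hs (cyl X) z
  have h2 := (norm_snd_le _).trans (norm_stretch_apply_le hs (cyl X) (dirT X))
  have h3 := mul_le_mul_of_nonneg_left (norm_dirT_le X) (show (0 : ℝ) ≤ 3 / 2 by norm_num)
  have h4 := mul_le_mul h1 (h2.trans h3) (norm_nonneg _) ((norm_nonneg _).trans h1)
  linarith

lemma le_distN (hK : 1 ≤ K) (hκ : K⁻¹ ≤ κ) (hκ' : κ ≤ K) (hε : ε * (96 * K ^ 3) ≤ 1)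
    (X : Amb d m) (z : Eu d) : (8 * K ^ 2)⁻¹ * (1 + ‖z‖ ^ 2) ≤ distN η θ β κ ψ X z := by
  have hK0 : 0 < K := by linarith
  have hε0 := h.eps_nonneg
  have hκ0 : 0 ≤ κ := (inv_pos.mpr hK0).le.trans hκ
  set I := inner ℝ (relPos η ψ (cyl X) z + mollB η ψ (cyl X) z)
      (stretch η θ β ψ (cyl X) (dirT X)).snd
  have hI : |I| ≤ 3 / 2 * (ε * (1 + 2 * ‖z‖)) := abs_inner_relPos_le hη h hs X z
  set q := (K ^ 2)⁻¹
  have hq0 : 0 < q := by positivity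
  have hq1 : q ≤ 1 := inv_le_one_of_one_le₀ (one_le_pow₀ hK)
  -- With q = K⁻², the cross term is then at most (q/32)(2 + |z|²). The terms |z|² ≥ q|z|² and
  -- (κ·scal)² ≥ q/4 dominate it and still leave (q/8)(1 + |z|²).
  have he : K * ε ≤ q / 96 := by
    calc K * ε = ε * (96 * K ^ 3) * (q / 96) := by simp only [q]; field_simp
      _ ≤ 1 * (q / 96) := mul_le_mul_of_nonneg_right hε (by positivity)
      _ = q / 96 := one_mul _
  have h1 : -(2 * κ * I) ≤ 3 * (K * ε) * (2 + ‖z‖ ^ 2) := by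
    have h2 : κ * -I ≤ K * (3 / 2 * (ε * (1 + 2 * ‖z‖))) :=
      (mul_le_mul_of_nonneg_left (neg_le_abs I) hκ0).trans
        (mul_le_mul hκ' hI (abs_nonneg _) hK0.le)
    have h3 : 1 + 2 * ‖z‖ ≤ 2 + ‖z‖ ^ 2 := by nlinarith [sq_nonneg (‖z‖ - 1)]
    have h4 := mul_le_mul_of_nonneg_left h3 (show 0 ≤ 3 * (K * ε) by positivity)
    linarith
  have h2 : q / 4 ≤ (κ * scal η θ β ψ (cyl X)) ^ 2 := by
    have h3 : 1 / 2 ≤ scal η θ β ψ (cyl X) := by linarith [(abs_le.mp (hs (cyl X))).1]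
    have h4 := mul_le_mul hκ h3 (by norm_num) hκ0
    have h5 := pow_le_pow_left₀ (by positivity) h4 2
    refine le_trans (le_of_eq ?_) h5
    simp only [q]; field_simp; norm_num
  have h3 : (8 * K ^ 2)⁻¹ = q / 8 := by simp only [q]; field_simp
  have h4 := mul_le_mul_of_nonneg_right he (show 0 ≤ 2 + ‖z‖ ^ 2 by positivity)
  have h5 := mul_le_mul_of_nonneg_right hq1 (sq_nonneg ‖z‖)
  have h6 := sq_nonneg ‖relPos η ψ (cyl X) z‖
  have h7 := sq_nonneg ‖z‖
  rw [distN, h3]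
  change _ ≤ ‖z‖ ^ 2 + ‖relPos η ψ (cyl X) z‖ ^ 2 + 2 * κ * I + _
  linarith

lemma distN_le (hK : 1 ≤ K) (hκ : K⁻¹ ≤ κ) (hκ' : κ ≤ K) (hε : ε * (96 * K ^ 3) ≤ 1)
    (X : Amb d m) {z : Eu d} (hz : ‖z‖ ≤ 1) : distN η θ β κ ψ X z ≤ 20 * K ^ 2 := by
  have hK0 : 0 < K := by linarith
  have hε0 := h.eps_nonneg
  have hκ0 : 0 ≤ κ := (inv_pos.mpr hK0).le.trans hκ
  have hK3 : 1 ≤ K ^ 3 := one_le_pow₀ hK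
  have hK2 : 1 ≤ K ^ 2 := one_le_pow₀ hK
  have hε1 : ε ≤ 1 := by nlinarith
  set I := inner ℝ (relPos η ψ (cyl X) z + mollB η ψ (cyl X) z)
      (stretch η θ β ψ (cyl X) (dirT X)).snd
  have hI : |I| ≤ 9 / 2 := by
    refine (abs_inner_relPos_le hη h hs X z).trans ?_
    have := mul_le_mul hε1 (show 1 + 2 * ‖z‖ ≤ 3 by linarith) (by positivity) zero_le_one
    linarith
  have h1 : κ * I ≤ K ^ 2 * (9 / 2) := by
    refine (le_abs_self _).trans ?_
    rw [abs_mul, abs_of_nonneg hκ0]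
    exact mul_le_mul (hκ'.trans (by nlinarith)) hI (abs_nonneg _) (by positivity)
  have h2 : ‖relPos η ψ (cyl X) z‖ ^ 2 ≤ 4 := by
    have h3 := norm_relPos_le hη h (cyl X) z
    have h4 : ‖relPos η ψ (cyl X) z‖ ≤ 2 := h3.trans (by nlinarith [norm_nonneg z])
    have := pow_le_pow_left₀ (norm_nonneg _) h4 2
    linarith
  have h3 : (κ * scal η θ β ψ (cyl X)) ^ 2 ≤ K ^ 2 * (9 / 4) := by
    rw [mul_pow, ← sq_abs (scal η θ β ψ (cyl X))]
    have h5 := pow_le_pow_left₀ (abs_nonneg _) (abs_scal_le hs (cyl X)) 2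
    exact mul_le_mul (pow_le_pow_left₀ hκ0 hκ' 2) (h5.trans (by norm_num)) (sq_nonneg _)
      (by positivity)
  have h4 : ‖z‖ ^ 2 ≤ 1 := pow_le_one₀ (norm_nonneg _) hz
  rw [distN]
  change ‖z‖ ^ 2 + ‖relPos η ψ (cyl X) z‖ ^ 2 + 2 * κ * I + _ ≤ _
  linarith

/-- The direction t/|t| occurs only in the cross term, next to a factor that is O(r) by
`relPos_add_mollB_le`. The cubic growth in z comes from the squared vertical difference: size 1 +
|z| times Lipschitz constant (1 + |z|)². -/
lemma lipOn_distN (hC : 0 ≤ C) (hε : ε ≤ 1) (hκ : |κ| ≤ K)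
    (hl : LipOn (C * L) (scal η θ β ψ) univ) (hl' : LipOn (C * L) (stretch η θ β ψ) univ)
    (z : Eu d) : LipOn ((4 * L + 2 * K * (3 * (8 * L + 2 * (C * L))) + K ^ 2 * (3 * (C * L))) *
      (1 + ‖z‖) ^ 3) (fun X : Amb d m => distN η θ β κ ψ X z) univ := by
  have hL := h.lip_nonneg
  have hε0 := h.eps_nonneg
  have hK : 0 ≤ K := (abs_nonneg _).trans hκ
  have hz := norm_nonneg z
  have hcyl := lipOn_cyl (univ : Set (Amb d m))
  have hu : MapsTo (cyl : Amb d m → Eu d × ℝ) univ univ := fun _ _ => mem_univ _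
  have hCL : 0 ≤ C * L := by positivity
  set u := 1 + ‖z‖
  have hu1 : 1 ≤ u := by simp only [u]; linarith
  have hu2 : u ^ 2 ≤ u ^ 3 := pow_le_pow_right₀ hu1 (by norm_num)
  have hu3 : 1 ≤ u ^ 3 := one_le_pow₀ hu1
  have hu4 : u ≤ u ^ 2 := le_self_pow₀ hu1 (by norm_num)
  have h1 : LipOn (4 * L * u ^ 3) (fun X : Amb d m => ‖relPos η ψ (cyl X) z‖ ^ 2) univ := by
    have h2 : LipOn (2 * L * u ^ 2) (fun X : Amb d m => relPos η ψ (cyl X) z) univ := by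
      have := (lipOn_relPos hη h z).comp hcyl hu (by positivity)
      rwa [mul_one] at this
    intro X hX Y hY
    have h3 := h2 X hX Y hY
    have h4 : ‖relPos η ψ (cyl X) z‖ ≤ u :=
      (norm_relPos_le hη h (cyl X) z).trans (mul_le_of_le_one_left (by positivity) hε)
    have h5 : ‖relPos η ψ (cyl Y) z‖ ≤ u :=
      (norm_relPos_le hη h (cyl Y) z).trans (mul_le_of_le_one_left (by positivity) hε)
    have h6 := (abs_norm_sub_norm_le _ _).trans h3
    rw [Real.norm_eq_abs, sq_sub_sq, abs_mul, abs_of_nonneg (by positivity)]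
    have h7 := mul_le_mul (add_le_add h4 h5) h6 (abs_nonneg _) (by positivity)
    refine h7.trans (le_of_eq (by ring))
  have h2 : LipOn (3 * (8 * L + 2 * (C * L)) * u ^ 2) (fun X : Amb d m =>
      inner ℝ (relPos η ψ (cyl X) z + mollB η ψ (cyl X) z)
        (stretch η θ β ψ (cyl X) (dirT X)).snd) univ := by
    set f : Amb d m → Eu m →L[ℝ] ℝ := fun X =>
      innerSL ℝ (relPos η ψ (cyl X) z + mollB η ψ (cyl X) z) ∘L
        (sndA d m ∘L stretch η θ β ψ (cyl X))
    have hq : LipOn (4 * L * u ^ 2) (fun X : Amb d m => innerSL ℝ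
        (relPos η ψ (cyl X) z + mollB η ψ (cyl X) z)) univ := fun X hX Y hY => by
      rw [← map_sub, innerSL_apply_norm]
      have h3 := (lipOn_relPos_add_mollB hη h z).comp hcyl hu (by positivity) X hX Y hY
      simpa using h3
    have hF : LipOn (C * L) (fun X : Amb d m => sndA d m ∘L stretch η θ β ψ (cyl X)) univ :=
      fun X hX Y hY => by
        rw [← ContinuousLinearMap.comp_sub]
        refine (ContinuousLinearMap.opNorm_comp_le _ _).trans ?_
        have h3 := hl'.comp hcyl hu hCL X hX Y hY
        rw [mul_one] at h3
        have := mul_le_mul (norm_sndA_le (d := d) (m := m)) h3 (norm_nonneg _) zero_le_one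
        rwa [one_mul] at this
    have hFb : ∀ X : Amb d m, ‖sndA d m ∘L stretch η θ β ψ (cyl X)‖ ≤ 2 := fun X => by
      refine (ContinuousLinearMap.opNorm_comp_le _ _).trans ?_
      have := mul_le_mul (norm_sndA_le (d := d) (m := m)) (norm_stretch_le hs (cyl X))
        (norm_nonneg _) zero_le_one
      linarith
    have hqb : ∀ X : Amb d m, ‖innerSL ℝ (relPos η ψ (cyl X) z + mollB η ψ (cyl X) z)‖ ≤ 2 * u :=
      fun X => by
        rw [innerSL_apply_norm]
        have h3 := norm_relPos_add_mollB_le hη h hs (cyl X) z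
        have := mul_le_mul_of_nonneg_right hε (show 0 ≤ 1 + 2 * ‖z‖ by positivity)
        simp only [u]; linarith
    have hf : LipOn ((8 * L + 2 * (C * L)) * u ^ 2) f univ := by
      refine LipOn.mono (hq.clmComp hF (fun X _ => hqb X) fun X _ => hFb X) ?_ subset_rfl
      have := mul_le_mul_of_nonneg_left hu4 hCL
      linarith
    have hf0 : ∀ X ∈ (univ : Set (Amb d m)), ‖f X‖ ≤ (8 * L + 2 * (C * L)) * u ^ 2 * ‖X.snd‖ :=
      fun X _ => by
        refine (ContinuousLinearMap.opNorm_comp_le _ _).trans ?_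
        rw [innerSL_apply_norm]
        have h3 := relPos_add_mollB_le hη h (cyl X) (norm_nonneg _) z
        have h4 := mul_le_mul h3 (hFb X) (norm_nonneg _) ((norm_nonneg _).trans h3)
        have h5 : 0 ≤ C * L * u ^ 2 * ‖X.snd‖ := by positivity
        change _ ≤ 4 * L * u ^ 2 * ‖X.snd‖ * 2 at h4
        linarith
    have h3 := LipOn.mul_dirT (fun (l : Eu m →L[ℝ] ℝ) v => l v) zero_le_one (fun x y v => by simp)
      (fun x v v' => by simp) (fun l v => by rw [one_mul]; exact l.le_opNorm v) hf hf0
    exact LipOn.mono h3 (by linarith) subset_rfl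
  have h3 : LipOn (K ^ 2 * (3 * (C * L))) (fun X : Amb d m => (κ * scal η θ β ψ (cyl X)) ^ 2)
      univ := fun X hX Y hY => by
    have h4 := hl.comp hcyl hu hCL X hX Y hY
    rw [mul_one] at h4
    simp only [mul_pow]
    rw [← mul_sub, norm_mul, Real.norm_eq_abs, Real.norm_eq_abs, abs_pow,
      sq_sub_sq, abs_mul, mul_assoc]
    have h5 := abs_add_le (scal η θ β ψ (cyl X)) (scal η θ β ψ (cyl Y))
    have h6 := abs_scal_le hs (cyl X)
    have h7 := abs_scal_le hs (cyl Y)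
    refine mul_le_mul (pow_le_pow_left₀ (abs_nonneg _) hκ 2) ?_ (by positivity) (by positivity)
    rw [mul_assoc]
    exact mul_le_mul (by linarith) h4 (abs_nonneg _) (by norm_num)
  have h4 := (((LipOn.const (‖z‖ ^ 2) (univ : Set (Amb d m))).add h1).add
    ((h2.const_smul hκ).const_smul (show |(2 : ℝ)| ≤ 2 by simp))).add h3
  refine LipOn.mono (LipOn.congr h4 fun X _ => ?_) ?_ subset_rfl
  · rw [distN]
    simp only [smul_eq_mul]
    ring
  · have h5 := mul_le_mul_of_nonneg_left hu2
      (show 0 ≤ 2 * K * (3 * (8 * L + 2 * (C * L))) by positivity)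
    have h6 := mul_le_mul_of_nonneg_left hu3 (show 0 ≤ K ^ 2 * (3 * (C * L)) by positivity)
    linarith

end Bounds

end Distance

end HigherCodim

namespace HigherCodim

/-! ### The rescaled potential of the graph -/

section NearPotential

variable {d m : ℕ}

/-- The decay `(1 + |z|²)^{-(d + β - 1)/2}` is integrable for `β > 1`. -/
lemma integrable_decay {β : ℝ} (hβ : 1 < β) :
    Integrable fun z : Eu d => (1 + ‖z‖ ^ 2) ^ (-(((d : ℝ) + β) / 2 - 1 / 2)) := by
  have h := integrable_rpow_neg_one_add_norm_sq (E := Eu d) (μ := volume) (r := d + β - 1)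
    (by rw [finrank_euclideanSpace_fin]; linarith)
  refine h.congr (Filter.Eventually.of_forall fun z => ?_)
  change (1 + ‖z‖ ^ 2) ^ (-((d : ℝ) + β - 1) / 2) = _
  congr 1
  ring

/-- Varying the weight costs 1 + |z| against N^{-a}, and varying N costs (1 + |z|)³ against
N^{-a-1}. In both cases exactly one power of |z| is lost, that is, a becomes a - 1/2. -/
lemma rpow_neg_mul_pow_le {a : ℝ} (z : Eu d) :
    (1 + ‖z‖ ^ 2) ^ (-a) * (1 + ‖z‖) ≤ 2 * (1 + ‖z‖ ^ 2) ^ (-(a - 1 / 2)) ∧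
      (1 + ‖z‖ ^ 2) ^ (-a - 1) * (1 + ‖z‖) ^ 3 ≤ 8 * (1 + ‖z‖ ^ 2) ^ (-(a - 1 / 2)) := by
  set q := 1 + ‖z‖ ^ 2
  have hq : 0 < q := by positivity
  have h1 : 1 + ‖z‖ ≤ 2 * q ^ (1 / 2 : ℝ) := by
    rw [← Real.sqrt_eq_rpow]
    have h2 : 1 + ‖z‖ ≤ √(4 * q) := by
      refine Real.le_sqrt_of_sq_le ?_
      simp only [q]
      nlinarith [sq_nonneg (1 - ‖z‖)]
    rwa [Real.sqrt_mul (by norm_num), show (4 : ℝ) = 2 ^ 2 by norm_num,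
      Real.sqrt_sq (by norm_num)] at h2
  have h3 : (1 + ‖z‖) ^ 3 ≤ 8 * q ^ (3 / 2 : ℝ) := by
    refine (pow_le_pow_left₀ (by positivity) h1 3).trans (le_of_eq ?_)
    rw [mul_pow, ← Real.rpow_natCast (q ^ _), ← Real.rpow_mul hq.le]
    norm_num
  constructor
  · refine (mul_le_mul_of_nonneg_left h1 (by positivity)).trans (le_of_eq ?_)
    rw [mul_left_comm, ← Real.rpow_add hq]
    congr 2; ring
  · refine (mul_le_mul_of_nonneg_left h3 (by positivity)).trans (le_of_eq ?_)
    rw [mul_left_comm, ← Real.rpow_add hq]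
    congr 2; ring

section Abstract

variable {N : Amb d m → Eu d → ℝ} {w : Eu d → ℝ} {c β C Lw : ℝ}

lemma rpow_neg_le_decay (hc : 0 < c) (hβ : 0 ≤ β) {s : ℝ} {z : Eu d}
    (hs : c * (1 + ‖z‖ ^ 2) ≤ s) : s ^ (-(((d : ℝ) + β) / 2)) ≤
      c ^ (-(((d : ℝ) + β) / 2)) * (1 + ‖z‖ ^ 2) ^ (-(((d : ℝ) + β) / 2)) := by
  rw [← Real.mul_rpow hc.le (by positivity)]
  refine Real.rpow_le_rpow_of_nonpos (by positivity) hs ?_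
  have : 0 ≤ ((d : ℝ) + β) / 2 := by positivity
  linarith

lemma rpow_neg_le_decay' (hc : 0 < c) (hβ : 0 ≤ β) {s : ℝ} {z : Eu d}
    (hs : c * (1 + ‖z‖ ^ 2) ≤ s) : s ^ (-(((d : ℝ) + β) / 2)) ≤
      c ^ (-(((d : ℝ) + β) / 2)) * (1 + ‖z‖ ^ 2) ^ (-(((d : ℝ) + β) / 2 - 1 / 2)) := by
  refine (rpow_neg_le_decay hc hβ hs).trans (mul_le_mul_of_nonneg_left ?_ (by positivity))
  exact Real.rpow_le_rpow_of_exponent_le (by linarith [sq_nonneg ‖z‖]) (by linarith)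

lemma continuous_potential (hc : 0 < c) (hNc : ∀ X, Continuous (N X))
    (hN : ∀ X z, c * (1 + ‖z‖ ^ 2) ≤ N X z) (hw : Continuous w) (X : Amb d m) (a : ℝ) :
    Continuous fun z => N X z ^ a * w (X.fst + ‖X.snd‖ • z) :=
  ((hNc X).rpow_const fun z => Or.inl
    (lt_of_lt_of_le (by positivity) (hN X z)).ne').mul (by fun_prop)

lemma integrable_potential (hβ : 1 < β) (hc : 0 < c) (hNc : ∀ X, Continuous (N X))
    (hN : ∀ X z, c * (1 + ‖z‖ ^ 2) ≤ N X z) (hw : Continuous w) (hw0 : ∀ y, 0 ≤ w y)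
    (hw2 : ∀ y, w y ≤ 2) (X : Amb d m) :
    Integrable fun z => N X z ^ (-(((d : ℝ) + β) / 2)) * w (X.fst + ‖X.snd‖ • z) := by
  refine ((integrable_decay hβ).const_mul (c ^ (-(((d : ℝ) + β) / 2)) * 2)).mono'
    (continuous_potential hc hNc hN hw X _).aestronglyMeasurable
    (Filter.Eventually.of_forall fun z => ?_)
  have hN0 : 0 ≤ N X z := le_trans (by positivity) (hN X z)
  rw [Real.norm_of_nonneg (mul_nonneg (Real.rpow_nonneg hN0 _) (hw0 _))]
  have := mul_le_mul (rpow_neg_le_decay' (β := β) hc (by linarith) (hN X z)) (hw2 (X.fst + ‖X.snd‖ • z))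
    (hw0 _) (by positivity)
  linarith

lemma potential_le (hβ : 1 < β) (hc : 0 < c) (hNc : ∀ X, Continuous (N X))
    (hN : ∀ X z, c * (1 + ‖z‖ ^ 2) ≤ N X z) (hw : Continuous w) (hw0 : ∀ y, 0 ≤ w y)
    (hw2 : ∀ y, w y ≤ 2) (X : Amb d m) :
    ∫ z, N X z ^ (-(((d : ℝ) + β) / 2)) * w (X.fst + ‖X.snd‖ • z) ≤
      c ^ (-(((d : ℝ) + β) / 2)) * 2 *
        ∫ z : Eu d, (1 + ‖z‖ ^ 2) ^ (-(((d : ℝ) + β) / 2 - 1 / 2)) := by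
  rw [← integral_const_mul]
  refine integral_mono (integrable_potential hβ hc hNc hN hw hw0 hw2 X)
    ((integrable_decay hβ).const_mul _) fun z => ?_
  have := mul_le_mul (rpow_neg_le_decay' (β := β) hc (by linarith) (hN X z)) (hw2 (X.fst + ‖X.snd‖ • z))
    (hw0 _) (by positivity)
  change _ ≤ c ^ (-(((d : ℝ) + β) / 2)) * 2 * _
  linarith

/-- After the loss of one power the integrand decays like |z|^{-(d+β-1)}, which is integrable on ℝ^d
because β > 1. -/
lemma lipOn_potential (hβ : 1 < β) (hc : 0 < c) (hC : 0 ≤ C) (hLw : 0 ≤ Lw)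
    (hNc : ∀ X, Continuous (N X)) (hN : ∀ X z, c * (1 + ‖z‖ ^ 2) ≤ N X z)
    (hNl : ∀ z, LipOn (C * (1 + ‖z‖) ^ 3) (fun X => N X z) univ) (hw : Continuous w)
    (hw0 : ∀ y, 0 ≤ w y) (hw2 : ∀ y, w y ≤ 2) (hwl : LipOn Lw w univ) :
    LipOn (∫ z : Eu d, (((d : ℝ) + β) / 2 * c ^ (-(((d : ℝ) + β) / 2) - 1) * C * 16 +
      c ^ (-(((d : ℝ) + β) / 2)) * Lw * 2) * (1 + ‖z‖ ^ 2) ^ (-(((d : ℝ) + β) / 2 - 1 / 2)))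
      (fun X => ∫ z, N X z ^ (-(((d : ℝ) + β) / 2)) * w (X.fst + ‖X.snd‖ • z)) univ := by
  set a := ((d : ℝ) + β) / 2
  have ha : 0 ≤ a := by positivity
  refine LipOn.integral (fun X _ => integrable_potential hβ hc hNc hN hw hw0 hw2 X)
    ((integrable_decay hβ).const_mul _) fun z X _ Y _ => ?_
  set q := 1 + ‖z‖ ^ 2
  have hq : 0 < q := by positivity
  obtain ⟨hd1, hd2⟩ := rpow_neg_mul_pow_le (a := a) z
  have e : N X z ^ (-a) * w (X.fst + ‖X.snd‖ • z) - N Y z ^ (-a) * w (Y.fst + ‖Y.snd‖ • z) =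
      (N X z ^ (-a) - N Y z ^ (-a)) * w (X.fst + ‖X.snd‖ • z) +
      N Y z ^ (-a) * (w (X.fst + ‖X.snd‖ • z) - w (Y.fst + ‖Y.snd‖ • z)) := by ring
  rw [e]
  refine (norm_add_le _ _).trans ?_
  rw [norm_mul, norm_mul, Real.norm_of_nonneg (hw0 _)]
  have h1 : ‖N X z ^ (-a) - N Y z ^ (-a)‖ ≤
      a * c ^ (-a - 1) * C * 8 * q ^ (-(a - 1 / 2)) * ‖X - Y‖ := by
    refine (rpow_neg_sub_le (by positivity) (hN X z) (hN Y z) ha).trans ?_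
    rw [Real.mul_rpow hc.le hq.le]
    have h2 := mul_le_mul_of_nonneg_left (hNl z X (mem_univ _) Y (mem_univ _))
      (show 0 ≤ a * (c ^ (-a - 1) * q ^ (-a - 1)) by positivity)
    have h3 := mul_le_mul_of_nonneg_left hd2
      (show 0 ≤ a * c ^ (-a - 1) * C * ‖X - Y‖ by positivity)
    rw [Real.norm_eq_abs] at h2
    linarith
  have h2 : ‖N Y z ^ (-a)‖ ≤ c ^ (-a) * q ^ (-a) := by
    rw [Real.norm_of_nonneg (Real.rpow_nonneg (le_trans (by positivity) (hN Y z)) _)]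
    exact rpow_neg_le_decay hc (by linarith) (hN Y z)
  have h3 : ‖w (X.fst + ‖X.snd‖ • z) - w (Y.fst + ‖Y.snd‖ • z)‖ ≤
      Lw * ((1 + ‖z‖) * ‖X - Y‖) := by
    refine (hwl _ (mem_univ _) _ (mem_univ _)).trans (mul_le_mul_of_nonneg_left ?_ hLw)
    have e2 : X.fst + ‖X.snd‖ • z - (Y.fst + ‖Y.snd‖ • z) =
        (X.fst - Y.fst) + (‖X.snd‖ - ‖Y.snd‖) • z := by module
    rw [e2]
    refine (norm_add_le _ _).trans ?_
    rw [norm_smul, Real.norm_eq_abs]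
    have h4 : ‖X.fst - Y.fst‖ ≤ ‖X - Y‖ := norm_fst_le (X - Y)
    have h5 : |‖X.snd‖ - ‖Y.snd‖| ≤ ‖X - Y‖ :=
      (abs_norm_sub_norm_le _ _).trans (norm_snd_le (X - Y))
    have h6 := mul_le_mul_of_nonneg_right h5 (norm_nonneg z)
    linarith
  have h4 := mul_le_mul h1 (hw2 (X.fst + ‖X.snd‖ • z)) (hw0 _) (by positivity)
  have h5 := mul_le_mul h2 h3 (norm_nonneg _) (by positivity)
  have h6 := mul_le_mul_of_nonneg_left hd1 (show 0 ≤ c ^ (-a) * Lw * ‖X - Y‖ by positivity)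
  linarith

/-- The part of the potential over the unit ball is bounded from below. -/
lemma le_potential (hβ : 1 < β) (hc : 0 < c) (hNc : ∀ X, Continuous (N X))
    (hN : ∀ X z, c * (1 + ‖z‖ ^ 2) ≤ N X z) (hw : Continuous w) (hw1 : ∀ y, 1 / 2 ≤ w y)
    (hw2 : ∀ y, w y ≤ 2) {b : ℝ} (X : Amb d m) (hb : ∀ z, ‖z‖ ≤ 1 → N X z ≤ b)
    {g : Eu d → ℝ} (hg : Measurable g) (hg0 : ∀ z, 0 ≤ g z) (hg1 : ∀ z, g z ≤ 1)
    (hg2 : ∀ z, ‖z‖ ≤ 1 → g z = 1) :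
    b ^ (-(((d : ℝ) + β) / 2)) * (1 / 2) * (volume (closedBall (0 : Eu d) 1)).toReal ≤
      ∫ z, g z * (N X z ^ (-(((d : ℝ) + β) / 2)) * w (X.fst + ‖X.snd‖ • z)) := by
  set a := ((d : ℝ) + β) / 2
  have ha : 0 ≤ a := by positivity
  have hw0 : ∀ y, 0 ≤ w y := fun y => le_trans (by norm_num) (hw1 y)
  have hi := integrable_potential hβ hc hNc hN hw hw0 hw2 X
  have hN0 : ∀ z, 0 < N X z := fun z => lt_of_lt_of_le (by positivity) (hN X z)
  have hi2 : Integrable fun z => g z * (N X z ^ (-a) * w (X.fst + ‖X.snd‖ • z)) :=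
    hi.bdd_mul (c := 1) hg.aestronglyMeasurable (Filter.Eventually.of_forall fun z => by
      rw [Real.norm_of_nonneg (hg0 z)]; exact hg1 z)
  have hci : Integrable ((closedBall (0 : Eu d) 1).indicator fun _ => b ^ (-a) * (1 / 2)) :=
    (integrable_indicator_iff measurableSet_closedBall).mpr
      (integrableOn_const measure_closedBall_lt_top.ne)
  have e : b ^ (-a) * (1 / 2) * (volume (closedBall (0 : Eu d) 1)).toReal =
      ∫ z, (closedBall (0 : Eu d) 1).indicator (fun _ => b ^ (-a) * (1 / 2)) z := by
    rw [integral_indicator measurableSet_closedBall, setIntegral_const, smul_eq_mul, mul_comm]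
    rfl
  rw [e]
  refine integral_mono hci hi2 fun z => ?_
  by_cases hz : ‖z‖ ≤ 1
  · rw [indicator_of_mem (by simpa using hz)]
    change _ ≤ g z * (N X z ^ (-a) * w (X.fst + ‖X.snd‖ • z))
    rw [hg2 z hz, one_mul]
    exact mul_le_mul (Real.rpow_le_rpow_of_nonpos (hN0 z) (hb z hz) (by linarith)) (hw1 _)
      (by norm_num) (Real.rpow_nonneg (hN0 z).le _)
  · rw [indicator_of_notMem (by simpa using hz)]
    exact mul_nonneg (hg0 z) (mul_nonneg (Real.rpow_nonneg (hN0 z).le _) (hw0 _))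

end Abstract

variable {θ : Amb d m → ℝ} {η : Eu d → ℝ} {ψ : Eu d → Eu m} {ε L β κ : ℝ}

lemma continuous_distN (hη : IsMollifier η) (h : FlatMap ψ ε L) (X : Amb d m) :
    Continuous (distN η θ β κ ψ X) := by
  have := continuous_relPos hη h (cyl X)
  unfold distN
  fun_prop

lemma norm_modelRho_sub_graphMap_rpow (hη : IsMollifier η) (h : FlatMap ψ ε L) {X : Amb d m}
    (hX : X.snd ≠ 0) {z : Eu d} (hN : 0 ≤ distN η θ β κ ψ X z) (s : ℝ) :
    (‖modelRho η θ β κ ψ X - graphMap ψ (X.fst + ‖X.snd‖ • z)‖ ^ s)⁻¹ =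
      ‖X.snd‖ ^ (-s) * distN η θ β κ ψ X z ^ (-(s / 2)) := by
  have h1 := norm_modelRho_sub_graphMap_sq (θ := θ) (β := β) (κ := κ) hη h hX z
  set v := ‖modelRho η θ β κ ψ X - graphMap ψ (X.fst + ‖X.snd‖ • z)‖
  have e : ∀ u : ℝ, 0 ≤ u → u ^ (-s) = (u ^ 2) ^ (-(s / 2)) := fun u hu => by
    rw [← Real.rpow_natCast, ← Real.rpow_mul hu]
    congr 1; push_cast; ring
  rw [← Real.rpow_neg (norm_nonneg _), e _ (norm_nonneg _), h1, Real.mul_rpow (sq_nonneg _) hN,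
    ← e _ (norm_nonneg _)]

/-- The potential of the graph in the rescaled coordinates of `ℝ^d`. -/
lemma rpow_mul_integral_graphSet (hη : IsMollifier η) (h : FlatMap ψ ε L) {X : Amb d m}
    (hX : X.snd ≠ 0) (hN : ∀ z, 0 ≤ distN η θ β κ ψ X z) (g : Amb d m → ℝ) :
    ‖X.snd‖ ^ β * ∫ Y in graphSet ψ, g Y *
        (‖modelRho η θ β κ ψ X - Y‖ ^ ((d : ℝ) + β))⁻¹ ∂μHE[d] =
      ∫ z, g (graphMap ψ (X.fst + ‖X.snd‖ • z)) *
        (distN η θ β κ ψ X z ^ (-(((d : ℝ) + β) / 2)) * areaW ψ (X.fst + ‖X.snd‖ • z)) := by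
  have h0 := norm_pos_iff.mpr hX
  have h1 := integral_comp_add_smul (fun y => areaFactor (fderiv ℝ ψ y) *
    (g (graphMap ψ y) * (‖modelRho η θ β κ ψ X - graphMap ψ y‖ ^ ((d : ℝ) + β))⁻¹)) X.fst h0
  simp_rw [norm_modelRho_sub_graphMap_rpow hη h hX (hN _)] at h1
  have h2 : ∀ v : ℝ, ‖X.snd‖ ^ β * v = ‖X.snd‖ ^ ((d : ℝ) + β) * ((‖X.snd‖ ^ d)⁻¹ • v) := fun v => by
    rw [Real.rpow_add h0, Real.rpow_natCast, smul_eq_mul]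
    field_simp
  rw [integral_graphSet h, h2, ← h1, ← integral_const_mul]
  refine integral_congr_ae (Filter.Eventually.of_forall fun z => ?_)
  have h3 : ‖X.snd‖ ^ ((d : ℝ) + β) * ‖X.snd‖ ^ (-((d : ℝ) + β)) = 1 := by
    rw [← Real.rpow_add h0, add_neg_cancel, Real.rpow_zero]
  change ‖X.snd‖ ^ ((d : ℝ) + β) * (areaW ψ _ * (g _ * (‖X.snd‖ ^ (-((d : ℝ) + β)) * _))) = _
  linear_combination (g (graphMap ψ (X.fst + ‖X.snd‖ • z)) *
        (distN η θ β κ ψ X z ^ (-(((d : ℝ) + β) / 2)) * areaW ψ (X.fst + ‖X.snd‖ • z))) * h3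

lemma integrableOn_graphSet_potential (hη : IsMollifier η) (h : FlatMap ψ ε L) {X : Amb d m}
    (hX : X.snd ≠ 0) (hN : ∀ z, 0 ≤ distN η θ β κ ψ X z)
    (hi : Integrable fun z => distN η θ β κ ψ X z ^ (-(((d : ℝ) + β) / 2)) *
      areaW ψ (X.fst + ‖X.snd‖ • z)) :
    IntegrableOn (fun Y => (‖modelRho η θ β κ ψ X - Y‖ ^ ((d : ℝ) + β))⁻¹) (graphSet ψ)
      μHE[d] := by
  have h0 := norm_pos_iff.mpr hX
  rw [integrableOn_graphSet_iff h]
  set f := fun y => areaFactor (fderiv ℝ ψ y) *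
    (‖modelRho η θ β κ ψ X - graphMap ψ y‖ ^ ((d : ℝ) + β))⁻¹
  have h1 : Integrable fun z => f (X.fst + ‖X.snd‖ • z) := by
    refine (hi.const_mul (‖X.snd‖ ^ (-((d : ℝ) + β)))).congr
      (Filter.Eventually.of_forall fun z => ?_)
    simp only [f]
    rw [norm_modelRho_sub_graphMap_rpow hη h hX (hN _), areaW]
    ring
  have h2 : Integrable fun y => f (X.fst + y) :=
    (integrable_comp_smul_iff volume (fun y => f (X.fst + y)) h0.ne').mp h1
  have h3 := h2.comp_add_left (-X.fst)
  simpa using h3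

end NearPotential

end HigherCodim

namespace HigherCodim

/-! ### The potential of the part of a measure far from the origin -/

section FarPotential

variable {d m : ℕ} {ν : Measure (Amb d m)} {A R b : ℝ}

/-- The bound for the potential of a measure with growth `A ρ^d` outside of the ball of radius `R`. -/
noncomputable def farBound (d : ℕ) (A R b : ℝ) : ℝ :=
  A * 2 ^ d * R ^ (-b) * (1 - 2 ^ (-b))⁻¹

lemma two_rpow_neg_lt_one (hb : 0 < b) : (2 : ℝ) ^ (-b) < 1 :=
  Real.rpow_lt_one_of_one_lt_of_neg one_lt_two (by linarith)

lemma farBound_nonneg (hA : 0 ≤ A) (hR : 0 ≤ R) (hb : 0 < b) : 0 ≤ farBound d A R b := by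
  have := two_rpow_neg_lt_one hb
  have : 0 ≤ (1 - (2 : ℝ) ^ (-b))⁻¹ := inv_nonneg.mpr (by linarith)
  unfold farBound
  positivity

/-- Dyadic decomposition: where 2^k R ≤ |Y| < 2^{k+1}R the kernel is at most (2^k R)^{-d-b} and the
mass at most A(2^{k+1}R)^d, which gives a geometric series of ratio 2^{-b}. -/
lemma lintegral_far_le (hA : 0 ≤ A) (hR : 0 < R) (hb : 0 < b)
    (hν : ∀ ρ, 0 < ρ → ν (ball 0 ρ) ≤ ENNReal.ofReal (A * ρ ^ d)) :
    ∫⁻ Y in (ball (0 : Amb d m) R)ᶜ, ENNReal.ofReal (‖Y‖ ^ (-((d : ℝ) + b))) ∂ν ≤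
      ENNReal.ofReal (farBound d A R b) := by
  set s : ℝ := (d : ℝ) + b
  have hs : 0 < s := by positivity
  set F : ℕ → Amb d m → ENNReal := fun k => (ball (0 : Amb d m) (2 ^ (k + 1) * R)).indicator
    fun _ => ENNReal.ofReal ((2 ^ k * R) ^ (-s))
  have hpt : ∀ Y ∈ (ball (0 : Amb d m) R)ᶜ, ENNReal.ofReal (‖Y‖ ^ (-s)) ≤ ∑' k, F k Y := by
    intro Y hY
    have hY' : R ≤ ‖Y‖ := by simpa using hY
    obtain ⟨k, hk1, hk2⟩ := exists_nat_pow_near ((one_le_div hR).mpr hY') (one_lt_two (α := ℝ))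
    rw [le_div_iff₀ hR] at hk1
    rw [div_lt_iff₀ hR] at hk2
    refine le_trans ?_ (ENNReal.le_tsum k)
    simp only [F]
    rw [indicator_of_mem (by simpa using hk2)]
    exact ENNReal.ofReal_le_ofReal
      (Real.rpow_le_rpow_of_nonpos (by positivity) hk1 (by linarith))
  refine (setLIntegral_mono' measurableSet_ball.compl hpt).trans ?_
  refine (lintegral_mono' Measure.restrict_le_self le_rfl).trans ?_
  rw [lintegral_tsum fun k => (measurable_const.indicator measurableSet_ball).aemeasurable]
  have hterm : ∀ k, ∫⁻ Y, F k Y ∂ν ≤ ENNReal.ofReal (A * 2 ^ d * R ^ (-b) * (2 ^ (-b)) ^ k) := by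
    intro k
    simp only [F]
    rw [lintegral_indicator_const measurableSet_ball]
    refine (mul_le_mul_right (hν _ (by positivity)) _).trans ?_
    rw [← ENNReal.ofReal_mul (by positivity)]
    refine ENNReal.ofReal_le_ofReal (le_of_eq ?_)
    have h1 : (2 ^ k * R) ^ (-s) = ((2 ^ k * R) ^ d)⁻¹ * ((2 ^ k * R) ^ (-b)) := by
      rw [← Real.rpow_natCast (2 ^ k * R) d, ← Real.rpow_neg (by positivity),
        ← Real.rpow_add (by positivity)]
      congr 1; simp only [s]; ring
    have h2 : (2 ^ k * R) ^ (-b) = (2 ^ (-b)) ^ k * R ^ (-b) := by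
      rw [Real.mul_rpow (by positivity) hR.le, ← Real.rpow_natCast 2 k, ← Real.rpow_mul (by norm_num),
        ← Real.rpow_natCast _ k, ← Real.rpow_mul (by norm_num), mul_comm (k : ℝ)]
    have h3 : (2 ^ (k + 1) * R) ^ d = 2 ^ d * (2 ^ k * R) ^ d := by rw [← mul_pow]; ring
    have h4 : (2 ^ k * R) ^ d ≠ 0 := by positivity
    rw [h1, h2, h3]
    generalize (2 ^ k * R) ^ d = u at h4
    field_simp
  refine (ENNReal.tsum_le_tsum hterm).trans (le_of_eq ?_)
  have hq0 : (0 : ℝ) ≤ 2 ^ (-b) := by positivity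
  have hq1 := two_rpow_neg_lt_one hb
  rw [← ENNReal.ofReal_tsum_of_nonneg (fun k => by positivity)
    ((summable_geometric_of_lt_one hq0 hq1).mul_left _), tsum_mul_left,
    tsum_geometric_of_lt_one hq0 hq1, farBound]

lemma integrableOn_far (hA : 0 ≤ A) (hR : 0 < R) (hb : 0 < b)
    (hν : ∀ ρ, 0 < ρ → ν (ball 0 ρ) ≤ ENNReal.ofReal (A * ρ ^ d)) :
    IntegrableOn (fun Y : Amb d m => ‖Y‖ ^ (-((d : ℝ) + b))) (ball 0 R)ᶜ ν ∧
      ∫ Y in (ball (0 : Amb d m) R)ᶜ, ‖Y‖ ^ (-((d : ℝ) + b)) ∂ν ≤ farBound d A R b := by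
  have h1 := lintegral_far_le (m := m) hA hR hb hν
  have hm : AEStronglyMeasurable (fun Y : Amb d m => ‖Y‖ ^ (-((d : ℝ) + b)))
      (ν.restrict (ball 0 R)ᶜ) := by
    have : Measurable fun Y : Amb d m => ‖Y‖ ^ (-((d : ℝ) + b)) := by fun_prop
    exact this.aestronglyMeasurable
  have h0 : ∀ Y : Amb d m, 0 ≤ ‖Y‖ ^ (-((d : ℝ) + b)) := fun Y => by positivity
  constructor
  · refine ⟨hm, ?_⟩
    rw [hasFiniteIntegral_iff_ofReal (Filter.Eventually.of_forall h0)]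
    exact h1.trans_lt ENNReal.ofReal_lt_top
  · rw [integral_eq_lintegral_of_nonneg_ae (Filter.Eventually.of_forall h0) hm]
    exact ENNReal.toReal_le_of_le_ofReal (farBound_nonneg hA hR.le hb) h1

/-- The potential of the part of the measure outside of the ball of radius `R`. -/
noncomputable def farPot (β : ℝ) (ν : Measure (Amb d m)) (R : ℝ) (P : Amb d m) : ℝ :=
  ∫ Y in (ball (0 : Amb d m) R)ᶜ, (‖P - Y‖ ^ ((d : ℝ) + β))⁻¹ ∂ν

lemma half_norm_le {P Y : Amb d m} (hP : ‖P‖ ≤ R / 2) (hY : Y ∈ (ball (0 : Amb d m) R)ᶜ) :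
    ‖Y‖ / 2 ≤ ‖P - Y‖ := by
  have hY' : R ≤ ‖Y‖ := by simpa using hY
  have := norm_sub_norm_le Y P
  rw [norm_sub_rev] at this
  linarith

lemma far_kernel_le (hR : 0 < R) (hb : 0 < b) {P Y : Amb d m} (hP : ‖P‖ ≤ R / 2)
    (hY : Y ∈ (ball (0 : Amb d m) R)ᶜ) :
    (‖P - Y‖ ^ ((d : ℝ) + b))⁻¹ ≤ 2 ^ ((d : ℝ) + b) * ‖Y‖ ^ (-((d : ℝ) + b)) := by
  have hY' : R ≤ ‖Y‖ := by simpa using hY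
  have hY0 : 0 < ‖Y‖ := by linarith
  have hs : 0 < (d : ℝ) + b := by positivity
  rw [← Real.rpow_neg (norm_nonneg _)]
  refine (Real.rpow_le_rpow_of_nonpos (by positivity) (half_norm_le hP hY) (by linarith)).trans
    (le_of_eq ?_)
  rw [Real.div_rpow hY0.le (by norm_num), Real.rpow_neg (by norm_num : (0 : ℝ) ≤ 2), div_inv_eq_mul,
    mul_comm]

lemma integrableOn_far_kernel (hA : 0 ≤ A) (hR : 0 < R) (hb : 0 < b)
    (hν : ∀ ρ, 0 < ρ → ν (ball 0 ρ) ≤ ENNReal.ofReal (A * ρ ^ d)) {P : Amb d m}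
    (hP : ‖P‖ ≤ R / 2) :
    IntegrableOn (fun Y => (‖P - Y‖ ^ ((d : ℝ) + b))⁻¹) (ball 0 R)ᶜ ν := by
  have hm : Measurable fun Y : Amb d m => (‖P - Y‖ ^ ((d : ℝ) + b))⁻¹ := by fun_prop
  refine ((integrableOn_far hA hR hb hν).1.const_mul (2 ^ ((d : ℝ) + b))).mono'
    hm.aestronglyMeasurable ?_
  refine (ae_restrict_mem measurableSet_ball.compl).mono fun Y hY => ?_
  rw [Real.norm_of_nonneg (by positivity)]
  exact far_kernel_le hR hb hP hY

lemma farPot_nonneg (β : ℝ) (P : Amb d m) : 0 ≤ farPot β ν R P :=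
  integral_nonneg fun Y => by positivity

lemma farPot_le (hA : 0 ≤ A) (hR : 0 < R) (hb : 0 < b)
    (hν : ∀ ρ, 0 < ρ → ν (ball 0 ρ) ≤ ENNReal.ofReal (A * ρ ^ d)) {P : Amb d m}
    (hP : ‖P‖ ≤ R / 2) : farPot b ν R P ≤ 2 ^ ((d : ℝ) + b) * farBound d A R b := by
  obtain ⟨h1, h2⟩ := integrableOn_far hA hR hb hν
  refine le_trans ?_ (mul_le_mul_of_nonneg_left h2 (by positivity))
  rw [← integral_const_mul]
  exact setIntegral_mono_on (integrableOn_far_kernel hA hR hb hν hP) (h1.const_mul _)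
    measurableSet_ball.compl fun Y hY => far_kernel_le hR hb hP hY

/-- The mean value theorem costs one more negative power of |Y|, so the growth bound is used with
exponent b + 1. -/
lemma lipOn_farPot (hA : 0 ≤ A) (hR : 0 < R) (hb : 0 < b)
    (hν : ∀ ρ, 0 < ρ → ν (ball 0 ρ) ≤ ENNReal.ofReal (A * ρ ^ d)) :
    LipOn (((d : ℝ) + b) * 2 ^ ((d : ℝ) + b + 1) * farBound d A R (b + 1)) (farPot b ν R)
      (closedBall 0 (R / 2)) := fun P hP P' hP' => by
  rw [mem_closedBall_zero_iff] at hP hP'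
  have hs : 0 < (d : ℝ) + b := by positivity
  obtain ⟨h1, h2⟩ := integrableOn_far (b := b + 1) hA hR (by linarith) hν
  rw [farPot, farPot, ← integral_sub (integrableOn_far_kernel hA hR hb hν hP)
    (integrableOn_far_kernel hA hR hb hν hP')]
  have h3 : ∀ Y ∈ (ball (0 : Amb d m) R)ᶜ,
      ‖(‖P - Y‖ ^ ((d : ℝ) + b))⁻¹ - (‖P' - Y‖ ^ ((d : ℝ) + b))⁻¹‖ ≤
      ((d : ℝ) + b) * 2 ^ ((d : ℝ) + b + 1) * ‖P - P'‖ * ‖Y‖ ^ (-((d : ℝ) + (b + 1))) := by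
    intro Y hY
    have hY' : R ≤ ‖Y‖ := by simpa using hY
    have hY0 : 0 < ‖Y‖ := by linarith
    rw [← Real.rpow_neg (norm_nonneg _), ← Real.rpow_neg (norm_nonneg _)]
    refine (rpow_neg_sub_le (half_pos hY0) (half_norm_le hP hY) (half_norm_le hP' hY) hs.le).trans ?_
    have h4 : |‖P - Y‖ - ‖P' - Y‖| ≤ ‖P - P'‖ := by
      refine (abs_norm_sub_norm_le _ _).trans (le_of_eq ?_)
      rw [sub_sub_sub_cancel_right]
    have h5 : (‖Y‖ / 2) ^ (-((d : ℝ) + b) - 1) =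
        2 ^ ((d : ℝ) + b + 1) * ‖Y‖ ^ (-((d : ℝ) + (b + 1))) := by
      rw [show -((d : ℝ) + b) - 1 = -((d : ℝ) + b + 1) by ring,
        Real.div_rpow hY0.le (by norm_num), Real.rpow_neg (by norm_num : (0 : ℝ) ≤ 2),
        div_inv_eq_mul, mul_comm, add_assoc]
    rw [h5]
    have := mul_le_mul_of_nonneg_left h4
      (show 0 ≤ ((d : ℝ) + b) * (2 ^ ((d : ℝ) + b + 1) * ‖Y‖ ^ (-((d : ℝ) + (b + 1)))) by positivity)
    linarith
  refine (norm_integral_le_of_norm_le (h1.const_mul _)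
    ((ae_restrict_mem measurableSet_ball.compl).mono h3)).trans ?_
  rw [integral_const_mul]
  have := mul_le_mul_of_nonneg_left h2
    (show 0 ≤ ((d : ℝ) + b) * 2 ^ ((d : ℝ) + b + 1) * ‖P - P'‖ by positivity)
  linarith

lemma rpow_sub_le_of_le_one {s t β : ℝ} (hs0 : 0 ≤ s) (hs : s ≤ 1) (ht0 : 0 ≤ t) (ht : t ≤ 1)
    (hβ : 1 ≤ β) : |s ^ β - t ^ β| ≤ β * |s - t| := by
  have := (convex_Icc (0 : ℝ) 1).norm_image_sub_le_of_norm_hasDerivWithin_le (C := β)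
    (f := fun s : ℝ => s ^ β) (f' := fun s => β * s ^ (β - 1)) (fun s _ =>
      (Real.hasDerivAt_rpow_const (Or.inr hβ)).hasDerivWithinAt)
    (fun s hs => by
      rw [Real.norm_of_nonneg (mul_nonneg (by linarith) (Real.rpow_nonneg hs.1 _))]
      exact mul_le_of_le_one_right (by linarith) (Real.rpow_le_one hs.1 hs.2 (by linarith)))
    (show t ∈ Icc (0 : ℝ) 1 from ⟨ht0, ht⟩) (show s ∈ Icc (0 : ℝ) 1 from ⟨hs0, hs⟩)
  simpa using this

/-- The measure of balls centred at the origin for the graph of `ψ`. -/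
lemma graphSet_growth {ψ : Eu d → Eu m} {ε L : ℝ} (h : FlatMap ψ ε L) (hε : ε ≤ 1) {ρ : ℝ}
    (hρ : 0 < ρ) : (μHE[d] : Measure (Amb d m)).restrict (graphSet ψ) (ball 0 ρ) ≤
      ENNReal.ofReal (2 ^ d * (volume (ball (0 : Eu d) 1)).toReal * ρ ^ d) := by
  rw [Measure.restrict_apply measurableSet_ball]
  have e : ball (0 : Amb d m) ρ ∩ graphSet ψ ⊆ graphMap ψ '' ball 0 ρ := by
    rintro _ ⟨hY, y, rfl⟩
    refine ⟨y, ?_, rfl⟩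
    rw [mem_ball_zero_iff] at hY ⊢
    exact (norm_le_norm_pt y (ψ y)).trans_lt hY
  refine (measure_mono e).trans ?_
  rw [← graphMeasure_apply h]
  refine (graphMeasure_le h _).trans ?_
  rw [Measure.addHaar_ball_of_pos volume _ hρ, finrank_euclideanSpace_fin, mul_assoc,
    ENNReal.ofReal_mul (by positivity), ENNReal.ofReal_mul ENNReal.toReal_nonneg,
    ENNReal.ofReal_toReal measure_ball_lt_top.ne, ENNReal.ofReal_pow (p := 2) (by norm_num),
    mul_comm (volume _)]
  have := h.eps_nonneg
  gcongr
  linarith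

end FarPotential

end HigherCodim

namespace HigherCodim

/-! ### Comparison of Γ with the model graph -/

section Model

variable {d m : ℕ}

/-- The set `S` coincides in the ball of radius `R` with the graph of the flat function `ψ`, and
the parameters are such that the change of variables is well behaved in the ball of radius `r₀`. -/
structure LocalModel (η : Eu d → ℝ) (θ : Amb d m → ℝ) (β κ K : ℝ) (ψ : Eu d → Eu m)
    (S : Set (Amb d m)) (ε L C A R r₀ : ℝ) : Prop where
  mollifier : IsMollifier η
  flat : FlatMap ψ ε L
  zero : ψ 0 = 0
  one_lt : 1 < β
  one_le : 1 ≤ K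
  le_stretch : K⁻¹ ≤ κ
  stretch_le : κ ≤ K
  const_nonneg : 0 ≤ C
  ratio : ∀ p, lamT η θ ψ p / lam0 θ ∈ Icc (1 / 2 : ℝ) (3 / 2)
  small : ε * (96 * K ^ 3) ≤ 1
  small' : (2 + 2 * K * C) * ε ≤ (2 * K)⁻¹
  scal_near : ∀ p, |scal η θ β ψ p - 1| ≤ 1 / 2
  scal_lip : LipOn (C * L) (scal η θ β ψ) univ
  stretch_near : ∀ p, ‖stretch η θ β ψ p - inrL d m‖ ≤ C * ε
  stretch_lip : LipOn (C * L) (stretch η θ β ψ) univ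
  area_near : ∀ y, |areaW ψ y - 1| ≤ 1 / 2
  area_lip : LipOn (C * L) (areaW ψ) univ
  radius_pos : 0 < r₀
  radius_le_one : r₀ ≤ 1
  radius_small : L * r₀ ≤ ε
  radius_le : 8 * K * r₀ ≤ R
  graph : ball 0 R ∩ S = ball 0 R ∩ graphSet ψ
  growth_nonneg : 0 ≤ A
  growth : ∀ ρ, 0 < ρ → (μHE[d] : Measure (Amb d m)).restrict S (ball 0 ρ) ≤
    ENNReal.ofReal (A * ρ ^ d)

namespace LocalModel

variable {η : Eu d → ℝ} {θ : Amb d m → ℝ} {β κ K : ℝ} {ψ : Eu d → Eu m} {S : Set (Amb d m)}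
  {ε L C A R r₀ : ℝ} (H : LocalModel η θ β κ K ψ S ε L C A R r₀)

include H

lemma K_pos : 0 < K := by linarith [H.one_le]

lemma stretch_nonneg : 0 ≤ κ := (inv_pos.mpr H.K_pos).le.trans H.le_stretch

lemma abs_stretch_le : |κ| ≤ K := by rw [abs_of_nonneg H.stretch_nonneg]; exact H.stretch_le

lemma R_pos : 0 < R := by
  have := mul_pos H.K_pos H.radius_pos
  linarith [H.radius_le]

lemma eps_le_one : ε ≤ 1 := by
  have h1 : 1 ≤ K ^ 3 := one_le_pow₀ H.one_le
  have := mul_le_mul_of_nonneg_left h1 H.flat.eps_nonneg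
  linarith [H.small, H.flat.eps_nonneg]

lemma eight_mul_le : 8 * r₀ ≤ R := by
  have := mul_le_mul_of_nonneg_right H.one_le H.radius_pos.le
  linarith [H.radius_le]

lemma ball_subset_tube : ball (0 : Amb d m) r₀ ⊆ tube d m r₀ := fun X hX =>
  (norm_snd_le X).trans_lt (mem_ball_zero_iff.mp hX)

lemma tube_subset : tube d m r₀ ⊆ tube d m 1 := fun _ hX => lt_of_lt_of_le hX H.radius_le_one

lemma norm_psi_le (y : Eu d) : ‖ψ y‖ ≤ ‖y‖ := by
  have h1 := H.flat.norm_sub_le y 0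
  rw [H.zero, sub_zero, sub_zero] at h1
  exact h1.trans (mul_le_of_le_one_left (norm_nonneg _) H.eps_le_one)

lemma graphMap_mem {X : Amb d m} (hX : X ∈ ball (0 : Amb d m) r₀) {z : Eu d} (hz : ‖z‖ ≤ 1) :
    graphMap ψ (X.fst + ‖X.snd‖ • z) ∈ ball (0 : Amb d m) R := by
  rw [mem_ball_zero_iff] at hX ⊢
  have h1 : ‖X.fst + ‖X.snd‖ • z‖ ≤ 2 * ‖X‖ := by
    refine (norm_add_le _ _).trans ?_
    rw [norm_smul, norm_norm]
    have := mul_le_mul (norm_snd_le X) hz (norm_nonneg _) (norm_nonneg _)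
    linarith [norm_fst_le X]
  refine (norm_pt_le _ _).trans_lt ?_
  linarith [H.norm_psi_le (X.fst + ‖X.snd‖ • z), H.eight_mul_le, norm_nonneg X]

lemma modelRho_zero : modelRho η θ β κ ψ 0 = 0 := by
  have h1 : phiS η ψ 0 0 = 0 := by simp [phiS, H.zero]
  have h2 : modelRho η θ β κ ψ 0 = pt 0 (phiS η ψ ‖(0 : Eu m)‖ 0) +
    κ • stretch η θ β ψ (cyl 0) 0 := rfl
  rw [h2, norm_zero, h1, map_zero, smul_zero, add_zero]
  rfl

lemma lipOn_modelRho_sub : LipOn ((2 + 2 * K * C) * ε)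
    (fun X => modelRho η θ β κ ψ X - flatD d m κ X) (tube d m r₀) :=
  HigherCodim.lipOn_modelRho_sub H.mollifier H.flat H.const_nonneg H.stretch_near H.stretch_lip
    H.abs_stretch_le H.radius_small

lemma bilipschitz {X Y : Amb d m} (hX : X ∈ tube d m r₀) (hY : Y ∈ tube d m r₀) :
    ‖modelRho η θ β κ ψ X - modelRho η θ β κ ψ Y‖ ≤ 2 * K * ‖X - Y‖ ∧
      ‖X - Y‖ ≤ 2 * K * ‖modelRho η θ β κ ψ X - modelRho η θ β κ ψ Y‖ :=
  bilipschitz_modelRho H.one_le H.le_stretch H.stretch_le H.lipOn_modelRho_sub H.small' hX hY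

/-- Half of the radius R is kept in reserve, so that the part of `S` outside B_R stays far from the
image and its kernel is not singular there. -/
lemma norm_modelRho_le {X : Amb d m} (hX : X ∈ ball (0 : Amb d m) r₀) :
    ‖modelRho η θ β κ ψ X‖ ≤ R / 2 := by
  have h1 := (H.bilipschitz (H.ball_subset_tube hX)
    (H.ball_subset_tube (mem_ball_self H.radius_pos))).1
  rw [H.modelRho_zero, sub_zero, sub_zero] at h1
  rw [mem_ball_zero_iff] at hX
  have := mul_le_mul_of_nonneg_left hX.le H.K_pos.le
  linarith [H.radius_le, mul_pos H.K_pos H.radius_pos]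

lemma modelDeriv_bounds {X : Amb d m} (hX : X ∈ tube d m r₀) :
    ‖modelDeriv η θ β κ ψ X‖ ≤ 2 * K ∧ ∀ v, ‖v‖ ≤ 2 * K * ‖modelDeriv η θ β κ ψ X v‖ := by
  have h1 : LipOn ((2 + 2 * K * C) * ε)
      (fun v => modelDeriv η θ β κ ψ X v - flatD d m κ v) univ := fun v _ w _ => by
    have h2 := norm_modelDeriv_sub_le H.mollifier H.flat H.const_nonneg H.stretch_near
      H.stretch_lip H.abs_stretch_le H.radius_small hX
    have := ContinuousLinearMap.le_of_opNorm_le _ h2 (v - w)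
    rw [_root_.sub_apply, map_sub, map_sub] at this
    rwa [sub_sub_sub_comm] at this
  have h2 := fun v : Amb d m => bilipschitz_modelRho H.one_le H.le_stretch H.stretch_le h1 H.small'
    (mem_univ v) (mem_univ 0)
  simp only [map_zero, sub_zero] at h2
  exact ⟨ContinuousLinearMap.opNorm_le_bound _ (by linarith [H.K_pos]) fun v => (h2 v).1,
    fun v => (h2 v).2⟩

/-- The cut-off θ sees only points within |t| of Φ_r(x). These lie in B_R, where `S` and the graph
coincide. -/
lemma density_eq {a₀ : ℝ} (hθ : IsCutoff θ) {X : Amb d m} (hX : X ∈ ball (0 : Amb d m) r₀)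
    (h0 : X.snd ≠ 0) :
    density η θ a₀ S ψ X.fst ‖X.snd‖ = density η θ a₀ (graphSet ψ) ψ X.fst ‖X.snd‖ := by
  have hr := norm_pos_iff.mpr h0
  set f : Amb d m → ℝ := fun Y => θ (‖X.snd‖⁻¹ • (PhiS η ψ ‖X.snd‖ X.fst - Y))
  have hf : f = (ball (0 : Amb d m) R).indicator f := by
    refine (indicator_eq_self.mpr fun Y hY => ?_).symm
    by_contra hYR
    refine hY (hθ.off ?_)
    rw [norm_smul, norm_inv, norm_norm, le_inv_mul_iff₀ hr, mul_one]
    rw [mem_ball_zero_iff, not_lt] at hYR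
    rw [mem_ball_zero_iff] at hX
    have h1 : ‖phiS η ψ ‖X.snd‖ X.fst‖ ≤ ‖X.fst‖ + ‖X.snd‖ :=
      H.mollifier.norm_integral_le fun z hz => by
        refine (H.norm_psi_le _).trans ((norm_sub_le _ _).trans ?_)
        rw [norm_smul, norm_norm]
        have := mul_le_mul_of_nonneg_left hz (norm_nonneg X.snd)
        linarith
    have h2 := norm_pt_le X.fst (phiS η ψ ‖X.snd‖ X.fst)
    have h3 := norm_sub_norm_le Y (PhiS η ψ ‖X.snd‖ X.fst)
    rw [norm_sub_rev] at h3
    change ‖PhiS η ψ ‖X.snd‖ X.fst‖ ≤ _ at h2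
    linarith [norm_fst_le X, norm_snd_le X, H.eight_mul_le, norm_nonneg X]
  have h1 : ∀ T : Set (Amb d m), ∫ Y in T, f Y ∂μHE[d] = ∫ Y in ball 0 R ∩ T, f Y ∂μHE[d] :=
    fun T => by
      rw [inter_comm]
      conv_lhs => rw [hf]
      exact setIntegral_indicator measurableSet_ball
  rw [density, density]
  change _ * ∫ Y in S, f Y ∂μHE[d] = _ * ∫ Y in graphSet ψ, f Y ∂μHE[d]
  rw [h1, H.graph, ← h1]

lemma rho_eq {a₀ : ℝ} (hθ : IsCutoff θ) (ha : 0 < a₀) (hκ : flatStretch θ a₀ β = κ) {X : Amb d m}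
    (hX : X ∈ ball (0 : Amb d m) r₀) : rho η θ a₀ β S ψ X = modelRho η θ β κ ψ X := by
  rw [← hκ, ← rho_graph_eq H.mollifier hθ H.flat ha, rho, rho]
  by_cases h0 : X.snd = 0
  · have : rot η ψ X.fst ‖X.snd‖ (pt 0 X.snd) = 0 := by
      rw [rot_eq H.mollifier H.flat, h0, map_zero]
    rw [this, smul_zero, smul_zero]
  · rw [hFun, hFun, H.density_eq hθ hX h0]

lemma le_distN (X : Amb d m) (z : Eu d) :
    (8 * K ^ 2)⁻¹ * (1 + ‖z‖ ^ 2) ≤ distN η θ β κ ψ X z :=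
  HigherCodim.le_distN H.mollifier H.flat H.scal_near H.one_le H.le_stretch H.stretch_le H.small X z

lemma distN_nonneg (X : Amb d m) (z : Eu d) : 0 ≤ distN η θ β κ ψ X z :=
  le_trans (by positivity) (H.le_distN X z)

lemma coeff_pos : 0 < (8 * K ^ 2)⁻¹ := by have := H.K_pos; positivity

lemma half_le_areaW (y : Eu d) : 1 / 2 ≤ areaW ψ y := by linarith [(abs_le.mp (H.area_near y)).1]

lemma areaW_le_two (y : Eu d) : areaW ψ y ≤ 2 := by linarith [(abs_le.mp (H.area_near y)).2]

lemma continuous_areaW : Continuous (areaW ψ) := continuousOn_univ.mp H.area_lip.continuousOn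

/-- The potential of the graph, multiplied by `|t|^β`. -/
lemma integrable_near (X : Amb d m) :
    Integrable fun z => distN η θ β κ ψ X z ^ (-(((d : ℝ) + β) / 2)) *
      areaW ψ (X.fst + ‖X.snd‖ • z) :=
  integrable_potential H.one_lt H.coeff_pos (continuous_distN H.mollifier H.flat) H.le_distN
    H.continuous_areaW (areaW_nonneg ψ) H.areaW_le_two X

end LocalModel

/-- The potential of the graph of `ψ` at `modelRho X`, multiplied by `|t|^β`. -/
noncomputable def nearPot (η : Eu d → ℝ) (θ : Amb d m → ℝ) (β κ : ℝ) (ψ : Eu d → Eu m)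
    (X : Amb d m) : ℝ :=
  ∫ z, distN η θ β κ ψ X z ^ (-(((d : ℝ) + β) / 2)) * areaW ψ (X.fst + ‖X.snd‖ • z)

/-- The potential of `S` at `modelRho X`, multiplied by `|t|^β` and extended to `t = 0`. -/
noncomputable def totPot (η : Eu d → ℝ) (θ : Amb d m → ℝ) (β κ : ℝ) (ψ : Eu d → Eu m)
    (S : Set (Amb d m)) (R : ℝ) (X : Amb d m) : ℝ :=
  nearPot η θ β κ ψ X + ‖X.snd‖ ^ β *
    (farPot β ((μHE[d] : Measure (Amb d m)).restrict S) R (modelRho η θ β κ ψ X) -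
      farPot β ((μHE[d] : Measure (Amb d m)).restrict (graphSet ψ)) R (modelRho η θ β κ ψ X))

/-- The growth constant of graphs of flat functions. -/
noncomputable def graphGrowth (d : ℕ) : ℝ := 2 ^ d * (volume (ball (0 : Eu d) 1)).toReal

lemma graphGrowth_nonneg (d : ℕ) : 0 ≤ graphGrowth d :=
  mul_nonneg (by positivity) ENNReal.toReal_nonneg

/-- The lower bound for the potential. -/
noncomputable def potLow (d : ℕ) (K β : ℝ) : ℝ :=
  (20 * K ^ 2) ^ (-(((d : ℝ) + β) / 2)) * (1 / 2) * (volume (closedBall (0 : Eu d) 1)).toReal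

lemma potLow_pos (d : ℕ) {K : ℝ} (hK : 0 < K) (β : ℝ) : 0 < potLow d K β :=
  mul_pos (by positivity) (ENNReal.toReal_pos volume_closedBall_pos.ne' volume_closedBall_ne_top)

/-- The upper bound for the potential of the graph. -/
noncomputable def potHigh (d : ℕ) (K β : ℝ) : ℝ :=
  (8 * K ^ 2)⁻¹ ^ (-(((d : ℝ) + β) / 2)) * 2 *
    ∫ z : Eu d, (1 + ‖z‖ ^ 2) ^ (-(((d : ℝ) + β) / 2 - 1 / 2))

/-- The bound for the contribution of the points outside of the ball of radius one. -/
noncomputable def potFar (d : ℕ) (A β : ℝ) : ℝ := 2 ^ ((d : ℝ) + β) * farBound d A 1 β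

namespace LocalModel

variable {η : Eu d → ℝ} {θ : Amb d m → ℝ} {β κ K : ℝ} {ψ : Eu d → Eu m} {S : Set (Amb d m)}
  {ε L C A R r₀ : ℝ} (H : LocalModel η θ β κ K ψ S ε L C A R r₀)

include H

lemma beta_pos : 0 < β := by linarith [H.one_lt]

lemma graph_growth (ρ : ℝ) (hρ : 0 < ρ) :
    (μHE[d] : Measure (Amb d m)).restrict (graphSet ψ) (ball 0 ρ) ≤
      ENNReal.ofReal (graphGrowth d * ρ ^ d) := graphSet_growth H.flat H.eps_le_one hρ

lemma integrable_pot {X : Amb d m} (hX : X ∈ ball (0 : Amb d m) r₀) (h0 : X.snd ≠ 0) :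
    IntegrableOn (fun Y => (‖modelRho η θ β κ ψ X - Y‖ ^ ((d : ℝ) + β))⁻¹) (graphSet ψ) μHE[d] ∧
    IntegrableOn (fun Y => (‖modelRho η θ β κ ψ X - Y‖ ^ ((d : ℝ) + β))⁻¹) S μHE[d] := by
  have h1 := integrableOn_graphSet_potential H.mollifier H.flat h0 (H.distN_nonneg X)
    (H.integrable_near X)
  refine ⟨h1, ?_⟩
  have h2 := integrableOn_far_kernel H.growth_nonneg H.R_pos H.beta_pos H.growth
    (H.norm_modelRho_le hX)
  rw [IntegrableOn, ← integrableOn_univ, ← union_compl_self (ball (0 : Amb d m) R),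
    integrableOn_union]
  refine ⟨?_, h2⟩
  rw [IntegrableOn, Measure.restrict_restrict measurableSet_ball, H.graph]
  exact IntegrableOn.mono_set h1 inter_subset_right

lemma setIntegral_ball_eq (f : Amb d m → ℝ) :
    ∫ Y in ball 0 R, f Y ∂((μHE[d] : Measure (Amb d m)).restrict S) =
      ∫ Y in ball 0 R, f Y ∂((μHE[d] : Measure (Amb d m)).restrict (graphSet ψ)) := by
  rw [Measure.restrict_restrict measurableSet_ball, Measure.restrict_restrict measurableSet_ball,
    H.graph]

/-- Inside B_R the two potentials agree, so replacing `S` by the graph costs only the difference of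
the far parts. -/
lemma mul_integral_eq_totPot {X : Amb d m} (hX : X ∈ ball (0 : Amb d m) r₀) (h0 : X.snd ≠ 0) :
    ‖X.snd‖ ^ β * ∫ Y in S, (‖modelRho η θ β κ ψ X - Y‖ ^ ((d : ℝ) + β))⁻¹ ∂μHE[d] =
      totPot η θ β κ ψ S R X := by
  obtain ⟨h1, h2⟩ := H.integrable_pot hX h0
  have e1 := integral_add_compl measurableSet_ball (s := ball (0 : Amb d m) R) h1
  have e2 := integral_add_compl measurableSet_ball (s := ball (0 : Amb d m) R) h2
  have e3 := rpow_mul_integral_graphSet H.mollifier H.flat h0 (H.distN_nonneg X) fun _ => 1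
  simp only [one_mul] at e3
  rw [totPot, nearPot, ← e3, ← e1, ← e2, H.setIntegral_ball_eq]
  simp only [farPot]
  ring

/-- The far part of the graph enters `totPot` with a minus sign, so the near potential alone is no
lower bound. The points over |z| ≤ 1 lie in B_R, hence in `S`, and their contribution suffices. The
bound involves neither the growth constant nor R. -/
lemma potLow_le {X : Amb d m} (hX : X ∈ ball (0 : Amb d m) r₀) :
    potLow d K β ≤ totPot η θ β κ ψ S R X := by
  have key : ∀ g : Eu d → ℝ, Measurable g → (∀ z, 0 ≤ g z) → (∀ z, g z ≤ 1) →
      (∀ z, ‖z‖ ≤ 1 → g z = 1) → potLow d K β ≤ ∫ z, g z *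
        (distN η θ β κ ψ X z ^ (-(((d : ℝ) + β) / 2)) * areaW ψ (X.fst + ‖X.snd‖ • z)) :=
    fun g hg hg0 hg1 hg2 => le_potential H.one_lt H.coeff_pos
      (continuous_distN H.mollifier H.flat) H.le_distN H.continuous_areaW H.half_le_areaW
      H.areaW_le_two X (fun z hz => distN_le H.mollifier H.flat H.scal_near H.one_le H.le_stretch
        H.stretch_le H.small X hz) hg hg0 hg1 hg2
  by_cases h0 : X.snd = 0
  · have e : totPot η θ β κ ψ S R X = nearPot η θ β κ ψ X := by
      rw [totPot, h0, norm_zero, Real.zero_rpow H.beta_pos.ne', zero_mul, add_zero]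
    rw [e, nearPot]
    have := key (fun _ => 1) measurable_const (fun _ => zero_le_one) (fun _ => le_rfl) fun _ _ => rfl
    simpa using this
  · rw [← H.mul_integral_eq_totPot hX h0]
    obtain ⟨h1, h2⟩ := H.integrable_pot hX h0
    set f := fun Y => (‖modelRho η θ β κ ψ X - Y‖ ^ ((d : ℝ) + β))⁻¹
    have hf : ∀ Y, 0 ≤ f Y := fun Y => by positivity
    have e1 : ∫ Y in graphSet ψ, (ball (0 : Amb d m) R).indicator 1 Y * f Y ∂μHE[d] ≤
        ∫ Y in S, f Y ∂μHE[d] := by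
      have e2 : (fun Y => (ball (0 : Amb d m) R).indicator 1 Y * f Y) =
          (ball (0 : Amb d m) R).indicator f := by
        funext Y
        by_cases hY : Y ∈ ball (0 : Amb d m) R <;> simp [hY]
      rw [e2, integral_indicator measurableSet_ball, ← H.setIntegral_ball_eq]
      exact setIntegral_le_integral h2 (Filter.Eventually.of_forall hf)
    refine le_trans ?_ (mul_le_mul_of_nonneg_left e1 (by positivity))
    rw [rpow_mul_integral_graphSet H.mollifier H.flat h0 (H.distN_nonneg X)]
    have hgm : Measurable fun z : Eu d =>
        (ball (0 : Amb d m) R).indicator (1 : Amb d m → ℝ) (graphMap ψ (X.fst + ‖X.snd‖ • z)) := by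
      have h3 : Measurable (graphMap ψ) := H.flat.measurableEmbedding.measurable
      exact (measurable_one.indicator measurableSet_ball).comp (h3.comp (by fun_prop))
    exact key _ hgm (fun z => indicator_nonneg (fun _ _ => zero_le_one) _)
      (fun z => indicator_le_self' (fun _ _ => zero_le_one) _)
      fun z hz => indicator_of_mem (H.graphMap_mem hX hz) _

/-- The far potential scales like R^{-β}, so with the prefactor it carries (|t|/R)^β, at most r₀/R
because β ≥ 1. The bound thus depends on R only through r₀/R. Since r₀ ≤ R the ellipticity is free
of C₂, and for small r₀/R it is free of the growth constant as well. -/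
lemma totPot_le {X : Amb d m} (hX : X ∈ ball (0 : Amb d m) r₀) :
    totPot η θ β κ ψ S R X ≤ potHigh d K β + r₀ / R * potFar d A β := by
  have h1 : nearPot η θ β κ ψ X ≤ potHigh d K β :=
    potential_le H.one_lt H.coeff_pos (continuous_distN H.mollifier H.flat) H.le_distN
      H.continuous_areaW (areaW_nonneg ψ) H.areaW_le_two X
  have h2 := farPot_le H.growth_nonneg H.R_pos H.beta_pos H.growth (H.norm_modelRho_le hX)
  have h3 := farPot_nonneg (ν := (μHE[d] : Measure (Amb d m)).restrict (graphSet ψ)) (R := R) β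
    (modelRho η θ β κ ψ X)
  have hR := H.R_pos
  have hXr : ‖X.snd‖ ≤ r₀ := (norm_snd_le X).trans (mem_ball_zero_iff.mp hX).le
  have h4 : (‖X.snd‖ / R) ^ β ≤ r₀ / R := by
    have h5 : ‖X.snd‖ / R ≤ r₀ / R := by gcongr
    have h6 : r₀ / R ≤ 1 := by
      rw [div_le_one hR]; linarith [H.eight_mul_le, H.radius_pos]
    refine le_trans ?_ h5
    conv_rhs => rw [← Real.rpow_one (‖X.snd‖ / R)]
    exact Real.rpow_le_rpow_of_exponent_ge' (by positivity) (h5.trans h6) zero_le_one H.one_lt.le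
  have h5 : ‖X.snd‖ ^ β * (2 ^ ((d : ℝ) + β) * farBound d A R β) =
      (‖X.snd‖ / R) ^ β * potFar d A β := by
    rw [potFar, farBound, farBound, Real.one_rpow, Real.div_rpow (norm_nonneg _) hR.le,
      Real.rpow_neg hR.le]
    ring
  have h6 : 0 ≤ potFar d A β := by
    have := farBound_nonneg (d := d) H.growth_nonneg zero_le_one H.beta_pos
    unfold potFar; positivity
  have h7 := mul_le_mul_of_nonneg_right h4 h6
  have h8 := mul_le_mul_of_nonneg_left
    (show farPot β ((μHE[d] : Measure (Amb d m)).restrict S) R (modelRho η θ β κ ψ X) -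
      farPot β ((μHE[d] : Measure (Amb d m)).restrict (graphSet ψ)) R (modelRho η θ β κ ψ X) ≤
      2 ^ ((d : ℝ) + β) * farBound d A R β by linarith)
    (show 0 ≤ ‖X.snd‖ ^ β by positivity)
  rw [totPot]
  linarith

lemma div_regDist_eq {X : Amb d m} (hX : X ∈ ball (0 : Amb d m) r₀) (h0 : X.snd ≠ 0) :
    ‖X.snd‖ / regDist β S (modelRho η θ β κ ψ X) = totPot η θ β κ ψ S R X ^ (1 / β) := by
  have hI : 0 ≤ ∫ Y in S, (‖modelRho η θ β κ ψ X - Y‖ ^ ((d : ℝ) + β))⁻¹ ∂μHE[d] :=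
    integral_nonneg fun Y => by positivity
  rw [← H.mul_integral_eq_totPot hX h0, Real.mul_rpow (by positivity) hI,
    ← Real.rpow_mul (norm_nonneg _), mul_one_div, div_self H.beta_pos.ne', Real.rpow_one, regDist,
    neg_div, Real.rpow_neg hI, div_inv_eq_mul]

end LocalModel

/-- The near part is covered by `lipOn_potential`. In the far terms |t|^β is Lipschitz for |t| ≤ 1
since β ≥ 1, and it multiplies bounded Lipschitz functions. -/
lemma exists_lipOn_totPot (d m : ℕ) (β K L C A R : ℝ) : ∃ CG, 0 ≤ CG ∧
    ∀ (η : Eu d → ℝ) (θ : Amb d m → ℝ) (κ : ℝ) (ψ : Eu d → Eu m) (S : Set (Amb d m)) (ε r₀ : ℝ),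
      LocalModel η θ β κ K ψ S ε L C A R r₀ → LipOn CG (totPot η θ β κ ψ S R) (ball 0 r₀) := by
  set c := (8 * K ^ 2)⁻¹
  set CN := 4 * L + 2 * K * (3 * (8 * L + 2 * (C * L))) + K ^ 2 * (3 * (C * L))
  set C₁ := ∫ z : Eu d, (((d : ℝ) + β) / 2 * c ^ (-(((d : ℝ) + β) / 2) - 1) * CN * 16 +
      c ^ (-(((d : ℝ) + β) / 2)) * (C * L) * 2) * (1 + ‖z‖ ^ 2) ^ (-(((d : ℝ) + β) / 2 - 1 / 2))
  set C₂ := fun A : ℝ => ((d : ℝ) + β) * 2 ^ ((d : ℝ) + β + 1) * farBound d A R (β + 1)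
  set M₂ := fun A : ℝ => 2 ^ ((d : ℝ) + β) * farBound d A R β
  set C₃ := fun A : ℝ => β * M₂ A + 1 * (C₂ A * (2 * K))
  refine ⟨max 0 (C₁ + (C₃ A + C₃ (graphGrowth d))), le_max_left _ _,
    fun η θ κ ψ S ε r₀ H => ?_⟩
  have h1 : LipOn C₁ (nearPot η θ β κ ψ) univ := by
    have hL := H.flat.lip_nonneg
    have hC := H.const_nonneg
    have hK := H.K_pos
    exact lipOn_potential H.one_lt H.coeff_pos (by positivity) (by positivity)
      (continuous_distN H.mollifier H.flat) H.le_distN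
      (lipOn_distN H.mollifier H.flat H.scal_near H.const_nonneg H.eps_le_one H.abs_stretch_le
        H.scal_lip H.stretch_lip) H.continuous_areaW (areaW_nonneg ψ) H.areaW_le_two H.area_lip
  have hρ : LipOn (2 * K) (modelRho η θ β κ ψ) (ball 0 r₀) := fun X hX Y hY =>
    (H.bilipschitz (H.ball_subset_tube hX) (H.ball_subset_tube hY)).1
  have hmem : MapsTo (modelRho η θ β κ ψ) (ball 0 r₀) (closedBall 0 (R / 2)) := fun X hX =>
    mem_closedBall_zero_iff.mpr (H.norm_modelRho_le hX)
  have hlt : ∀ X ∈ ball (0 : Amb d m) r₀, ‖X.snd‖ ≤ 1 := fun X hX =>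
    ((norm_snd_le X).trans (mem_ball_zero_iff.mp hX).le).trans H.radius_le_one
  have hpow : LipOn β (fun X : Amb d m => ‖X.snd‖ ^ β) (ball 0 r₀) := fun X hX Y hY => by
    refine (rpow_sub_le_of_le_one (norm_nonneg _) (hlt X hX) (norm_nonneg _) (hlt Y hY)
      H.one_lt.le).trans (mul_le_mul_of_nonneg_left ?_ H.beta_pos.le)
    exact (abs_norm_sub_norm_le _ _).trans (norm_snd_le (X - Y))
  have hpowb : ∀ X ∈ ball (0 : Amb d m) r₀, ‖‖X.snd‖ ^ β‖ ≤ 1 := fun X hX => by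
    rw [Real.norm_of_nonneg (by positivity)]
    exact Real.rpow_le_one (norm_nonneg _) (hlt X hX) H.beta_pos.le
  have hfar : ∀ (A : ℝ) (ν : Measure (Amb d m)), 0 ≤ A →
      (∀ ρ, 0 < ρ → ν (ball 0 ρ) ≤ ENNReal.ofReal (A * ρ ^ d)) →
      LipOn (C₃ A) (fun X => ‖X.snd‖ ^ β * farPot β ν R (modelRho η θ β κ ψ X)) (ball 0 r₀) := by
    intro A ν hA hν
    have hβ := H.beta_pos
    have hC₂ : 0 ≤ C₂ A := mul_nonneg (by positivity)
      (farBound_nonneg hA H.R_pos.le (by linarith))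
    exact hpow.mul ((lipOn_farPot hA H.R_pos H.beta_pos hν).comp hρ hmem hC₂) hpowb fun X hX => by
      rw [Real.norm_of_nonneg (farPot_nonneg _ _)]
      exact farPot_le hA H.R_pos H.beta_pos hν (H.norm_modelRho_le hX)
  have h2 := hfar A _ H.growth_nonneg H.growth
  have h3 := (hfar (graphGrowth d) _ (graphGrowth_nonneg d) H.graph_growth).const_smul
    (show |(-1 : ℝ)| ≤ 1 by simp)
  have h4 := (h1.mono le_rfl (subset_univ (ball 0 r₀))).add (h2.add h3)
  refine LipOn.mono (LipOn.congr h4 fun X _ => ?_) ?_ subset_rfl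
  · rw [totPot]; simp only [smul_eq_mul]; ring
  · refine le_trans (le_of_eq ?_) (le_max_right _ _)
    ring

end Model

end HigherCodim

namespace HigherCodim

/-! ### The conjugated matrix -/

section ModelMatrix

variable {d m : ℕ}

lemma inner_frame (B : Eu d →L[ℝ] Eu m) (s s' : Eu m) :
    inner ℝ (frame B s) (frame B s') = inner ℝ s s' :=
  LinearIsometry.inner_map_map
    (⟨(frame B : Eu m →ₗ[ℝ] Amb d m), norm_frame_apply B⟩ : Eu m →ₗᵢ[ℝ] Amb d m) s s'

lemma norm_smul_le_mul {E W : Type*} [NormedAddCommGroup W] [NormedSpace ℝ W] {b c : ℝ}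
    {f : E → ℝ} {g : E → W} {s : Set E} (hf : ∀ x ∈ s, ‖f x‖ ≤ b) (hg : ∀ x ∈ s, ‖g x‖ ≤ c) :
    ∀ x ∈ s, ‖f x • g x‖ ≤ b * c := fun x hx => by
  rw [norm_smul]
  exact mul_le_mul (hf x hx) (hg x hx) (norm_nonneg _) ((norm_nonneg _).trans (hf x hx))

lemma Elliptic.smul {E : Type*} [NormedAddCommGroup E] [InnerProductSpace ℝ E]
    {T : E →L[ℝ] E} {μ a b s lam : ℝ} (hT : Elliptic μ T) (hμ : 0 < μ) (ha : 0 < a) (has : a ≤ s)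
    (hsb : s ≤ b) (h1 : b * μ ≤ lam) (h2 : a⁻¹ * μ ≤ lam) : Elliptic lam (s • T) := fun ξ => by
  obtain ⟨hl, hu⟩ := hT ξ
  have hs : 0 < s := ha.trans_le has
  rw [_root_.smul_apply, real_inner_smul_left]
  have h3 : lam⁻¹ ≤ s * μ⁻¹ := by
    refine (inv_anti₀ (by positivity) h2).trans ?_
    rw [mul_inv, inv_inv]
    gcongr
  constructor
  · refine (mul_le_mul_of_nonneg_right h3 (sq_nonneg _)).trans ?_
    rw [mul_assoc]
    exact mul_le_mul_of_nonneg_left hl hs.le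
  · refine (mul_le_mul_of_nonneg_left hu hs.le).trans ?_
    rw [← mul_assoc]
    refine mul_le_mul_of_nonneg_right (le_trans ?_ h1) (sq_nonneg _)
    gcongr

/-- The power of the potential that enters in the conjugated matrix. -/
noncomputable def potScale (m : ℕ) (β x : ℝ) : ℝ := (x ^ (1 / β)) ^ (m - 1)

lemma potScale_pos (m : ℕ) (β : ℝ) {x : ℝ} (hx : 0 < x) : 0 < potScale m β x :=
  pow_pos (Real.rpow_pos_of_pos hx _) _

lemma potScale_mono (m : ℕ) {β x y : ℝ} (hβ : 0 < β) (hx : 0 ≤ x) (hxy : x ≤ y) :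
    potScale m β x ≤ potScale m β y :=
  pow_le_pow_left₀ (by positivity) (Real.rpow_le_rpow hx hxy (by positivity)) _

lemma exists_lipOn_potScale (m : ℕ) (β : ℝ) {a : ℝ} (ha : 0 < a) (b : ℝ) :
    ∃ C, 0 ≤ C ∧ LipOn C (potScale m β) (Icc a b) ∧ ∀ x ∈ Icc a b, ‖potScale m β x‖ ≤ C := by
  refine LipOn.of_contDiffOn isOpen_Ioi (O := Ioi 0) ?_ isCompact_Icc
    fun x hx => ha.trans_le hx.1
  exact (contDiffOn_id.rpow_const_of_ne fun x hx => (mem_Ioi.mp hx).ne').pow _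

/-- The matrix `𝒜` of the change of variables `modelRho`, extended to `t = 0`. -/
noncomputable def modelA (η : Eu d → ℝ) (θ : Amb d m → ℝ) (β κ : ℝ) (ψ : Eu d → Eu m)
    (S : Set (Amb d m)) (R : ℝ) (X : Amb d m) : Amb d m →L[ℝ] Amb d m :=
  (potScale m β (totPot η θ β κ ψ S R X) *
    |(ContinuousLinearMap.adjoint (modelDeriv η θ β κ ψ X)).det|) •
      gramInv (modelDeriv η θ β κ ψ X)

lemma modelA_of_snd_eq_zero {η : Eu d → ℝ} {θ : Amb d m → ℝ} {β κ K : ℝ} {ψ : Eu d → Eu m}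
    {S : Set (Amb d m)} {ε L C A R r₀ : ℝ} (H : LocalModel η θ β κ K ψ S ε L C A R r₀)
    {X : Amb d m} (hX : X ∈ ball (0 : Amb d m) r₀) (h0 : X.snd = 0) :
    ∃ c : ℝ, ∀ s : Eu m, modelA η θ β κ ψ S R X (pt 0 s) = c • pt 0 s := by
  set M := modelDeriv η θ β κ ψ X
  set B := fderiv ℝ ψ X.fst
  set h := κ * scal η θ β ψ (cyl X)
  have hh : h ≠ 0 := by
    have h1 : 0 < κ := (inv_pos.mpr H.K_pos).trans_le H.le_stretch
    have h2 := (abs_le.mp (H.scal_near (cyl X))).1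
    exact (mul_pos h1 (by linarith)).ne'
  have hM : ∀ v, M v = liftL B v.fst + h • frame B v.snd :=
    modelDeriv_of_snd_eq_zero H.mollifier H.flat h0
  refine ⟨potScale m β (totPot η θ β κ ψ S R X) * |(ContinuousLinearMap.adjoint M).det| *
    (h ^ 2)⁻¹, fun s => ?_⟩
  -- Since M splits orthogonally into tangent and normal parts, with normal part h times an
  -- isometry, M⁻ᵀ(0, s) is h⁻¹ times the frame vector of s, while M(0, s) is h times it. Hence the
  -- eigenvalue h⁻².
  have key := gramInv_apply_of_adjoint (by linarith [H.K_pos] : 0 ≤ 2 * K)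
    (H.modelDeriv_bounds (H.ball_subset_tube hX)).2 (v := pt 0 s) (w := h⁻¹ • frame B s)
    (fun u => by
      change inner ℝ _ (M u) = _
      rw [hM, real_inner_smul_left, inner_add_right, real_inner_comm, inner_liftL_frame,
        real_inner_smul_right, inner_frame, inner_amb, pt_fst, pt_snd, inner_zero_left,
        zero_add, zero_add, ← mul_assoc, inv_mul_cancel₀ hh, one_mul])
    (c := h ^ 2) (v' := pt 0 s) (by
      change M _ = _
      rw [hM, pt_fst, pt_snd, map_zero, zero_add, smul_smul, sq, mul_assoc, mul_inv_cancel₀ hh,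
        mul_one])
  rcases key with key | key
  · rw [modelA, _root_.smul_apply, key, smul_smul]
  · exact absurd key (pow_ne_zero 2 hh)

lemma calA_rho_eq {η : Eu d → ℝ} {θ : Amb d m → ℝ} {β κ K : ℝ} {ψ : Eu d → Eu m}
    {S : Set (Amb d m)} {ε L C A R r₀ a₀ Cf : ℝ} (H : LocalModel η θ β κ K ψ S ε L C A R r₀)
    (hθ : IsCutoff θ) (ha : 0 < a₀) (hκ : flatStretch θ a₀ β = κ)
    (hF : ConicReg (stretch η θ β ψ) Cf) {X : Amb d m} (hX : X ∈ offPlane (0 : Amb d m) r₀) :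
    calA β S (rho η θ a₀ β S ψ) X = modelA η θ β κ ψ S R X := by
  have h1 : rho η θ a₀ β S ψ =ᶠ[nhds X] modelRho η θ β κ ψ := by
    filter_upwards [isOpen_ball.mem_nhds hX.1] with Y hY using H.rho_eq hθ ha hκ hY
  have h2 : jac (rho η θ a₀ β S ψ) X = ContinuousLinearMap.adjoint (modelDeriv η θ β κ ψ X) := by
    rw [jac, h1.fderiv_eq, (hasFDerivAt_modelRho H.mollifier H.flat hF hX.2
      (H.tube_subset (H.ball_subset_tube hX.1))).fderiv]
  rw [calA, modelA, h2, H.rho_eq hθ ha hκ hX.1, H.div_regDist_eq hX.1 hX.2]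
  rfl

set_option maxHeartbeats 1000000 in
-- The order of the quantifiers carries the dependence of the constants: λ' precedes the growth
-- constant A, λ precedes L and R, which encode C₂, and C₀ and r̄' come last.
lemma exists_condition {η : Eu d → ℝ} {θ : Amb d m → ℝ} (hm : 1 ≤ m) (hη : IsMollifier η)
    (hθ : IsCutoff θ) {K : ℝ} (hK : 1 ≤ K) (C β : ℝ) (hβ : 1 < β) :
    ∃ lam', 0 < lam' ∧ ∀ A, ∃ lam, 0 < lam ∧ ∀ L R, 0 ≤ L → 0 < R → ∃ C₀, 0 < C₀ ∧
      ∃ rbar', 0 < rbar' ∧ ∀ (a₀ κ : ℝ) (ψ : Eu d → Eu m) (S : Set (Amb d m)) (ε r₀ : ℝ),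
        0 < a₀ → flatStretch θ a₀ β = κ → LocalModel η θ β κ K ψ S ε L C A R r₀ →
        HigherCodimC01 (conjMatrix β S (rho η θ a₀ β S ψ)) 0 r₀ lam C₀ ∧
        (r₀ ≤ rbar' → HigherCodimC01 (conjMatrix β S (rho η θ a₀ β S ψ)) 0 r₀ lam' C₀) := by
  have hK0 : 0 < K := by linarith
  have hβ0 : 0 < β := by linarith
  have hΛ : 0 < 2 * K := by positivity
  obtain ⟨D, hD1, hD⟩ := exists_det_bounds (Amb d m) (2 * K)
  have hD0 : 0 < D := by linarith
  set g₀ := potLow d K β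
  have hg₀ : 0 < g₀ := potLow_pos d hK0 β
  -- The matrix is a scalar times an inverse Gram matrix of ellipticity (2K)². If the potential lies
  -- between g₀ and g, the scalar lies between `potScale m β g₀ * D⁻¹` and `potScale m β g * D`.
  set lamOf : ℝ → ℝ := fun g => max (potScale m β g * D * (2 * K) ^ 2)
    ((potScale m β g₀ * D⁻¹)⁻¹ * (2 * K) ^ 2)
  have hq₀ : 0 < potScale m β g₀ := potScale_pos m β hg₀
  have hlam : ∀ g, 0 < lamOf g := fun g => lt_max_of_lt_right (by positivity)
  refine ⟨_, hlam (potHigh d K β + 1), fun A => ⟨_, hlam (potHigh d K β + |potFar d A β|),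
    fun L R hL hR => ?_⟩⟩
  obtain ⟨Cq, hCq, hql, hqb⟩ := exists_lipOn_potScale m β hg₀ (potHigh d K β + |potFar d A β|)
  obtain ⟨Cf, hCf⟩ := exists_conicReg_stretch (m := m) hη hθ L β hL
  obtain ⟨CG, hCG, hG⟩ := exists_lipOn_totPot d m β K L C A R
  set CM := 16 * L + K * (13 * max 0 Cf)
  have hCM : 0 ≤ CM := by positivity
  set Cp := Cq * CG * D + Cq * (D * CM)
  have hCp : 0 ≤ Cp := by positivity
  set Ca := Cp * (2 * K) ^ 2 + Cq * D * (2 * (2 * K) ^ 3 * CM)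
  have hCa : 0 ≤ Ca := by positivity
  -- The smaller radius is chosen so that (r₀/R) |potFar| ≤ 1. The potential is then at most
  -- `potHigh d K β + 1`, without reference to A.
  refine ⟨max 1 (3 * Ca + m * (Cq * D * (2 * K) ^ 2)), by positivity,
    R / (1 + |potFar d A β|), by positivity, fun a₀ κ ψ S ε r₀ ha hκ H => ?_⟩
  have hF := hCf ψ ⟨H.flat.lip_nonneg, H.flat.contDiff,
    fun x => (H.flat.small x).trans H.eps_le_one, H.flat.lip⟩ H.ratio
  have hMb : ∀ X ∈ ball (0 : Amb d m) r₀, _ := fun X hX =>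
    H.modelDeriv_bounds (H.ball_subset_tube hX)
  have hMl : LipOn CM (modelDeriv η θ β κ ψ) (ball 0 r₀) := by
    refine (lipOn_modelDeriv hη H.flat hF H.abs_stretch_le).mono ?_
      (H.ball_subset_tube.trans H.tube_subset)
    have := mul_le_mul_of_nonneg_left (le_max_right 0 Cf) hK0.le
    change _ ≤ 16 * L + K * (13 * max 0 Cf)
    linarith
  have hdet : ∀ X ∈ ball (0 : Amb d m) r₀, _ := fun X hX =>
    hD _ (hMb X hX).1 (hMb X hX).2 hΛ.le
  have hdl : LipOn (D * CM)
      (fun X => |(ContinuousLinearMap.adjoint (modelDeriv η θ β κ ψ X)).det|) (ball 0 r₀) :=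
    fun X hX Y hY => by
      refine ((hdet X hX).2.2 _ (hMb Y hY).1).trans ?_
      rw [mul_assoc]
      exact mul_le_mul_of_nonneg_left (hMl X hX Y hY) hD0.le
  have hgl : LipOn (2 * (2 * K) ^ 3 * CM) (fun X => gramInv (modelDeriv η θ β κ ψ X))
      (ball 0 r₀) := fun X hX Y hY => by
    refine (norm_gramInv_sub_le hΛ.le (hMb X hX).2 (hMb Y hY).2).trans ?_
    rw [mul_assoc _ CM]
    exact mul_le_mul_of_nonneg_left (hMl X hX Y hY) (by positivity)
  have hr1 : r₀ / R ≤ 1 := by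
    rw [div_le_one hR]; linarith [H.eight_mul_le, H.radius_pos]
  have hr0 : 0 ≤ r₀ / R := by have := H.radius_pos; positivity
  have hmem : MapsTo (totPot η θ β κ ψ S R) (ball 0 r₀)
      (Icc g₀ (potHigh d K β + |potFar d A β|)) := fun X hX => by
    refine ⟨H.potLow_le hX, (H.totPot_le hX).trans ?_⟩
    have h2 := mul_le_mul_of_nonneg_left (le_abs_self (potFar d A β)) hr0
    have h3 := mul_le_mul_of_nonneg_right hr1 (abs_nonneg (potFar d A β))
    linarith
  have hpl := (hql.comp (hG η θ κ ψ S ε r₀ H) hmem hCq)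
  have hpb : ∀ X ∈ ball (0 : Amb d m) r₀, ‖potScale m β (totPot η θ β κ ψ S R X)‖ ≤ Cq :=
    fun X hX => hqb _ (hmem hX)
  have hdb : ∀ X ∈ ball (0 : Amb d m) r₀,
      ‖|(ContinuousLinearMap.adjoint (modelDeriv η θ β κ ψ X)).det|‖ ≤ D := fun X hX => by
    rw [norm_abs_eq_norm]; exact (hdet X hX).2.1
  have hsl := hpl.mul hdl hpb hdb
  have hsb : ∀ X ∈ ball (0 : Amb d m) r₀, ‖potScale m β (totPot η θ β κ ψ S R X) *
      |(ContinuousLinearMap.adjoint (modelDeriv η θ β κ ψ X)).det|‖ ≤ Cq * D := fun X hX => by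
    rw [norm_mul]
    exact mul_le_mul (hpb X hX) (hdb X hX) (norm_nonneg _) hCq
  have hgb : ∀ X ∈ ball (0 : Amb d m) r₀, ‖gramInv (modelDeriv η θ β κ ψ X)‖ ≤ (2 * K) ^ 2 :=
    fun X hX => norm_gramInv_le hΛ.le (hMb X hX).2
  have hAl : LipOn Ca (modelA η θ β κ ψ S R) (ball 0 r₀) := hsl.smul hgl hsb hgb
  have hAb : ∀ X ∈ ball (0 : Amb d m) r₀, ‖modelA η θ β κ ψ S R X‖ ≤ Cq * D * (2 * K) ^ 2 :=
    norm_smul_le_mul hsb hgb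
  have main : ∀ g, (∀ X ∈ ball (0 : Amb d m) r₀, totPot η θ β κ ψ S R X ≤ g) →
      HigherCodimC01 (conjMatrix β S (rho η θ a₀ β S ψ)) 0 r₀ (lamOf g)
        (max 1 (3 * Ca + m * (Cq * D * (2 * K) ^ 2))) := fun g hg => by
    refine higherCodimC01_of_lipOn hm H.radius_le_one hCa
      (fun X hX => by rw [conjMatrix, calA_rho_eq H hθ ha hκ hF hX]) hAl hAb (fun X _ => ?_)
      (fun X hX => ?_) (fun X hX h0 => modelA_of_snd_eq_zero H hX h0) (le_max_right _ _)
    · exact (IsSelfAdjoint.all _).smul (isSelfAdjoint_gramInv _)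
    · have h1 := potScale_mono m hβ0 hg₀.le (hmem hX).1
      have h2 := potScale_mono m hβ0 (hg₀.le.trans (hmem hX).1) (hg X hX)
      exact (elliptic_gramInv hΛ (hMb X hX).2 (hMb X hX).1).smul (by positivity)
        (show 0 < potScale m β g₀ * D⁻¹ by positivity)
        (mul_le_mul h1 (hdet X hX).1 (by positivity) (hq₀.le.trans h1))
        (mul_le_mul h2 (hdet X hX).2.1 (abs_nonneg _) ((hq₀.le.trans h1).trans h2))
        (le_max_left _ _) (le_max_right _ _)
  refine ⟨main _ fun X hX => (hmem hX).2, fun hr => main _ fun X hX => ?_⟩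
  refine (H.totPot_le hX).trans (add_le_add le_rfl ?_)
  have h1 : r₀ / R ≤ (1 + |potFar d A β|)⁻¹ := by
    rw [div_le_iff₀ hR]
    exact hr.trans (le_of_eq (by rw [div_eq_inv_mul]))
  refine (mul_le_mul_of_nonneg_left (le_abs_self (potFar d A β)) hr0).trans
    ((mul_le_mul_of_nonneg_right h1 (abs_nonneg _)).trans ?_)
  rw [inv_mul_le_iff₀ (by positivity)]
  linarith

end ModelMatrix

end HigherCodim

namespace HigherCodim

/-! ### Cut-off and inversion of nearly linear maps -/

section Localization

variable {E : Type*} [NormedAddCommGroup E] [InnerProductSpace ℝ E] [FiniteDimensional ℝ E]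
  {W : Type*} [NormedAddCommGroup W] [NormedSpace ℝ W] {V : Type*} [NormedAddCommGroup V]
  [NormedSpace ℝ V]

/-- A smooth map that is the identity in the unit ball and takes values in the ball of radius
two. -/
lemma exists_retraction (E : Type*) [NormedAddCommGroup E] [InnerProductSpace ℝ E]
    [FiniteDimensional ℝ E] : ∃ (σ : E → E) (c : ℝ), 0 ≤ c ∧ ContDiff ℝ 1 σ ∧
      (∀ x ∈ ball (0 : E) 1, σ x = x) ∧ (∀ x, ‖σ x‖ ≤ 2) ∧ (∀ x, ‖fderiv ℝ σ x‖ ≤ c) ∧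
      LipOn c (fderiv ℝ σ) univ := by
  let χ : ContDiffBump (0 : E) := ⟨1, 2, one_pos, one_lt_two⟩
  set σ : E → E := fun x => χ x • x
  have h1 : ContDiff ℝ 2 σ := χ.contDiff.smul contDiff_id
  have h2 : HasCompactSupport σ := χ.hasCompactSupport.smul_right
  obtain ⟨C₁, hC₁⟩ := h1.lipschitzWith_of_hasCompactSupport h2 two_ne_zero
  have h3 : ContDiff ℝ 1 (fderiv ℝ σ) := h1.fderiv_right (by norm_num)
  obtain ⟨C₂, hC₂⟩ := h3.lipschitzWith_of_hasCompactSupport (h2.fderiv ℝ) one_ne_zero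
  refine ⟨σ, max C₁ C₂, le_max_of_le_left C₁.2, h1.of_le (by norm_num), fun x hx => ?_,
    fun x => ?_, fun x => (norm_fderiv_le_of_lipschitz ℝ hC₁).trans (le_max_left _ _),
    fun x _ y _ => ?_⟩
  · have : χ x = 1 := χ.one_of_mem_closedBall (ball_subset_closedBall hx)
    simp [σ, this]
  · by_cases hx : ‖x‖ ≤ 2
    · simp only [σ]
      rw [norm_smul, Real.norm_of_nonneg χ.nonneg]
      have := mul_le_mul (χ.le_one (x := x)) hx (norm_nonneg x) zero_le_one
      linarith
    · have : χ x = 0 := χ.zero_of_le_dist (by rw [dist_zero_right]; exact (not_le.mp hx).le)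
      simp [σ, this]
  · have := hC₂.dist_le_mul x y
    rw [dist_eq_norm, dist_eq_norm] at this
    exact this.trans (mul_le_mul_of_nonneg_right (le_max_right _ _) (norm_nonneg _))

/-- A function with Lipschitz derivative that vanishes to first order at the origin coincides in
a small ball with a function that has a globally small derivative. -/
lemma exists_flat_extension (E : Type*) [NormedAddCommGroup E] [InnerProductSpace ℝ E]
    [FiniteDimensional ℝ E] : ∃ c : ℝ, 0 ≤ c ∧
    ∀ (g₀ : E → W) (Λ r : ℝ), 0 ≤ Λ → 0 < r → ContDiff ℝ 1 g₀ → LipOn Λ (fderiv ℝ g₀) univ →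
      g₀ 0 = 0 → fderiv ℝ g₀ 0 = 0 → ∃ g : E → W, ContDiff ℝ 1 g ∧ (∀ x ∈ ball 0 r, g x = g₀ x) ∧
        (∀ x, ‖fderiv ℝ g x‖ ≤ c * Λ * r) ∧ LipOn (c * Λ) (fderiv ℝ g) univ := by
  obtain ⟨σ, c, hc, h1, h2, h3, h4, h5⟩ := exists_retraction E
  refine ⟨2 * c + c * c + 2 * c, by positivity, fun g₀ Λ r hΛ hr hg hl hg0 hg1 => ?_⟩
  -- Precomposition with a retraction replaces multiplication by a cut-off: τ takes values in the
  -- ball of radius 2r, where |∇g₀| ≤ 2Λr, and its derivative is bounded independently of r.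
  set τ : E → E := fun x => r • σ (r⁻¹ • x)
  have hτd : ∀ x, HasFDerivAt τ (fderiv ℝ σ (r⁻¹ • x)) x := fun x => by
    have e1 : HasFDerivAt (fun x : E => r⁻¹ • x) (r⁻¹ • ContinuousLinearMap.id ℝ E) x :=
      (hasFDerivAt_id x).const_smul r⁻¹
    have e2 := (((h1.differentiable one_ne_zero) (r⁻¹ • x)).hasFDerivAt.comp x e1).const_smul r
    refine e2.congr_fderiv (ContinuousLinearMap.ext fun v => ?_)
    simp [smul_smul, mul_inv_cancel₀ hr.ne']
  have hτb : ∀ x, ‖τ x‖ ≤ 2 * r := fun x => by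
    rw [norm_smul, Real.norm_of_nonneg hr.le]
    have := mul_le_mul_of_nonneg_left (h3 (r⁻¹ • x)) hr.le
    linarith
  have hτl : LipOn c τ univ := LipOn.of_hasFDerivAt convex_univ (fun x _ => hτd x) fun x _ => h4 _
  have hτc : ContDiff ℝ 1 τ := (h1.comp (contDiff_id.const_smul r⁻¹)).const_smul r
  have hgd : ∀ x, fderiv ℝ (fun x => g₀ (τ x)) x =
      fderiv ℝ g₀ (τ x) ∘L fderiv ℝ σ (r⁻¹ • x) := fun x =>
    (((hg.differentiable one_ne_zero) (τ x)).hasFDerivAt.comp x (hτd x)).fderiv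
  have hb : ∀ x, ‖fderiv ℝ g₀ (τ x)‖ ≤ 2 * Λ * r := fun x => by
    have e1 := hl (τ x) (mem_univ _) 0 (mem_univ _)
    rw [hg1, sub_zero, sub_zero] at e1
    have := mul_le_mul_of_nonneg_left (hτb x) hΛ
    linarith
  refine ⟨fun x => g₀ (τ x), hg.comp hτc, fun x hx => ?_, fun x => ?_, ?_⟩
  · have : r⁻¹ • x ∈ ball (0 : E) 1 := by
      rw [mem_ball_zero_iff] at hx ⊢
      rw [norm_smul, norm_inv, Real.norm_of_nonneg hr.le, inv_mul_lt_iff₀ hr]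
      linarith
    simp only [τ]
    rw [h2 _ this, smul_smul, mul_inv_cancel₀ hr.ne', one_smul]
  · rw [hgd]
    refine (ContinuousLinearMap.opNorm_comp_le _ _).trans ?_
    have e1 := mul_le_mul (hb x) (h4 (r⁻¹ • x)) (norm_nonneg _) (by positivity)
    have e2 : 0 ≤ (c * c + 2 * c) * Λ * r := by positivity
    linarith
  · have e1 : LipOn (Λ * c) (fun x => fderiv ℝ g₀ (τ x)) univ :=
      hl.comp hτl (fun _ _ => mem_univ _) hΛ
    have e2 : LipOn (c * r⁻¹) (fun x : E => fderiv ℝ σ (r⁻¹ • x)) univ := by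
      refine h5.comp (fun x _ y _ => ?_) (fun _ _ => mem_univ _) hc
      rw [← smul_sub, norm_smul, norm_inv, Real.norm_of_nonneg hr.le]
    refine ((e1.clmComp e2 (fun x _ => hb x) fun x _ => h4 _).congr fun x _ => hgd x).mono ?_
      subset_rfl
    have e3 : 2 * Λ * r * (c * r⁻¹) = 2 * Λ * c := by field_simp
    rw [e3]
    have : 0 ≤ 2 * c * Λ := by positivity
    linarith

/-- A Lipschitz perturbation of an expanding linear map is onto. -/
lemma surjective_add_of_lipOn {A : E →L[ℝ] E} (hA : ∀ v, ‖v‖ ≤ ‖A v‖) {f : E → E} {e : ℝ}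
    (he : e ≤ 1 / 5) (hf : LipOn e f univ) : Function.Surjective fun x => A x + f x := by
  obtain ⟨Q, h1, h2, h3⟩ := exists_inverse zero_le_one fun v => by rw [one_mul]; exact hA v
  let A' : E ≃L[ℝ] E := ContinuousLinearEquiv.equivOfInverse A Q
    (fun v => congrArg (fun T : E →L[ℝ] E => T v) h1)
    (fun v => congrArg (fun T : E →L[ℝ] E => T v) h2)
  have happ : ApproximatesLinearOn (fun x => A x + f x) (A' : E →L[ℝ] E) univ (1 / 5) :=
    fun x hx y hy => by
      have e1 : A x + f x - (A y + f y) - (A' : E →L[ℝ] E) (x - y) = f x - f y := by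
        change A x + f x - (A y + f y) - A (x - y) = _
        rw [map_sub]; abel
      rw [e1]
      refine (hf x hx y hy).trans (mul_le_mul_of_nonneg_right (he.trans ?_) (norm_nonneg _))
      simp
  refine happ.surjective ?_
  rcases subsingleton_or_nontrivial E with hE | hE
  · exact Or.inl hE
  · right
    have h4 : ‖(A'.symm : E →L[ℝ] E)‖₊ ≤ 1 := h3
    have h5 : 0 < ‖(A'.symm : E →L[ℝ] E)‖₊ := A'.nnnorm_symm_pos
    refine lt_of_lt_of_le ?_ (one_le_inv₀ h5 |>.mpr h4)
    rw [div_lt_one (by norm_num)]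
    norm_num

/-- The set `{(A x + P (g x), N (g x))}` is the graph of a function whose derivative is controlled
by that of `g`. -/
lemma exists_graph_function {A : E →L[ℝ] E} (hA : ∀ v, ‖v‖ ≤ ‖A v‖) {P : W →L[ℝ] E}
    {N : W →L[ℝ] V} (hP : ‖P‖ ≤ 1) (hN : ‖N‖ ≤ 1) {g : E → W} (hg : ContDiff ℝ 1 g) {e : ℝ}
    (he : e ≤ 1 / 5) (hge : ∀ x, ‖fderiv ℝ g x‖ ≤ e) :
    ∃ S : E → E, (∀ x, S (A x + P (g x)) = x) ∧ (∀ p, A (S p) + P (g (S p)) = p) ∧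
      LipOn (5 / 4) S univ ∧
      Differentiable ℝ (fun p => N (g (S p))) ∧
      (∀ p, ‖fderiv ℝ (fun p => N (g (S p))) p‖ ≤ 2 * e) ∧
      (∀ p, fderiv ℝ g (S p) = 0 → fderiv ℝ (fun p => N (g (S p))) p = 0) ∧
      ∀ (Λ : ℝ) (s : Set E), 0 ≤ Λ → LipOn Λ (fderiv ℝ g) s →
        LipOn (2 * Λ) (fderiv ℝ fun p => N (g (S p))) (S ⁻¹' s) := by
  have he0 : 0 ≤ e := (norm_nonneg _).trans (hge 0)
  have hgd : ∀ x, HasFDerivAt g (fderiv ℝ g x) x := fun x =>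
    (hg.differentiable one_ne_zero x).hasFDerivAt
  have hPl : ∀ T : E →L[ℝ] W, ‖P ∘L T‖ ≤ ‖T‖ := fun T =>
    (ContinuousLinearMap.opNorm_comp_le _ _).trans (mul_le_of_le_one_left (norm_nonneg _) hP)
  have hf : LipOn e (fun x => P (g x)) univ :=
    LipOn.of_hasFDerivAt convex_univ (fun x _ => P.hasFDerivAt.comp x (hgd x))
      fun x _ => (hPl _).trans (hge x)
  set T : E → E := fun x => A x + P (g x)
  have hT : ∀ x y, ‖x - y‖ ≤ 5 / 4 * ‖T x - T y‖ := fun x y => by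
    have e1 := hf x (mem_univ _) y (mem_univ _)
    have e2 := hA (x - y)
    have e3 : A (x - y) = T x - T y - (P (g x) - P (g y)) := by
      simp only [T]; rw [map_sub]; abel
    rw [e3] at e2
    have e4 := norm_sub_le (T x - T y) (P (g x) - P (g y))
    have e5 := mul_le_mul_of_nonneg_right he (norm_nonneg (x - y))
    linarith
  choose S hS using surjective_add_of_lipOn hA he hf
  have hTS : ∀ p, T (S p) = p := hS
  have hST : ∀ x, S (T x) = x := fun x => by
    have := hT (S (T x)) x
    rw [hTS, sub_self, norm_zero, mul_zero] at this
    exact sub_eq_zero.mp (norm_le_zero_iff.mp this)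
  have hSl : LipOn (5 / 4) S univ := fun p _ q _ => by
    have := hT (S p) (S q)
    rwa [hTS, hTS] at this
  have hinv : ∀ x, ∃ Q : E →L[ℝ] E, Q ∘L (A + P ∘L fderiv ℝ g x) = ContinuousLinearMap.id ℝ E ∧
      (A + P ∘L fderiv ℝ g x) ∘L Q = ContinuousLinearMap.id ℝ E ∧ ‖Q‖ ≤ 5 / 4 := fun x => by
    refine exists_inverse (by norm_num) fun v => ?_
    have e1 := hA v
    have e2 := (P ∘L fderiv ℝ g x).le_of_opNorm_le ((hPl _).trans ((hge x).trans he)) v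
    have e3 := norm_sub_le ((A + P ∘L fderiv ℝ g x) v) ((P ∘L fderiv ℝ g x) v)
    rw [_root_.add_apply, add_sub_cancel_right] at e3
    rw [_root_.add_apply]
    linarith
  choose Q hQ1 hQ2 hQ3 using hinv
  have hSd : ∀ p, HasFDerivAt S (Q (S p)) p := fun p => by
    let T' : E ≃L[ℝ] E := ContinuousLinearEquiv.equivOfInverse (A + P ∘L fderiv ℝ g (S p)) (Q (S p))
      (fun v => congrArg (fun T : E →L[ℝ] E => T v) (hQ1 (S p)))
      (fun v => congrArg (fun T : E →L[ℝ] E => T v) (hQ2 (S p)))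
    have hTd : HasFDerivAt T (T' : E →L[ℝ] E) (S p) :=
      A.hasFDerivAt.add (P.hasFDerivAt.comp (S p) (hgd (S p)))
    exact hTd.of_local_left_inverse (continuousOn_univ.mp hSl.continuousOn).continuousAt
      (Filter.Eventually.of_forall hTS)
  have hψd : ∀ p, HasFDerivAt (fun p => N (g (S p))) (N ∘L (fderiv ℝ g (S p) ∘L Q (S p))) p :=
    fun p => N.hasFDerivAt.comp p ((hgd (S p)).comp p (hSd p))
  have hNl : ∀ T : E →L[ℝ] W, ‖N ∘L T‖ ≤ ‖T‖ := fun T =>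
    (ContinuousLinearMap.opNorm_comp_le _ _).trans (mul_le_of_le_one_left (norm_nonneg _) hN)
  refine ⟨S, hST, hTS, hSl, fun p => (hψd p).differentiableAt, fun p => ?_, fun p hp => ?_,
    fun Λ s hΛ hl p hp q hq => ?_⟩
  · rw [(hψd p).fderiv]
    refine (hNl _).trans ((ContinuousLinearMap.opNorm_comp_le _ _).trans ?_)
    have := mul_le_mul (hge (S p)) (hQ3 (S p)) (norm_nonneg _) he0
    linarith
  · rw [(hψd p).fderiv, hp, ContinuousLinearMap.zero_comp, ContinuousLinearMap.comp_zero]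
  · rw [(hψd p).fderiv, (hψd q).fderiv, ← ContinuousLinearMap.comp_sub]
    refine (hNl _).trans ?_
    set G := fderiv ℝ g (S p)
    set G' := fderiv ℝ g (S q)
    have e0 : Q (S p) - Q (S q) = -(Q (S p) ∘L ((P ∘L (G - G')) ∘L Q (S q))) := by
      have e1 : P ∘L (G - G') = (A + P ∘L G) - (A + P ∘L G') := by
        rw [ContinuousLinearMap.comp_sub]; abel
      rw [e1, ContinuousLinearMap.sub_comp, hQ2, ContinuousLinearMap.comp_sub,
        ContinuousLinearMap.comp_id, ← ContinuousLinearMap.comp_assoc, hQ1,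
        ContinuousLinearMap.id_comp, neg_sub]
    have e2 : G ∘L Q (S p) - G' ∘L Q (S q) =
        (G - G') ∘L Q (S p) + G' ∘L (Q (S p) - Q (S q)) := by
      rw [ContinuousLinearMap.sub_comp, ContinuousLinearMap.comp_sub]; abel
    have e3 : ‖Q (S p) - Q (S q)‖ ≤ 25 / 16 * ‖G - G'‖ := by
      rw [e0, norm_neg]
      refine (ContinuousLinearMap.opNorm_comp_le _ _).trans ?_
      have e4 := (ContinuousLinearMap.opNorm_comp_le (P ∘L (G - G')) (Q (S q))).trans
        (mul_le_mul (hPl _) (hQ3 _) (norm_nonneg _) (norm_nonneg _))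
      have := mul_le_mul (hQ3 (S p)) e4 (norm_nonneg _) (by norm_num)
      linarith
    have e5 : ‖G - G'‖ ≤ Λ * (5 / 4 * ‖p - q‖) :=
      (hl _ hp _ hq).trans (mul_le_mul_of_nonneg_left (hSl p (mem_univ _) q (mem_univ _)) hΛ)
    rw [e2]
    refine (norm_add_le _ _).trans ?_
    have e6 := (ContinuousLinearMap.opNorm_comp_le (G - G') (Q (S p))).trans
      (mul_le_mul_of_nonneg_left (hQ3 (S p)) (norm_nonneg _))
    have e7 := (ContinuousLinearMap.opNorm_comp_le G' (Q (S p) - Q (S q))).trans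
      (mul_le_mul ((hge (S q)).trans he) e3 (norm_nonneg _) (by norm_num))
    -- The contributions are (5/4)² = 25/16 and (1/5)(25/16)(5/4) = 25/64. Their sum 125/64 is below
    -- 2, the factor in front of Λ.
    have e8 : 0 ≤ Λ * ‖p - q‖ := by positivity
    linarith

end Localization

/-! ### The graph in coordinates adapted to its tangent plane -/

section AdaptedMotion

variable {d m : ℕ}

/-- The tangent space has dimension d, so an orthonormal basis identifies it isometrically with ℝ^d.
This isometry extends to the whole space and is followed by a translation. -/
lemma exists_adaptedMotion (φ : Eu d → Eu m) (x₀ : Eu d) : ∃ U, AdaptedMotion φ x₀ U := by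
  set l : Eu d →L[ℝ] Amb d m := liftL (fderiv ℝ φ x₀)
  have hinj : Function.Injective (l : Eu d →ₗ[ℝ] Amb d m) := fun v w h => congrArg WithLp.fst h
  have hdim : Module.finrank ℝ (LinearMap.range (l : Eu d →ₗ[ℝ] Amb d m)) = d := by
    rw [LinearMap.finrank_range_of_inj hinj, finrank_euclideanSpace_fin]
  let b := (stdOrthonormalBasis ℝ (LinearMap.range (l : Eu d →ₗ[ℝ] Amb d m))).reindex
    (finCongr hdim)
  let inl' : Eu d →ₗᵢ[ℝ] Amb d m := ⟨(inlL d m : Eu d →ₗ[ℝ] Amb d m), norm_pt_zero_right⟩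
  let V := (inl'.comp b.repr.toLinearIsometry).extend.toLinearIsometryEquiv rfl
  have hV : ∀ v, (V (l v)).snd = 0 := fun v => by
    have e1 : V (l v) = inl' (b.repr ⟨l v, LinearMap.mem_range_self (l : Eu d →ₗ[ℝ] Amb d m) v⟩) :=
      LinearIsometry.extend_apply (inl'.comp b.repr.toLinearIsometry)
        ⟨l v, LinearMap.mem_range_self (l : Eu d →ₗ[ℝ] Amb d m) v⟩
    rw [e1]
    rfl
  refine ⟨V.toAffineIsometryEquiv.trans
    (AffineIsometryEquiv.constVAdd ℝ (Amb d m) (-V (pt x₀ (φ x₀)))), ?_, fun v => ?_⟩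
  · simp
  · exact hV v

lemma motion_apply (U : Amb d m ≃ᵃⁱ[ℝ] Amb d m) {X₀ : Amb d m} (h : U X₀ = 0) (X : Amb d m) :
    U X = U.linearIsometryEquiv (X - X₀) := by
  have := U.map_vsub X X₀
  simpa [h] using this.symm

/-- In a ball whose radius depends only on the Lipschitz constant of the gradient, the image of a
graph under an adapted motion is the graph of a flat function. -/
lemma exists_flat_graph (d m : ℕ) {ε : ℝ} (hε : 0 < ε) (hε' : ε ≤ 2 / 5) :
    ∃ L R : ℝ≥0 → ℝ, (∀ C₂, 0 ≤ L C₂) ∧ (∀ C₂, 0 < R C₂) ∧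
      ∀ (C₂ : ℝ≥0) (φ : Eu d → Eu m), ContDiff ℝ 1 φ → LipschitzWith C₂ (fderiv ℝ φ) →
      ∀ (x₀ : Eu d) (U : Amb d m ≃ᵃⁱ[ℝ] Amb d m), AdaptedMotion φ x₀ U →
      ∃ ψ : Eu d → Eu m, FlatMap ψ ε (L C₂) ∧ ψ 0 = 0 ∧ fderiv ℝ ψ 0 = 0 ∧
        LipOn (2 * C₂) (fderiv ℝ ψ) (ball 0 (R C₂)) ∧
        ∀ X ∈ ball (0 : Amb d m) (R C₂), X ∈ U '' graphSet φ ↔ X.snd = ψ X.fst := by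
  obtain ⟨c, hc, hext⟩ := exists_flat_extension (W := Eu m) (Eu d)
  -- This makes the extension's gradient at most ε/2 ≤ 1/5, and passing to the rotated graph doubles
  -- it to ε. The final radius is r/2 because the inverse map is 5/4-Lipschitz and must send the
  -- small ball into B_r.
  set r : ℝ≥0 → ℝ := fun C₂ => ε / 2 / (1 + c * C₂)
  have hr : ∀ C₂, 0 < r C₂ := fun C₂ => by positivity
  refine ⟨fun C₂ => 2 * (c * C₂), fun C₂ => r C₂ / 2, fun C₂ => by positivity,
    fun C₂ => half_pos (hr C₂), fun C₂ φ hφ hφl x₀ U hU => ?_⟩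
  set B := fderiv ℝ φ x₀
  set V := U.linearIsometryEquiv
  set g₀ : Eu d → Eu m := fun x => φ (x₀ + x) - φ x₀ - B x
  have hg₀d : ∀ x, HasFDerivAt g₀ (fderiv ℝ φ (x₀ + x) - B) x := fun x => by
    have h1 := (hφ.differentiable one_ne_zero (x₀ + x)).hasFDerivAt.comp x
      ((hasFDerivAt_id x).const_add x₀)
    exact (h1.sub_const (φ x₀)).sub B.hasFDerivAt
  have hg₀l : LipOn C₂ (fderiv ℝ g₀) univ := fun x _ y _ => by
    rw [(hg₀d x).fderiv, (hg₀d y).fderiv, sub_sub_sub_cancel_right]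
    have := hφl.dist_le_mul (x₀ + x) (x₀ + y)
    rwa [dist_eq_norm, dist_eq_norm, add_sub_add_left_eq_sub] at this
  have hg₀c : ContDiff ℝ 1 g₀ :=
    ((hφ.comp (contDiff_const.add contDiff_id)).sub contDiff_const).sub B.contDiff
  have hg₀0 : g₀ 0 = 0 := by simp [g₀]
  have hg₀1 : fderiv ℝ g₀ 0 = 0 := by rw [(hg₀d 0).fderiv, add_zero, sub_self]
  obtain ⟨g, hg, hgeq, hge, hgl⟩ := hext g₀ C₂ (r C₂) C₂.2 (hr C₂) hg₀c hg₀l hg₀0 hg₀1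
  have hsmall : c * C₂ * r C₂ ≤ ε / 2 := by
    simp only [r]
    rw [mul_div_assoc', div_le_iff₀ (by positivity)]
    nlinarith
  have hgd : ∀ x ∈ ball 0 (r C₂), fderiv ℝ g x = fderiv ℝ g₀ x := fun x hx =>
    Filter.EventuallyEq.fderiv_eq (Filter.eventuallyEq_of_mem (isOpen_ball.mem_nhds hx) hgeq)
  set Vc : Amb d m →L[ℝ] Amb d m := V.toLinearIsometry.toContinuousLinearMap
  have hVc : ∀ X, ‖Vc X‖ = ‖X‖ := V.norm_map
  set A : Eu d →L[ℝ] Eu d := fstA d m ∘L Vc ∘L liftL B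
  -- The tangent plane goes to ℝ^d, so the linear part of the graph has no vertical component after
  -- rotation, and A expands because |Av| = |(v, Bv)| ≥ |v|.
  have hA' : ∀ v, Vc (liftL B v) = pt (A v) 0 := fun v => by
    rw [← pt_eta (Vc (liftL B v))]
    exact congrArg (pt _) (hU.2 v)
  have hA : ∀ v, ‖v‖ ≤ ‖A v‖ := fun v => by
    rw [← norm_pt_zero_right (m := m) (A v), ← hA', hVc]
    exact norm_fst_le (liftL B v)
  have hnorm : ∀ {k : ℕ} (F : Amb d m →L[ℝ] Eu k), (∀ X, ‖F X‖ ≤ ‖X‖) →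
      ‖F ∘L Vc ∘L inrL d m‖ ≤ 1 := fun F hF =>
    ContinuousLinearMap.opNorm_le_bound _ zero_le_one fun s => by
      refine (hF _).trans ?_
      change ‖Vc (inrL d m s)‖ ≤ _
      rw [hVc, inrL_apply, norm_pt_zero_left, one_mul]
  set P : Eu m →L[ℝ] Eu d := fstA d m ∘L Vc ∘L inrL d m
  set N : Eu m →L[ℝ] Eu m := sndA d m ∘L Vc ∘L inrL d m
  obtain ⟨S, hS1, hS2, hS3, hψd, hψe, hψ0, hψl⟩ := exists_graph_function (P := P) (N := N) hA
    (hnorm _ norm_fst_le) (hnorm _ norm_snd_le) hg (by linarith) fun x => (hge x).trans hsmall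
  have hg0 : g 0 = 0 := by rw [hgeq 0 (mem_ball_self (hr C₂)), hg₀0]
  have hS0 : S 0 = 0 := by
    have := hS1 0
    rwa [map_zero, zero_add, hg0, map_zero] at this
  have hSball : ∀ p ∈ ball (0 : Eu d) (r C₂ / 2), S p ∈ ball (0 : Eu d) (r C₂) := fun p hp => by
    have := hS3 p (mem_univ _) 0 (mem_univ _)
    rw [hS0, sub_zero, sub_zero] at this
    rw [mem_ball_zero_iff] at hp ⊢
    linarith [hr C₂]
  have hψlip : LipOn (2 * (c * C₂)) (fderiv ℝ fun p => N (g (S p))) univ :=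
    hψl (c * C₂) univ (by positivity) hgl
  have hdecomp : ∀ x, U (pt (x₀ + x) (φ (x₀ + x))) = pt (A x + P (g₀ x)) (N (g₀ x)) := fun x => by
    have e1 : pt (x₀ + x) (φ (x₀ + x)) - pt x₀ (φ x₀) = liftL B x + inrL d m (g₀ x) := by
      rw [pt_sub, liftL_apply, inrL_apply, pt_add]
      congr 1 <;> simp [g₀]
    rw [motion_apply U hU.1, e1]
    change Vc _ = _
    rw [map_add, hA', ← pt_eta (Vc (inrL d m (g₀ x))), pt_add, zero_add]
    rfl
  refine ⟨fun p => N (g (S p)), ⟨by positivity,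
    contDiff_one_iff_fderiv.mpr ⟨hψd, continuousOn_univ.mp hψlip.continuousOn⟩,
    fun p => (hψe p).trans (by linarith), fun p q => hψlip p (mem_univ _) q (mem_univ _)⟩, ?_, ?_,
    ?_, fun X hX => ⟨?_, fun h => ?_⟩⟩
  · simp only [hS0, hg0, map_zero]
  · exact hψ0 0 (by rw [hS0, hgd 0 (mem_ball_self (hr C₂)), hg₀1])
  -- Inside B_r the extension is the original function, with gradient of Lipschitz constant C₂.
  -- Hence 2C₂ here, without the cut-off constant c that enters the global bound.
  · refine (hψl C₂ (ball 0 (r C₂)) C₂.2 ?_).mono le_rfl hSball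
    exact (hg₀l.mono le_rfl (subset_univ _)).congr hgd
  · rintro ⟨Y, ⟨y, rfl⟩, rfl⟩
    obtain ⟨x, rfl⟩ : ∃ x, y = x₀ + x := ⟨y - x₀, by abel⟩
    have hx : x ∈ ball (0 : Eu d) (r C₂) := by
      rw [mem_ball_zero_iff, motion_apply U hU.1, LinearIsometryEquiv.norm_map, pt_sub] at hX
      change _ < r C₂ / 2 at hX
      rw [mem_ball_zero_iff]
      have := norm_fst_le (pt (x₀ + x - x₀) (φ (x₀ + x) - φ x₀))
      rw [pt_fst, add_sub_cancel_left] at this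
      rw [add_sub_cancel_left] at hX
      linarith [hr C₂]
    change (U (pt (x₀ + x) (φ (x₀ + x)))).snd = N (g (S (U (pt (x₀ + x) (φ (x₀ + x)))).fst))
    rw [hdecomp, pt_snd, pt_fst, ← hgeq x hx, hS1]
  · have hx : S X.fst ∈ ball (0 : Eu d) (r C₂) := hSball _ (by
      rw [mem_ball_zero_iff] at hX ⊢
      exact (norm_fst_le X).trans_lt hX)
    refine ⟨_, ⟨x₀ + S X.fst, rfl⟩, ?_⟩
    change U (pt (x₀ + S X.fst) (φ (x₀ + S X.fst))) = X
    rw [hdecomp, ← hgeq _ hx, hS2]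
    change X.snd = N (g (S X.fst)) at h
    rw [← h, pt_eta]

/-- The motion takes X₀ to the origin, so balls about the origin are images of balls centred on Γ.
The absolute value makes the constant formally non-negative. -/
lemma AhlforsRegular.growth {φ : Eu d → Eu m} {CA : ℝ} (h : AhlforsRegular (graphSet φ) CA)
    {x₀ : Eu d} {U : Amb d m ≃ᵃⁱ[ℝ] Amb d m} (hU : AdaptedMotion φ x₀ U) (ρ : ℝ) (hρ : 0 < ρ) :
    (μHE[d] : Measure (Amb d m)).restrict (U '' graphSet φ) (ball 0 ρ) ≤
      ENNReal.ofReal (|CA| * ρ ^ d) := by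
  rw [Measure.restrict_apply measurableSet_ball, inter_comm]
  have e : U '' graphSet φ ∩ ball 0 ρ = U '' (graphSet φ ∩ ball (pt x₀ (φ x₀)) ρ) := by
    rw [image_inter U.injective, ← U.coe_toIsometryEquiv, IsometryEquiv.image_ball, U.coe_toIsometryEquiv, hU.1]
  rw [e, U.isometry.euclideanHausdorffMeasure_image]
  refine ((h _ ⟨x₀, rfl⟩ ρ hρ).2).trans (ENNReal.ofReal_le_ofReal ?_)
  exact mul_le_mul_of_nonneg_right (le_abs_self _) (by positivity)

end AdaptedMotion

end HigherCodim

namespace HigherCodim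

/-! ### Choice of the parameters and conclusion -/

section Assembly

variable {d m : ℕ}

/-- Near each of its points, the graph of a function with Lipschitz gradient is, up to a rigid
motion, the graph of a flat function to which the analysis of the change of variables applies. -/
lemma exists_localModel {η : Eu d → ℝ} {θ : Amb d m → ℝ} (hη : IsMollifier η) (hθ : IsCutoff θ)
    {K : ℝ} (hK : 1 ≤ K) : ∃ (ε C : ℝ) (L R rbar : ℝ≥0 → ℝ), (∀ C₂, 0 ≤ L C₂) ∧
      (∀ C₂, 0 < R C₂) ∧ (∀ C₂, 0 < rbar C₂) ∧
      ∀ (C₂ : ℝ≥0) (CA : ℝ) (φ : Eu d → Eu m), ContDiff ℝ 1 φ → LipschitzWith C₂ (fderiv ℝ φ) →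
        AhlforsRegular (graphSet φ) CA →
      ∀ (x₀ : Eu d) (U : Amb d m ≃ᵃⁱ[ℝ] Amb d m), AdaptedMotion φ x₀ U →
      ∀ r₀ : ℝ, 0 < r₀ → r₀ ≤ rbar C₂ →
      ∃ ψ : Eu d → Eu m, LocalGraph (U '' graphSet φ) ψ (2 * C₂) (4 * r₀) ∧
        ∀ β κ : ℝ, 1 < β → K⁻¹ ≤ κ → κ ≤ K →
          LocalModel η θ β κ K ψ (U '' graphSet φ) ε (L C₂) C |CA| (R C₂) r₀ := by
  have hK0 : 0 < K := by linarith
  obtain ⟨ε₀, C₁, hε₀, -, hC₁, hs⟩ := exists_stretch_bounds hη hθ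
  obtain ⟨C', hC', hw⟩ := exists_areaW_bounds d m
  set C := max C₁ C'
  have hC : 0 ≤ C := le_max_of_le_left hC₁
  -- The five constraints serve the stretching, the rotated graph, the lower bound for the distance,
  -- the bi-Lipschitz estimate and the area factor. None of them involves β or C₂.
  obtain ⟨ε, hε, h1, h2, h4, h5, h6⟩ : ∃ ε : ℝ, 0 < ε ∧ ε ≤ ε₀ ∧ ε ≤ 2 / 5 ∧
      ε * (96 * K ^ 3) ≤ 1 ∧ (2 + 2 * K * C) * ε ≤ (2 * K)⁻¹ ∧ C' * ε ≤ 1 / 2 := by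
    refine ⟨min (min ε₀ (2 / 5)) (min (1 / (96 * K ^ 3))
      (min ((2 * K)⁻¹ / (2 + 2 * K * C)) (1 / 2 / (C' + 1)))), by positivity,
      (min_le_left _ _).trans (min_le_left _ _), (min_le_left _ _).trans (min_le_right _ _),
      ?_, ?_, ?_⟩
    · rw [← le_div_iff₀ (by positivity)]
      exact (min_le_right _ _).trans (min_le_left _ _)
    · rw [mul_comm, ← le_div_iff₀ (by positivity)]
      exact (min_le_right _ _).trans ((min_le_right _ _).trans (min_le_left _ _))
    · have : min (min ε₀ (2 / 5)) (min (1 / (96 * K ^ 3))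
          (min ((2 * K)⁻¹ / (2 + 2 * K * C)) (1 / 2 / (C' + 1)))) ≤ 1 / 2 / (C' + 1) :=
        (min_le_right _ _).trans ((min_le_right _ _).trans (min_le_right _ _))
      refine (mul_le_mul_of_nonneg_left this hC').trans ?_
      rw [mul_div_assoc', div_le_iff₀ (by positivity)]
      linarith
  obtain ⟨L, R, hL, hR, hloc⟩ := exists_flat_graph d m hε h2
  -- The three terms give |t| ≤ 1, L r₀ ≤ ε, and room for the image of B_{r₀} inside B_{R/2}.
  refine ⟨ε, C, L, R, fun C₂ => min 1 (min (ε / (L C₂ + 1)) (R C₂ / (8 * K))), hL, hR,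
    fun C₂ => ?_, fun C₂ CA φ hφ hφl hA x₀ U hU r₀ hr hr' => ?_⟩
  · have := hL C₂
    have := hR C₂
    positivity
  obtain ⟨ψ, hflat, h0, hd0, hlip, hgraph⟩ := hloc C₂ φ hφ hφl x₀ U hU
  have hr1 : r₀ ≤ 1 := hr'.trans (min_le_left _ _)
  have hr2 : L C₂ * r₀ ≤ ε := by
    have := hr'.trans ((min_le_right _ _).trans (min_le_left _ _))
    rw [le_div_iff₀ (by linarith [hL C₂])] at this
    linarith
  have hr3 : 8 * K * r₀ ≤ R C₂ := by
    have := hr'.trans ((min_le_right _ _).trans (min_le_right _ _))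
    rw [le_div_iff₀ (by positivity)] at this
    linarith
  have hr4 : 4 * r₀ ≤ R C₂ := by
    have := mul_le_mul_of_nonneg_right hK hr.le
    linarith
  refine ⟨ψ, ⟨hflat.contDiff.contDiffOn, h0, hd0,
    fun x _ => (hflat.small x).trans (by linarith), ?_,
    fun X hX => hgraph X (ball_subset_ball hr4 hX)⟩, fun β κ hβ hκ hκ' => ?_⟩
  · refine LipschitzOnWith.of_dist_le_mul fun x hx y hy => ?_
    rw [dist_eq_norm, dist_eq_norm]
    exact hlip x (ball_subset_ball hr4 hx) y (ball_subset_ball hr4 hy)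
  · obtain ⟨a1, -, a3, a4, a5, a6⟩ := hs ψ ε (L C₂) β hflat h1 hβ.le
    obtain ⟨b1, b2⟩ := hw ψ ε (L C₂) hflat (by linarith)
    have hCL : C₁ * L C₂ ≤ C * L C₂ := mul_le_mul_of_nonneg_right (le_max_left _ _) (hL C₂)
    exact
      { mollifier := hη, flat := hflat, zero := h0, one_lt := hβ, one_le := hK, le_stretch := hκ
        stretch_le := hκ', const_nonneg := hC, ratio := a1, small := h4, small' := h5
        scal_near := a3, scal_lip := a4.mono hCL subset_rfl
        stretch_near := fun p => (a5 p).trans (mul_le_mul_of_nonneg_right (le_max_left _ _) hε.le)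
        stretch_lip := a6.mono hCL subset_rfl
        area_near := fun y => (b1 y).trans h6
        area_lip := b2.mono (mul_le_mul_of_nonneg_right (le_max_right _ _) (hL C₂)) subset_rfl
        radius_pos := hr, radius_le_one := hr1, radius_small := hr2, radius_le := hr3
        graph := by
          ext X
          refine and_congr_right fun hX => (hgraph X hX).trans ⟨fun h => ⟨X.fst, ?_⟩, ?_⟩
          · change pt X.fst (ψ X.fst) = X
            rw [← h, pt_eta]
          · rintro ⟨x, rfl⟩
            rfl
        growth_nonneg := abs_nonneg _
        growth := hA.growth hU }

end Assembly

end HigherCodim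
theorem theoremB4 (d m : ℕ) (hm : 2 ≤ m) (η : Eu d → ℝ) (hη : IsMollifier η)
    (θ : Amb d m → ℝ) (hθ : IsCutoff θ) (K : ℝ) (hK : 1 ≤ K) :
    ∃ (rbar : ℝ≥0 → ℝ) (lam : ℝ → ℝ → ℝ) (C₀ : ℝ → ℝ≥0 → ℝ → ℝ)
      (lam' : ℝ → ℝ) (rbar' : ℝ → ℝ≥0 → ℝ → ℝ),
      (∀ C₂, 0 < rbar C₂) ∧ (∀ β CA, 0 < lam β CA) ∧ (∀ β C₂ CA, 0 < C₀ β C₂ CA) ∧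
      (∀ β, 0 < lam' β) ∧ (∀ β C₂ CA, 0 < rbar' β C₂ CA) ∧
      ∀ (β : ℝ), 1 < β → ∀ (a₀ : ℝ), 0 < a₀ →
        K⁻¹ ≤ flatStretch θ a₀ β → flatStretch θ a₀ β ≤ K →
      ∀ (C₂ : ℝ≥0) (CA : ℝ) (φ : Eu d → Eu m), ContDiff ℝ 1 φ →
        LipschitzWith C₂ (fderiv ℝ φ) → AhlforsRegular (graphSet φ) CA →
      ∀ x₀ : Eu d, (∃ U, AdaptedMotion φ x₀ U) ∧
        ∀ U : Amb d m ≃ᵃⁱ[ℝ] Amb d m, AdaptedMotion φ x₀ U →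
        ∀ r₀ : ℝ, 0 < r₀ → r₀ ≤ rbar C₂ →
        ∃ ψ : Eu d → Eu m, LocalGraph (U '' graphSet φ) ψ (2 * C₂) (4 * r₀) ∧
          (∀ X ∈ ball (0 : Amb d m) r₀, ∀ Y ∈ ball (0 : Amb d m) r₀,
            ‖rho η θ a₀ β (U '' graphSet φ) ψ X - rho η θ a₀ β (U '' graphSet φ) ψ Y‖
                ≤ 2 * K * ‖X - Y‖ ∧
              ‖X - Y‖ ≤ 2 * K *
                ‖rho η θ a₀ β (U '' graphSet φ) ψ X - rho η θ a₀ β (U '' graphSet φ) ψ Y‖) ∧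
          HigherCodimC01
            (conjMatrix β (U '' graphSet φ) (rho η θ a₀ β (U '' graphSet φ) ψ))
            0 r₀ (lam β CA) (C₀ β C₂ CA) ∧
          (r₀ ≤ rbar' β C₂ CA →
            HigherCodimC01
              (conjMatrix β (U '' graphSet φ) (rho η θ a₀ β (U '' graphSet φ) ψ))
              0 r₀ (lam' β) (C₀ β C₂ CA)) := by
  obtain ⟨ε, C, L, R, rbar, hL, hR, hrbar, hloc⟩ := exists_localModel hη hθ hK
  -- The constants are wanted as functions of every real β. The condition β > 1 is moved behind
  -- them, with the value 1 for the other β, so that `choose` respects their dependence.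
  have hcond : ∀ β : ℝ, ∃ lam' : ℝ, 0 < lam' ∧ ∀ CA : ℝ, ∃ lam : ℝ, 0 < lam ∧ ∀ C₂ : ℝ≥0,
      ∃ C₀ : ℝ, 0 < C₀ ∧ ∃ rbar' : ℝ, 0 < rbar' ∧ (1 < β →
        ∀ (a₀ κ : ℝ) (ψ : Eu d → Eu m) (S : Set (Amb d m)) (r₀ : ℝ), 0 < a₀ →
          flatStretch θ a₀ β = κ → LocalModel η θ β κ K ψ S ε (L C₂) C |CA| (R C₂) r₀ →
          HigherCodimC01 (conjMatrix β S (rho η θ a₀ β S ψ)) 0 r₀ lam C₀ ∧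
          (r₀ ≤ rbar' → HigherCodimC01 (conjMatrix β S (rho η θ a₀ β S ψ)) 0 r₀ lam' C₀)) := by
    intro β
    by_cases hβ : 1 < β
    · obtain ⟨lam', h1, h2⟩ := exists_condition (one_le_two.trans hm) hη hθ hK C β hβ
      refine ⟨lam', h1, fun CA => ?_⟩
      obtain ⟨lam, h3, h4⟩ := h2 |CA|
      refine ⟨lam, h3, fun C₂ => ?_⟩
      obtain ⟨C₀, h5, rbar', h6, h7⟩ := h4 (L C₂) (R C₂) (hL C₂) (hR C₂)
      exact ⟨C₀, h5, rbar', h6, fun _ a₀ κ ψ S r₀ => h7 a₀ κ ψ S ε r₀⟩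
    · exact ⟨1, one_pos, fun _ => ⟨1, one_pos, fun _ => ⟨1, one_pos, 1, one_pos,
        fun h => absurd h hβ⟩⟩⟩
  choose lam' hlam' lam hlam C₀ hC₀ rbar' hrbar' hmain using hcond
  refine ⟨rbar, lam, fun β C₂ CA => C₀ β CA C₂, lam', fun β C₂ CA => rbar' β CA C₂, hrbar, hlam,
    fun β C₂ CA => hC₀ β CA C₂, hlam', fun β C₂ CA => hrbar' β CA C₂, ?_⟩
  intro β hβ a₀ ha hκ hκ' C₂ CA φ hφ hφl hA x₀
  refine ⟨exists_adaptedMotion φ x₀, fun U hU r₀ hr hr' => ?_⟩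
  obtain ⟨ψ, hψ, hmodel⟩ := hloc C₂ CA φ hφ hφl hA x₀ U hU r₀ hr hr'
  have H := hmodel β _ hβ hκ hκ'
  refine ⟨ψ, hψ, fun X hX Y hY => ?_, hmain β CA C₂ hβ a₀ _ ψ _ r₀ ha rfl H⟩
  rw [H.rho_eq hθ ha rfl hX, H.rho_eq hθ ha rfl hY]
  exact H.bilipschitz (H.ball_subset_tube hX) (H.ball_subset_tube hY)
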